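/- Let $n\ge 1$ and $d=n+1$. Let $D$ be a connected complex manifold of dimension $d$ (Hausdorff, second countable), let $B$ be a normal (reduced, Hausdorff) complex space of pure dimension $n=d-1$, and let $B^{reg}$ denote its regular locus. Let $f:D\to B$ be a uni-smooth fibration in curves, that is, a proper surjective holomorphic map with connected fibres such that every fibre, with its reduced structure, is a smooth compact curve. For a prime divisor (irreducible analytic subset of codimension one) $E\subset B$ put $E'=f^{-1}(E)$, let $m_f(E)\ge 1$ be the integer with $f^*(E)=m_f(E)\,E'$ over $B^{reg}$, and let $\Delta=\sum_E\bigl(1-\tfrac1{m_f(E)}\bigr)E$ be the orbifold divisor of $f$. Suppose that $f$ is given by the kernel of a nowhere vanishing holomorphic $(d-1)$-form $\omega$ on $D$: for every $x\in D$, the kernel $\{v\in T_xD : \iota_v\omega_x=0\}$ is the tangent line at $x$ of the reduced fibre of $f$ through $x$. Then: 1. $f$ has no multiple fibres in codimension one: there is an analytic subset $Z\subset B$, everywhere of codimension at least two, with $B\setminus Z\subset B^{reg}$, and $f$ is submersive over $B^{reg}$; moreover $m_f(E)=1$ for every prime divisor $E$, that is, $\Delta=0$. 2. The form descends off codimension two: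 there is a nowhere vanishing holomorphic $(d-1)$-form $\alpha$ on $B^{reg}$ with $f^*\alpha=\omega$ on $f^{-1}(B^{reg})$. 3. Consequently $K_B$ is trivial: the canonical bundle of $B^{reg}$ has a nowhere vanishing holomorphic section. -/

import Mathlib

open Set Filter Topology TopologicalSpace
open scoped Manifold ContDiff

/-- The model space `ℂⁿ`. -/
abbrev Cn (n : ℕ) : Type := EuclideanSpace ℂ (Fin n)

/-- `A ⊆ V` is an analytic subset of the open set `V ⊆ ℂᴺ`: near every point of `V` it is the
common zero set of finitely many holomorphic functions. -/
def IsAnalyticIn {N : ℕ} (V A : Set (Cn N)) : Prop :=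
  A ⊆ V ∧ ∀ p ∈ V, ∃ (k : ℕ) (g : Fin k → Cn N → ℂ), (∀ i, AnalyticAt ℂ (g i) p) ∧
    ∀ᶠ q in 𝓝 p, q ∈ A ↔ ∀ i, g i q = 0

/-- A reduced complex space: a topological space with a sheaf of complex-valued functions which is
locally isomorphic to an analytic subset `A` of an open subset of some `ℂᴺ`, with the sheaf of
functions on `A` that are locally restrictions of holomorphic functions of the ambient space.
The sheaf is given by its germs: `HolAt φ b` says that `φ` is a section of the structure sheaf
on some neighbourhood of `b`. -/
class ReducedComplexSpace (B : Type*) [TopologicalSpace B] where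
  HolAt : (B → ℂ) → B → Prop
  local_model : ∀ b : B, ∃ (N : ℕ) (U : Set B) (V : Set (Cn N)) (χ : B → Cn N),
    IsOpen U ∧ b ∈ U ∧ IsOpen V ∧ IsAnalyticIn V (χ '' U) ∧ IsEmbedding (U.domRestrict χ) ∧
    ∀ y ∈ U, ∀ φ : B → ℂ,
      HolAt φ y ↔ ∃ Φ : Cn N → ℂ, AnalyticAt ℂ Φ (χ y) ∧ φ =ᶠ[𝓝 y] Φ ∘ χ

namespace ReducedComplexSpace

section Base

variable {B : Type*} [TopologicalSpace B] [ReducedComplexSpace B]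

/-- `Z` is a (closed) analytic subset of `B`. -/
def IsAnalyticSet (Z : Set B) : Prop :=
  ∀ b : B, ∃ (k : ℕ) (g : Fin k → B → ℂ), (∀ i, HolAt (g i) b) ∧
    ∀ᶠ y in 𝓝 b, y ∈ Z ↔ ∀ i, g i y = 0

/-- The dimension at `b ∈ Z` of an analytic subset `Z`: the least number of holomorphic functions
germs vanishing at `b` for which `b` is an isolated point of their common zero set in `Z`. -/
noncomputable def localDim (Z : Set B) (b : B) : ℕ :=
  sInf {k | ∃ g : Fin k → B → ℂ, (∀ i, HolAt (g i) b ∧ g i b = 0) ∧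
    ∀ᶠ y in 𝓝 b, y ∈ Z → (∀ i, g i y = 0) → y = b}

/-- An isomorphism of an open subset of `B` with an open subset of `ℂⁿ`. -/
def IsChart {n : ℕ} (e : OpenPartialHomeomorph B (Cn n)) : Prop :=
  ∀ y ∈ e.source, ∀ φ : B → ℂ, HolAt φ y ↔ AnalyticAt ℂ (φ ∘ e.symm) (e y)

/-- The space has pure dimension `n`. -/
def IsPureDim (n : ℕ) (B : Type*) [TopologicalSpace B] [ReducedComplexSpace B] : Prop := ∀ b : B, localDim (univ : Set B) b = n

/-- The regular locus of a complex space of pure dimension `n`: the points near which the space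
is isomorphic to an open subset of `ℂⁿ`. -/
def regularLocus (n : ℕ) (B : Type*) [TopologicalSpace B] [ReducedComplexSpace B] : Opens B where
  carrier := {b | ∃ e : OpenPartialHomeomorph B (Cn n), IsChart e ∧ b ∈ e.source}
  is_open' := by
    rw [isOpen_iff_mem_nhds]
    rintro b ⟨e, he, hb⟩
    exact mem_of_superset (e.open_source.mem_nhds hb) fun y hy => ⟨e, he, hy⟩

/-- Normality of a reduced complex space of pure dimension `n`: every weakly holomorphic function
(that is, holomorphic on the regular locus and locally bounded near the singular points) on an open
set is holomorphic. -/
def IsNormal (n : ℕ) (B : Type*) [TopologicalSpace B] [ReducedComplexSpace B] : Prop :=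
  ∀ (U : Set B) (φ : B → ℂ), IsOpen U →
    (∀ b ∈ U ∩ regularLocus n B, HolAt φ b) →
    (∀ b ∈ U, ∃ C : ℝ, ∀ᶠ y in 𝓝 b, y ∈ regularLocus n B → ‖φ y‖ ≤ C) →
    ∃ ψ : B → ℂ, (∀ b ∈ U, HolAt ψ b) ∧ EqOn ψ φ (U ∩ regularLocus n B)

variable {n : ℕ}

theorem IsChart.contDiffOn_trans {e e' : OpenPartialHomeomorph B (Cn n)} (he : IsChart e)
    (he' : IsChart e') : ContDiffOn ℂ ω (e.symm ≫ₕ e') (e.symm ≫ₕ e').source := by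
  rw [contDiffOn_euclidean]
  intro i p hp
  simp only [OpenPartialHomeomorph.trans_source, OpenPartialHomeomorph.symm_source, mem_inter_iff,
    mem_preimage] at hp
  have h1 : HolAt (fun y => e' y i) (e.symm p) := by
    rw [he' _ hp.2]
    have h2 : AnalyticAt ℂ (fun q : Cn n => q i) (e' (e.symm p)) :=
      (EuclideanSpace.proj (𝕜 := ℂ) i).analyticAt _
    refine h2.congr ?_
    filter_upwards [e'.open_target.mem_nhds (e'.map_source hp.2)] with q hq
    simp [e'.right_inv hq]
  rw [he _ (e.map_target hp.1), e.right_inv hp.1] at h1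
  exact h1.contDiffAt.contDiffWithinAt

/-- The regular locus is a complex manifold, through all its holomorphic charts. -/
noncomputable instance : ChartedSpace (Cn n) (regularLocus n B) where
  atlas := {e' | ∃ (e : OpenPartialHomeomorph B (Cn n)) (h : Nonempty (regularLocus n B)),
    IsChart e ∧ e' = e.subtypeRestr h}
  chartAt b := b.2.choose.subtypeRestr ⟨b⟩
  mem_chart_source b := by
    simpa [OpenPartialHomeomorph.subtypeRestr_source] using b.2.choose_spec.2
  chart_mem_atlas b := ⟨_, ⟨b⟩, b.2.choose_spec.1, rfl⟩

instance : IsManifold 𝓘(ℂ, Cn n) ω (regularLocus n B) := by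
  apply isManifold_of_contDiffOn
  rintro _ _ ⟨e, h, he, rfl⟩ ⟨e', h', he', rfl⟩
  have hs := OpenPartialHomeomorph.subtypeRestr_symm_trans_subtypeRestr h e e'
  have h0 := he.contDiffOn_trans he'
  simp only [modelWithCornersSelf_coe, modelWithCornersSelf_coe_symm, Function.comp_id,
    Function.id_comp, preimage_id, range_id, inter_univ]
  rw [hs.1]
  refine (h0.mono ?_).congr ?_
  · rw [OpenPartialHomeomorph.restr_source]
    exact inter_subset_left
  · intro p hp
    have := hs.2 (hs.1 ▸ hp)
    simpa using this

/-- A prime divisor of a complex space of pure dimension `n`: an irreducible analytic subset of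
codimension one. -/
def IsPrimeDivisor (n : ℕ) (E : Set B) : Prop :=
  E.Nonempty ∧ IsAnalyticSet E ∧ (∀ b ∈ E, localDim E b + 1 = n) ∧
    ∀ A A' : Set B, IsAnalyticSet A → IsAnalyticSet A' → E ⊆ A ∪ A' → E ⊆ A ∨ E ⊆ A'

end Base

end ReducedComplexSpace

open ReducedComplexSpace

/-- With respect to a sheaf of functions given by its germs `Hol`, the germ of `u` at `b` generates
the ideal of holomorphic germs at `b` that vanish on `E`. -/
def IsLocalEquation {M : Type*} [TopologicalSpace M] (Hol : (M → ℂ) → M → Prop)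
    (E : Set M) (b : M) (u : M → ℂ) : Prop :=
  Hol u b ∧ (∀ᶠ y in 𝓝 b, y ∈ E → u y = 0) ∧
    ∀ φ : M → ℂ, Hol φ b → (∀ᶠ y in 𝓝 b, y ∈ E → φ y = 0) →
      ∃ h : M → ℂ, Hol h b ∧ φ =ᶠ[𝓝 b] h * u

section Forms

variable {m k : ℕ} {M : Type*} [TopologicalSpace M] [ChartedSpace (Cn m) M]

/-- Holomorphic germs of functions on a complex manifold. -/
def ManifoldHolAt (m : ℕ) {M : Type*} [TopologicalSpace M] [ChartedSpace (Cn m) M]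
    (φ : M → ℂ) (x : M) : Prop :=
  ContMDiffAt 𝓘(ℂ, Cn m) 𝓘(ℂ, ℂ) ω φ x

/-- (Not necessarily continuous) differential forms of type `(k, 0)` on an `m`-dimensional complex
manifold. -/
abbrev DForm (m k : ℕ) (M : Type*) [TopologicalSpace M] [ChartedSpace (Cn m) M] : Type _ :=
  ∀ x : M, (TangentSpace 𝓘(ℂ, Cn m) x) [⋀^Fin k]→L[ℂ] ℂ

/-- The form is holomorphic: its coefficients in local coordinates are holomorphic functions. -/
def DForm.IsHolomorphic (α : DForm m k M) : Prop :=
  ∀ (x : M) (v : Fin k → Cn m), AnalyticAt ℂ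
    (fun p : Cn m => α ((chartAt (Cn m) x).symm p) fun i =>
      mfderiv 𝓘(ℂ, Cn m) 𝓘(ℂ, Cn m) (chartAt (Cn m) x).symm p (v i))
    (chartAt (Cn m) x x)

/-- The form has no zeros. -/
def DForm.NowhereVanishing (α : DForm m k M) : Prop := ∀ x : M, α x ≠ 0

/-- `v` lies in the kernel of the form `α` at `x`: contraction of `α x` with `v` is zero. -/
def DForm.InKernel (α : DForm m k M) (x : M) (v : TangentSpace 𝓘(ℂ, Cn m) x) : Prop :=
  ∀ w : Fin k → TangentSpace 𝓘(ℂ, Cn m) x, (∃ i, w i = v) → α x w = 0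

/-- Pull-back of differential forms. -/
noncomputable def DForm.pullback {m' : ℕ} {M' : Type*} [TopologicalSpace M']
    [ChartedSpace (Cn m') M'] (g : M' → M) (α : DForm m k M) : DForm m' k M' :=
  fun x => (α (g x)).compContinuousLinearMap (mfderiv 𝓘(ℂ, Cn m') 𝓘(ℂ, Cn m) g x)

/-- `C` is, near `x ∈ C`, a one-dimensional complex submanifold: in suitable holomorphic
coordinates it is a coordinate line. -/
def IsSmoothCurveAt (n : ℕ) {D : Type*} [TopologicalSpace D] [ChartedSpace (Cn (n + 1)) D]
    (C : Set D) (x : D) : Prop :=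
  ∃ e ∈ IsManifold.maximalAtlas 𝓘(ℂ, Cn (n + 1)) ω D, x ∈ e.source ∧
    ∀ y ∈ e.source, y ∈ C ↔ ∀ i : Fin n, e y i.succ = e x i.succ

/-- `v` is tangent to `C` at `x`: it is annihilated by the differentials of all holomorphic
functions near `x` that vanish on `C`. -/
def IsTangentTo (C : Set M) (x : M) (v : TangentSpace 𝓘(ℂ, Cn m) x) : Prop :=
  ∀ φ : M → ℂ, ManifoldHolAt m φ x → (∀ᶠ y in 𝓝 x, y ∈ C → φ y = 0) →
    mfderiv 𝓘(ℂ, Cn m) 𝓘(ℂ, ℂ) φ x v = 0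

end Forms

section Fibration

variable {D B : Type*} [TopologicalSpace D] [TopologicalSpace B] [ReducedComplexSpace B]

/-- A uni-smooth fibration in curves: a proper surjective holomorphic map whose fibres are connected
and such that every fibre, with its reduced structure, is a smooth (compact, since the map is
proper) curve. -/
structure IsUniSmoothFibration (n : ℕ) [ChartedSpace (Cn (n + 1)) D] (f : C(D, B)) : Prop where
  holomorphic : ∀ (x : D) (φ : B → ℂ), HolAt φ (f x) → ManifoldHolAt (n + 1) (φ ∘ f) x
  proper : IsProperMap f
  surjective : Function.Surjective f
  connected : ∀ b : B, IsConnected (f ⁻¹' {b})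
  smooth : ∀ x : D, IsSmoothCurveAt n (f ⁻¹' {f x}) x

/-- The fibration is given by the kernel of the form `σ`: at each point the kernel of `σ` is the
tangent line of the reduced fibre. -/
def IsGivenByKernel (n : ℕ) [ChartedSpace (Cn (n + 1)) D] (f : C(D, B)) (σ : DForm (n + 1) n D) : Prop :=
  ∀ (x : D) (v : TangentSpace 𝓘(ℂ, Cn (n + 1)) x),
    σ.InKernel x v ↔ IsTangentTo (f ⁻¹' {f x}) x v

/-- The open part of `D` lying over the regular locus of the base. -/
def overReg (n : ℕ) [ChartedSpace (Cn (n + 1)) D] (f : C(D, B)) : Opens D := Opens.comap f (regularLocus n B)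

/-- The restriction of `f` over the regular locus, as a map of complex manifolds. -/
def regMap (n : ℕ) [ChartedSpace (Cn (n + 1)) D] (f : C(D, B)) (x : overReg n f) : regularLocus n B := ⟨f x, x.2⟩

/-- `f^*(E) = m E'` with `E' = f⁻¹(E)` and `m ≥ 1`, as divisors over the regular locus of the base:
if `u` is a local equation of `E` and `v` is a local equation of `E'`, then
`u ∘ f = (unit) * v ^ m`. (Some pair of such local equations is required to exist.) -/
def HasFibreMultiplicity (n : ℕ) [ChartedSpace (Cn (n + 1)) D] (f : C(D, B)) (E : Set B) (m : ℕ) : Prop :=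
  1 ≤ m ∧
  (∃ x : overReg n f, f x ∈ E ∧ (∃ u, IsLocalEquation HolAt E (f x) u) ∧
    ∃ v, IsLocalEquation (ManifoldHolAt (n + 1)) (f ⁻¹' E) (x : D) v) ∧
  ∀ x : overReg n f, f x ∈ E → ∀ (u : B → ℂ) (v : D → ℂ), IsLocalEquation HolAt E (f x) u →
    IsLocalEquation (ManifoldHolAt (n + 1)) (f ⁻¹' E) (x : D) v →
    ∃ c : D → ℂ, ManifoldHolAt (n + 1) c x ∧ c x ≠ 0 ∧ u ∘ f =ᶠ[𝓝 (x : D)] c * v ^ m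

/-- The multiplicity `m_f(E)` of `f` along the prime divisor `E` (there is only one `m` as in
`HasFibreMultiplicity`). -/
noncomputable def fibreMultiplicity (n : ℕ) [ChartedSpace (Cn (n + 1)) D] (f : C(D, B)) (E : Set B) : ℕ :=
  sInf {m | HasFibreMultiplicity n f E m}

/-- The orbifold divisor `Δ = ∑ (1 - 1 / m_f(E)) E` of `f`, as a function on prime divisors. -/
noncomputable def orbifoldDivisor (n : ℕ) [ChartedSpace (Cn (n + 1)) D] (f : C(D, B)) : {E : Set B // IsPrimeDivisor n E} → ℚ :=
  fun E => 1 - 1 / (fibreMultiplicity n f E.1 : ℚ)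

end Fibration

/-- The canonical class of a normal complex space of pure dimension `n` is trivial: the canonical
bundle of its regular locus has a nowhere vanishing holomorphic section. -/
def CanonicalClassTrivial (n : ℕ) (B : Type*) [TopologicalSpace B] [ReducedComplexSpace B] : Prop :=
  ∃ α : DForm n n (regularLocus n B), α.IsHolomorphic ∧ α.NowhereVanishing

/-!
# Smooth fibrations in curves given by the kernel of a holomorphic form

Locally on `D` there are flow boxes with coordinates `(t, z) ∈ ℂ × ℂⁿ` in which the kernel of `σ` is
spanned by `∂/∂t`. There `f` depends only on `z`, and `σ` is a nonvanishing density times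
`dz₁ ∧ … ∧ dzₙ`; the restriction of `f` to a slice `t = const` parametrizes an open part of `B`
finitely (`IsSlice`).

Let `y₁, …, yₙ` be holomorphic functions on an open part of `B`. The form
`d(y₁ ∘ f) ∧ … ∧ d(yₙ ∘ f)` is killed by the kernel of `σ`, so it is a holomorphic function times
`σ`. Along a fibre this function is constant by the maximum principle, the fibre being a compact
connected curve (`jacQuot_comp_eq`). It therefore descends to a function on `B`, the Jacobian
determinant `m y` of `y` (`baseJac`). This function is continuous, and holomorphic at the regular
points of `B` by the Riemann extension theorem, hence holomorphic everywhere, because `B` is normal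
(`HasSlices.holAt_jac`).

The degeneracy locus is the analytic set on which all `m y` vanish. Off it some `y` is a chart of `B`
(`IsSlice.exists_isChart`). The main point is that it has codimension at least two. If `k = n - 1`
functions `y` had independent differentials, on a slice, at a point of the degeneracy locus, then
along a curve in a fibre of `y` the determinant of `(φ, y)` would be the derivative of `φ` up to a
factor that does not depend on `φ`. As the determinant of a holomorphic function and `y` is again a
holomorphic function on `B`, and vanishes at the point, this can be iterated; all `φ` would be
constant along the curve (`IsSlice.not_surjective_fderiv`). So `n - 1` functions are dependent
everywhere on the degeneracy locus, by Sard's theorem they map it to a null set, and the finite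
mapping theorem bounds its dimension by `n - 2` (`HasSlices.exists_isolating`,
`HasSlices.localDim_degeneracyLocus`). At a regular point of `B` the degeneracy locus would be empty
or a hypersurface, being given by the Jacobian determinant of a chart; so it does not meet the
regular locus (`HasSlices.notMem_degeneracyLocus`).

On the regular locus, a chart `y` thus has a nonvanishing determinant `m y`, and
`dy₁ ∧ … ∧ dyₙ / m y` is a form there, whose pullback is `σ` (`invJacForm`, `pullback_invJacForm`).
In particular `f` is submersive over the regular locus. A prime divisor is not contained in the
degeneracy locus, and at a general point of it a local equation pulls back to a local equation,
whence multiplicity one (`IsLocalEquation.comp_eq_unit_mul`).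

The tools from several complex variables that this uses are proved from Osgood's lemma: holomorphic
flows, elimination by norms and the finite mapping theorem for germs of analytic sets, the Riemann
extension theorem for continuous functions, and Sard's theorem on analytic hypersurfaces.
-/

/-! ### Holomorphic functions of several variables -/

/-- Continuity on `U` together with complex differentiability along complex lines. -/
def LineHolomorphicOn {E V : Type*} [NormedAddCommGroup E] [NormedSpace ℂ E]
    [NormedAddCommGroup V] [NormedSpace ℂ V] (F : E → V) (U : Set E) : Prop :=
  ContinuousOn F U ∧ ∀ p ∈ U, ∀ v : E, DifferentiableAt ℂ (fun t : ℂ => F (p + t • v)) 0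

section Osgood

variable {E V X : Type*} [NormedAddCommGroup E] [NormedSpace ℂ E]
  [NormedAddCommGroup V] [NormedSpace ℂ V]

theorem LineHolomorphicOn.differentiableAt {F : E → V} {U : Set E} (hF : LineHolomorphicOn F U)
    {p v : E} {t : ℂ} (h : p + t • v ∈ U) : DifferentiableAt ℂ (fun t : ℂ => F (p + t • v)) t := by
  have h1 := hF.2 _ h v
  have h2 : DifferentiableAt ℂ (fun s : ℂ => s - t) t := by fun_prop
  have h3 : (fun s : ℂ => F (p + s • v)) = (fun s : ℂ => F (p + t • v + s • v)) ∘ fun s => s - t := by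
    ext s
    simp only [Function.comp_apply]
    congr 1
    module
  rw [h3]
  refine DifferentiableAt.comp t ?_ h2
  simpa using h1

theorem AnalyticOnNhd.lineHolomorphicOn {F : E → V} {U : Set E} (hF : AnalyticOnNhd ℂ F U) :
    LineHolomorphicOn F U := by
  refine ⟨hF.continuousOn, fun p hp v => ?_⟩
  have h : DifferentiableAt ℂ F (p + (0 : ℂ) • v) := by simpa using (hF p hp).differentiableAt
  exact DifferentiableAt.comp (0 : ℂ) h (by fun_prop)

/-- A function with values in `C(X, V)`, `X` compact, is holomorphic along lines if it is jointly
continuous and pointwise holomorphic along lines: by Cauchy's formula, applied with values in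
`C(X, V)`. -/
theorem lineHolomorphicOn_continuousMap [CompleteSpace V] [TopologicalSpace X] [CompactSpace X]
    {U : Set E} (hU : IsOpen U) (Φ : E → C(X, V))
    (hc : ContinuousOn (fun q : E × X => Φ q.1 q.2) (U ×ˢ univ))
    (hd : ∀ p ∈ U, ∀ (x : X) (v : E), DifferentiableAt ℂ (fun t : ℂ => Φ (p + t • v) x) 0) :
    LineHolomorphicOn Φ U := by
  have hcont : ContinuousOn Φ U := by
    rw [continuousOn_iff_continuous_domRestrict]
    refine ContinuousMap.continuous_of_continuous_uncurry _ ?_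
    have : Continuous (fun q : U × X => ((q.1 : E), q.2)) := by fun_prop
    exact hc.comp_continuous this (fun q => ⟨q.1.2, mem_univ _⟩)
  refine ⟨hcont, fun p hp v => ?_⟩
  have hl : Continuous (fun t : ℂ => p + t • v) := by fun_prop
  obtain ⟨r, hr, hrU⟩ : ∃ r > 0, Metric.closedBall (0 : ℂ) r ⊆ (fun t : ℂ => p + t • v) ⁻¹' U := by
    refine Metric.nhds_basis_closedBall.mem_iff.1 ?_
    exact hl.continuousAt (hU.mem_nhds (by simpa using hp))
  set h : ℂ → C(X, V) := fun t => Φ (p + t • v) with hh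
  have hhc : ContinuousOn h (Metric.closedBall 0 r) := hcont.comp hl.continuousOn hrU
  lift r to NNReal using hr.le
  have hci : CircleIntegrable h 0 r :=
    (hhc.mono Metric.sphere_subset_closedBall).circleIntegrable hr.le
  have h1 := (hasFPowerSeriesOn_cauchy_integral hci (by exact_mod_cast hr)).analyticAt
  refine h1.differentiableAt.congr_of_eventuallyEq ?_
  filter_upwards [Metric.ball_mem_nhds (0 : ℂ) hr] with t ht
  ext x
  have hint : CircleIntegrable (fun z => (z - t)⁻¹ • h z) 0 r := by
    refine ContinuousOn.circleIntegrable hr.le ?_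
    refine ContinuousOn.smul (ContinuousOn.inv₀ (continuousOn_id.sub continuousOn_const) ?_)
      (hhc.mono Metric.sphere_subset_closedBall)
    intro z hz h0
    rw [show z = t from sub_eq_zero.1 h0] at hz
    simp only [mem_sphere_iff_norm, Metric.mem_ball, dist_zero_right, sub_zero] at hz ht
    exact ht.ne hz
  have h2 : ((2 * Real.pi * Complex.I : ℂ)⁻¹ • ∮ z in C(0, r), (z - t)⁻¹ • h z) x
      = (2 * Real.pi * Complex.I : ℂ)⁻¹ • ∮ z in C(0, r), (z - t)⁻¹ • h z x := by
    rw [ContinuousMap.smul_apply]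
    congr 1
    have h3 := (ContinuousMap.evalCLM ℂ x : C(X, V) →L[ℂ] V).intervalIntegral_comp_comm hint.out
    simp only [circleIntegral]
    rw [← ContinuousMap.evalCLM_apply (R := ℂ), ← h3]
    simp
  rw [h2]
  have h4 : DifferentiableOn ℂ (fun t => h t x) (Metric.closedBall 0 r) := by
    intro s hs
    refine DifferentiableAt.differentiableWithinAt ?_
    have h5 : LineHolomorphicOn (fun q => Φ q x) U :=
      ⟨hc.comp (f := fun q => (q, x)) (by fun_prop) (fun q hq => ⟨hq, mem_univ _⟩),
        fun q hq w => hd q hq x w⟩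
    exact h5.differentiableAt (hrU hs)
  have h6 := Complex.two_pi_I_inv_smul_circleIntegral_sub_inv_smul_of_differentiable_on_off_countable
    (countable_empty) ht h4.continuousOn
    (fun z hz => (h4.differentiableAt (Metric.closedBall_mem_nhds_of_mem hz.1)))
  simpa using h6.symm

/-- The Cauchy integral as a bilinear map of the function and the kernel. -/
theorem exists_circleIntegral_bilin [CompleteSpace V] (c : ℂ) (r : ℝ) (hr : 0 ≤ r) :
    ∃ B : C(Metric.sphere c r, V) →L[ℂ] C(Metric.sphere c r, ℂ) →L[ℂ] V,
      ∀ (h : ℂ → V) (k : ℂ → ℂ) (h' : C(Metric.sphere c r, V)) (k' : C(Metric.sphere c r, ℂ)),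
        (∀ w : Metric.sphere c r, h w = h' w) →
        (∀ w : Metric.sphere c r, k w = k' w) → B h' k' = ∮ z in C(c, r), k z • h z := by
  let γ : ℝ → Metric.sphere c r := fun θ => ⟨circleMap c r θ, circleMap_mem_sphere c hr θ⟩
  have hγ : Continuous γ := (continuous_circleMap c r).subtype_mk _
  have hd : Continuous (deriv (circleMap c r)) := by
    have : deriv (circleMap c r) = fun θ => circleMap 0 r θ * Complex.I := by
      ext θ; simp
    rw [this]
    exact (continuous_circleMap 0 r).mul continuous_const
  have hcont : ∀ (h : C(Metric.sphere c r, V)) (k : C(Metric.sphere c r, ℂ)),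
      Continuous fun θ => deriv (circleMap c r) θ • k (γ θ) • h (γ θ) := by
    intro h k
    exact hd.smul ((k.continuous.comp hγ).smul (h.continuous.comp hγ))
  let B0 : C(Metric.sphere c r, V) →ₗ[ℂ] C(Metric.sphere c r, ℂ) →ₗ[ℂ] V :=
    LinearMap.mk₂ ℂ (fun h k => ∫ θ in (0)..(2 * Real.pi),
        deriv (circleMap c r) θ • k (γ θ) • h (γ θ))
      (fun h h' k => by
        rw [← intervalIntegral.integral_add ((hcont h k).intervalIntegrable _ _)
          ((hcont h' k).intervalIntegrable _ _)]
        simp [smul_add])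
      (fun a h k => by
        rw [← intervalIntegral.integral_smul]
        congr 1; ext θ
        simp only [ContinuousMap.smul_apply]
        rw [smul_comm a, smul_comm a])
      (fun h k k' => by
        rw [← intervalIntegral.integral_add ((hcont h k).intervalIntegrable _ _)
          ((hcont h k').intervalIntegrable _ _)]
        simp [smul_add, add_smul])
      (fun a h k => by
        rw [← intervalIntegral.integral_smul]
        congr 1; ext θ
        simp only [ContinuousMap.smul_apply]
        rw [smul_comm a, smul_assoc])
  refine ⟨LinearMap.mkContinuous₂ B0 (r * |2 * Real.pi - 0|) ?_, ?_⟩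
  · intro h k
    have := intervalIntegral.norm_integral_le_of_norm_le_const (a := 0) (b := 2 * Real.pi)
      (f := fun θ => deriv (circleMap c r) θ • k (γ θ) • h (γ θ)) (C := r * (‖k‖ * ‖h‖)) ?_
    · calc ‖B0 h k‖ ≤ _ := this
        _ = _ := by ring
    · intro θ _
      rw [norm_smul, norm_smul]
      have h1 : ‖deriv (circleMap c r) θ‖ = r := by simp [abs_of_nonneg hr]
      rw [h1]
      gcongr
      · exact k.norm_coe_le_norm _
      · exact h.norm_coe_le_norm _
  · intro h k h' k' hh hk
    simp only [LinearMap.mkContinuous₂_apply]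
    simp only [B0, LinearMap.mk₂_apply, circleIntegral]
    refine intervalIntegral.integral_congr fun θ _ => ?_
    change _ • k' (γ θ) • h' (γ θ) = _ • k (γ θ : ℂ) • h (γ θ : ℂ)
    rw [hh, hk]

/-- The inductive step of Osgood's lemma: one more complex variable. -/
theorem analyticAt_prod_of_lineHolomorphicOn [CompleteSpace V]
    (ih : ∀ (U : Set E), IsOpen U → ∀ (c : ℂ) (r : ℝ) (Φ : E → C(Metric.sphere c r, V)),
      LineHolomorphicOn Φ U → AnalyticOnNhd ℂ Φ U)
    {U : Set (E × ℂ)} (hU : IsOpen U) {F : E × ℂ → V} (hF : LineHolomorphicOn F U) :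
    AnalyticOnNhd ℂ F U := by
  rintro ⟨p, c⟩ hp
  obtain ⟨r, hr, hrU⟩ := Metric.nhds_basis_closedBall.mem_iff.1 (hU.mem_nhds hp)
  rw [← closedBall_prod_same] at hrU
  classical
  let k : E × Metric.sphere c r → E × ℂ := fun q => (q.1, q.2)
  have hk : Continuous k := by fun_prop
  have hsub : ∀ z ∈ Metric.ball p r, ∀ w ∈ Metric.closedBall c r, (z, w) ∈ U :=
    fun z hz w hw => hrU ⟨Metric.ball_subset_closedBall hz, hw⟩
  have hcont : ∀ z ∈ Metric.ball p r, Continuous fun w : Metric.sphere c r => F (z, w) := by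
    intro z hz
    refine hF.1.comp_continuous (f := fun w : Metric.sphere c r => (z, (w : ℂ))) (by fun_prop) ?_
    exact fun w => hsub z hz w (Metric.sphere_subset_closedBall w.2)
  let Φ : E → C(Metric.sphere c r, V) := fun z =>
    if hz : z ∈ Metric.ball p r then ⟨fun w => F (z, w), hcont z hz⟩ else 0
  have hΦ : ∀ z ∈ Metric.ball p r, ∀ w, Φ z w = F (z, w) := by
    intro z hz w
    simp only [Φ, dif_pos hz]
    rfl
  have hΦl : LineHolomorphicOn Φ (Metric.ball p r) := by
    refine lineHolomorphicOn_continuousMap Metric.isOpen_ball Φ ?_ ?_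
    · refine ContinuousOn.congr (f := F ∘ k) (hF.1.comp hk.continuousOn ?_) ?_
      · rintro ⟨z, w⟩ ⟨hz, -⟩
        exact hsub z hz w (Metric.sphere_subset_closedBall w.2)
      · rintro ⟨z, w⟩ ⟨hz, -⟩
        exact hΦ z hz w
    · intro z hz w v
      have h1 := hF.2 _ (hsub z hz w (Metric.sphere_subset_closedBall w.2)) (v, 0)
      refine h1.congr_of_eventuallyEq ?_
      have hl : ContinuousAt (fun t : ℂ => z + t • v) 0 := by fun_prop
      filter_upwards [hl.preimage_mem_nhds (Metric.isOpen_ball.mem_nhds (by simpa using hz))]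
        with t ht
      rw [hΦ _ ht]
      simp
  have hΦa := ih _ Metric.isOpen_ball c r Φ hΦl p (Metric.mem_ball_self hr)
  obtain ⟨B, hB⟩ := exists_circleIntegral_bilin (V := V) c r hr.le
  let inc : C(Metric.sphere c r, ℂ) := ⟨fun w => w, by fun_prop⟩
  let κ : ℂ → C(Metric.sphere c r, ℂ) := fun ζ => Ring.inverse (inc - algebraMap ℂ _ ζ)
  have hunit : ∀ ζ ∈ Metric.ball c r, IsUnit (inc - algebraMap ℂ C(Metric.sphere c r, ℂ) ζ) := by
    intro ζ hζ
    rw [ContinuousMap.isUnit_iff_forall_ne_zero]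
    intro w h0
    have h1 : (w : ℂ) = ζ := by simpa [inc, sub_eq_zero] using h0
    have h2 := w.2
    rw [h1] at h2
    exact (Metric.mem_ball.1 hζ).ne h2
  have hκ : ∀ ζ ∈ Metric.ball c r, ∀ w, κ ζ w = ((w : ℂ) - ζ)⁻¹ := by
    intro ζ hζ w
    have h1 := congrArg (fun g : C(Metric.sphere c r, ℂ) => g w) (Ring.inverse_mul_cancel _ (hunit ζ hζ))
    simp only [ContinuousMap.mul_apply, ContinuousMap.one_apply, ContinuousMap.sub_apply] at h1
    exact eq_inv_of_mul_eq_one_left h1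
  have hκa : AnalyticAt ℂ κ c := by
    obtain ⟨u, hu⟩ := hunit c (Metric.mem_ball_self hr)
    have h1 : AnalyticAt ℂ (Ring.inverse : C(Metric.sphere c r, ℂ) → _)
        (inc - algebraMap ℂ _ c) := by
      rw [← hu]; exact analyticAt_inverse u
    refine h1.comp (f := fun ζ : ℂ => inc - algebraMap ℂ C(Metric.sphere c r, ℂ) ζ)
      (analyticAt_const.sub ?_)
    exact (Algebra.linearMap ℂ C(Metric.sphere c r, ℂ)).toContinuousLinearMap.analyticAt c
  have hfin : AnalyticAt ℂ (fun q : E × ℂ => (2 * Real.pi * Complex.I : ℂ)⁻¹ • B (Φ q.1) (κ q.2))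
      (p, c) := by
    have h1 : AnalyticAt ℂ (fun q : E × ℂ => Φ q.1) (p, c) := hΦa.comp_of_eq analyticAt_fst rfl
    have h2 : AnalyticAt ℂ (fun q : E × ℂ => κ q.2) (p, c) := hκa.comp_of_eq analyticAt_snd rfl
    exact analyticAt_const.smul
      ((B.analyticAt_bilinear (Φ p, κ c)).comp_of_eq (h1.prod h2) rfl)
  refine hfin.congr ?_
  filter_upwards [prod_mem_nhds (Metric.ball_mem_nhds p hr) (Metric.ball_mem_nhds c hr)]
  rintro ⟨z, ζ⟩ ⟨hz, hζ⟩
  simp only at hz hζ ⊢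
  rw [hB (fun w => F (z, w)) (fun w => (w - ζ)⁻¹) _ _ (fun w => (hΦ z hz w).symm)
    (fun w => (hκ ζ hζ w).symm)]
  have hline : (fun s : ℂ => F (z, s)) = fun s => F ((z, 0) + s • ((0 : E), (1 : ℂ))) := by
    ext s; simp
  have h4 : ∀ s ∈ Metric.closedBall c r, DifferentiableAt ℂ (fun s : ℂ => F (z, s)) s := by
    intro s hs
    rw [hline]
    refine hF.differentiableAt ?_
    simpa using hsub z hz s hs
  exact Complex.two_pi_I_inv_smul_circleIntegral_sub_inv_smul_of_differentiable_on_off_countable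
    (countable_empty) hζ (fun s hs => (h4 s hs).continuousAt.continuousWithinAt)
    (fun s hs => h4 s (Metric.ball_subset_closedBall hs.1))

theorem LineHolomorphicOn.comp_continuousLinearEquiv {E' : Type*} [NormedAddCommGroup E']
    [NormedSpace ℂ E'] (e : E' ≃L[ℂ] E) {U : Set E} {F : E → V} (hF : LineHolomorphicOn F U) :
    LineHolomorphicOn (F ∘ e) (e ⁻¹' U) := by
  refine ⟨hF.1.comp e.continuous.continuousOn fun _ h => h, fun p hp v => ?_⟩
  simpa using hF.2 _ hp (e v)

end Osgood

theorem LineHolomorphicOn.analyticOnNhd_pi (n : ℕ) : ∀ {V : Type*} [NormedAddCommGroup V]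
    [NormedSpace ℂ V] [CompleteSpace V] {U : Set (Fin n → ℂ)} (_ : IsOpen U)
    {F : (Fin n → ℂ) → V} (_ : LineHolomorphicOn F U), AnalyticOnNhd ℂ F U := by
  induction n with
  | zero =>
    intro V _ _ _ U _ F _ p _
    have : F = fun _ => F p := by ext q; rw [Subsingleton.elim q p]
    rw [this]
    exact analyticAt_const
  | succ n ih =>
    intro V _ _ _ U hU F hF
    let e : (Fin (n + 1) → ℂ) ≃L[ℂ] (Fin n → ℂ) × ℂ :=
      (Fin.consEquivL ℂ (fun _ : Fin (n + 1) => ℂ)).symm.trans (ContinuousLinearEquiv.prodComm ℂ _ _)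
    have h1 := hF.comp_continuousLinearEquiv e.symm
    have h2 := analyticAt_prod_of_lineHolomorphicOn
      (fun U hU c r Φ hΦ => ih hU hΦ) (hU.preimage e.symm.continuous) h1
    intro p hp
    have h3 := (h2 (e p) (by simpa using hp)).comp (e.analyticAt p)
    refine h3.congr (Eventually.of_forall fun q => ?_)
    simp

/-- **Osgood's lemma**: a continuous function on an open subset of a finite-dimensional space which
is holomorphic along complex lines is analytic. -/
theorem LineHolomorphicOn.analyticOnNhd {E V : Type*} [NormedAddCommGroup E] [NormedSpace ℂ E]
    [FiniteDimensional ℂ E] [NormedAddCommGroup V] [NormedSpace ℂ V] [CompleteSpace V]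
    {U : Set E} (hU : IsOpen U) {F : E → V} (hF : LineHolomorphicOn F U) :
    AnalyticOnNhd ℂ F U := by
  let e : E ≃L[ℂ] (Fin (Module.finrank ℂ E) → ℂ) :=
    ContinuousLinearEquiv.ofFinrankEq (by simp)
  have h2 := LineHolomorphicOn.analyticOnNhd_pi _ (hU.preimage e.symm.continuous)
    (hF.comp_continuousLinearEquiv e.symm)
  intro p hp
  have h3 := (h2 (e p) (by simpa using hp)).comp (e.analyticAt p)
  refine h3.congr (Eventually.of_forall fun q => ?_)
  simp

/-- Integrals over a compact interval depend holomorphically on parameters. -/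
theorem AnalyticOnNhd.intervalIntegral_param {E V : Type*} [NormedAddCommGroup E] [NormedSpace ℂ E]
    [FiniteDimensional ℂ E] [NormedAddCommGroup V] [NormedSpace ℂ V] [CompleteSpace V]
    {U : Set E} (hU : IsOpen U) {a b : ℝ} (hab : a ≤ b) {F : E → ℝ → V}
    (hc : ContinuousOn (fun q : E × ℝ => F q.1 q.2) (U ×ˢ Icc a b))
    (hd : ∀ s ∈ Icc a b, AnalyticOnNhd ℂ (fun z => F z s) U) :
    AnalyticOnNhd ℂ (fun z => ∫ s in a..b, F z s) U := by
  classical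
  have hcont : ∀ z ∈ U, Continuous fun w : Icc a b => F z w := by
    intro z hz
    exact hc.comp_continuous (f := fun w : Icc a b => (z, (w : ℝ))) (by fun_prop)
      (fun w => ⟨hz, w.2⟩)
  let Φ : E → C(Icc a b, V) := fun z =>
    if hz : z ∈ U then ⟨fun w => F z w, hcont z hz⟩ else 0
  have hΦ : ∀ z ∈ U, ∀ w, Φ z w = F z w := by
    intro z hz w
    simp only [Φ, dif_pos hz]
    rfl
  have hΦl : LineHolomorphicOn Φ U := by
    refine lineHolomorphicOn_continuousMap hU Φ ?_ ?_
    · have hk : Continuous fun q : E × Icc a b => (q.1, (q.2 : ℝ)) := by fun_prop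
      refine ContinuousOn.congr (hc.comp hk.continuousOn ?_) ?_
      · rintro ⟨z, w⟩ ⟨hz, -⟩
        exact ⟨hz, w.2⟩
      · rintro ⟨z, w⟩ ⟨hz, -⟩
        exact hΦ z hz w
    · intro z hz w v
      have h1 := (hd w w.2).lineHolomorphicOn.2 z hz v
      refine h1.congr_of_eventuallyEq ?_
      have hl : ContinuousAt (fun t : ℂ => z + t • v) 0 := by fun_prop
      filter_upwards [hl.preimage_mem_nhds (hU.mem_nhds (by simpa using hz))] with t ht
      rw [hΦ _ ht]
  have hΦa := hΦl.analyticOnNhd hU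
  let γ : ℝ → Icc a b := projIcc a b hab
  have hγ : Continuous γ := continuous_projIcc
  let L0 : C(Icc a b, V) →ₗ[ℂ] V :=
    { toFun := fun h => ∫ s in a..b, h (γ s)
      map_add' := fun h h' => by
        exact intervalIntegral.integral_add ((h.continuous.comp hγ).intervalIntegrable _ _)
          ((h'.continuous.comp hγ).intervalIntegrable _ _)
      map_smul' := fun c h => by
        exact intervalIntegral.integral_smul c _ }
  let L : C(Icc a b, V) →L[ℂ] V := L0.mkContinuous |b - a| fun h => by
    rw [mul_comm]
    exact intervalIntegral.norm_integral_le_of_norm_le_const fun s _ => h.norm_coe_le_norm _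
  intro z hz
  refine ((L.analyticAt _).comp (hΦa z hz)).congr ?_
  filter_upwards [hU.mem_nhds hz] with q hq
  change ∫ s in a..b, Φ q (γ s) = _
  refine intervalIntegral.integral_congr fun s hs => ?_
  rw [uIcc_of_le hab] at hs
  simp only [hΦ q hq, γ, projIcc_of_mem hab hs]

/-- Contour integrals depend holomorphically on parameters. -/
theorem AnalyticOnNhd.circleIntegral_param {E V : Type*} [NormedAddCommGroup E] [NormedSpace ℂ E]
    [FiniteDimensional ℂ E] [NormedAddCommGroup V] [NormedSpace ℂ V] [CompleteSpace V]
    {U : Set E} (hU : IsOpen U) {c : ℂ} {r : ℝ} (hr : 0 ≤ r) {F : E × ℂ → V}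
    (hF : AnalyticOnNhd ℂ F (U ×ˢ Metric.sphere c r)) :
    AnalyticOnNhd ℂ (fun z => ∮ w in C(c, r), F (z, w)) U := by
  refine AnalyticOnNhd.intervalIntegral_param hU Real.two_pi_pos.le
    (F := fun z θ => deriv (circleMap c r) θ • F (z, circleMap c r θ)) ?_ ?_
  · have hd : Continuous (deriv (circleMap c r)) := by
      have : deriv (circleMap c r) = fun θ => circleMap 0 r θ * Complex.I := by
        ext θ; simp
      rw [this]
      exact (continuous_circleMap 0 r).mul continuous_const
    have hk : Continuous fun q : E × ℝ => (q.1, circleMap c r q.2) :=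
      continuous_fst.prodMk ((continuous_circleMap c r).comp continuous_snd)
    refine (hd.comp continuous_snd).continuousOn.smul (hF.continuousOn.comp hk.continuousOn ?_)
    rintro ⟨z, θ⟩ ⟨hz, -⟩
    exact ⟨hz, circleMap_mem_sphere c hr θ⟩
  · intro θ _ z hz
    refine analyticAt_const.smul ?_
    exact (hF (z, circleMap c r θ) ⟨hz, circleMap_mem_sphere c hr θ⟩).comp_of_eq
      (analyticAt_id.prod analyticAt_const) rfl

/-! ### Holomorphic flows and local inverses -/

/-- Holomorphic inverse function theorem, with analyticity on the whole source and target. -/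
theorem AnalyticAt.exists_openPartialHomeomorph {E E' : Type*} [NormedAddCommGroup E]
    [NormedSpace ℂ E] [CompleteSpace E] [NormedAddCommGroup E'] [NormedSpace ℂ E']
    [CompleteSpace E']
    {g : E → E'} {p : E} (hg : AnalyticAt ℂ g p) (e : E ≃L[ℂ] E')
    (he : HasFDerivAt g (e : E →L[ℂ] E') p) {O : Set E} (hO : O ∈ 𝓝 p) :
    ∃ Φ : OpenPartialHomeomorph E E', p ∈ Φ.source ∧ Φ.source ⊆ O ∧ (Φ : E → E') = g ∧
      AnalyticOnNhd ℂ g Φ.source ∧ AnalyticOnNhd ℂ Φ.symm Φ.target := by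
  have hs : HasStrictFDerivAt g (e : E →L[ℂ] E') p := by
    have := hg.hasStrictFDerivAt
    rwa [he.fderiv] at this
  let Φ := hs.toOpenPartialHomeomorph g
  have h1 : {q | AnalyticAt ℂ g q} ∩ {q | fderiv ℂ g q ∈ range ((↑) : (E ≃L[ℂ] E') → E →L[ℂ] E')}
      ∩ O ∈ 𝓝 p := by
    refine inter_mem (inter_mem hg.eventually_analyticAt ?_) hO
    exact hg.fderiv.continuousAt.preimage_mem_nhds
      (ContinuousLinearEquiv.isOpen.mem_nhds ⟨e, he.fderiv.symm⟩)
  obtain ⟨N, hN, hNo, hpN⟩ := mem_nhds_iff.1 h1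
  refine ⟨Φ.restrOpen N hNo, ⟨hs.mem_toOpenPartialHomeomorph_source, hpN⟩, ?_, rfl, ?_, ?_⟩
  · exact fun q hq => (hN hq.2).2
  · exact fun q hq => (hN hq.2).1.1
  · intro q hq
    have hq' := (Φ.restrOpen N hNo).map_target hq
    obtain ⟨⟨ha, e', he'⟩, -⟩ := hN hq'.2
    refine ContDiffAt.analyticAt ?_
    refine OpenPartialHomeomorph.contDiffAt_symm (Φ.restrOpen N hNo) (f₀' := e') hq ?_ ?_
    · rw [he']
      exact ha.differentiableAt.hasFDerivAt
    · exact ha.contDiffAt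

section Flow

variable {W : Type*} [NormedAddCommGroup W] [NormedSpace ℂ W] [FiniteDimensional ℂ W]

open Classical in
/-- Picard iterates of the equation `∂ₜ X = F (t, X)`, `X (0, z) = z`, in complex time. -/
noncomputable def picardIterate (F : ℂ × W → W) : ℕ → ℂ × W → W
  | 0 => Prod.snd
  | k + 1 => fun q => q.2 + ∫ s in (0 : ℝ)..1, q.1 • F (s • q.1, picardIterate F k (s • q.1, q.2))

/-- The flow of a holomorphic vector field is holomorphic in time and initial value jointly: the uniform
limit of the Picard iterates is holomorphic along lines, so that Osgood's lemma applies. -/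
theorem exists_holomorphic_flow_on {F : ℂ × W → W} {R M r : ℝ} {K : NNReal}
    (hr : 0 < r) (hrR : r < R) (hM : 0 ≤ M) (hF : AnalyticOnNhd ℂ F (Metric.ball 0 R))
    (hFM : ∀ q ∈ Metric.ball 0 R, ‖F q‖ ≤ M) (hFK : LipschitzOnWith K F (Metric.ball 0 R))
    (hrM : r * M ≤ R / 2) (hrK : r * K ≤ 1 / 2) :
    ∃ X : ℂ × W → W, AnalyticOnNhd ℂ X (Metric.ball 0 r ×ˢ Metric.ball 0 (R / 2)) ∧
      (∀ z ∈ Metric.ball (0 : W) (R / 2), X (0, z) = z) ∧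
      (∀ q ∈ Metric.ball (0 : ℂ) r ×ˢ Metric.ball (0 : W) (R / 2),
        HasDerivAt (fun t => X (t, q.2)) (F (q.1, X q)) q.1) := by
  set U : Set (ℂ × W) := Metric.ball 0 r ×ˢ Metric.ball 0 (R / 2) with hUdef
  have hU : IsOpen U := Metric.isOpen_ball.prod Metric.isOpen_ball
  set P := picardIterate F with hP
  have hstar : ∀ q ∈ U, ∀ s ∈ Icc (0 : ℝ) 1, (s • q.1, q.2) ∈ U := by
    rintro ⟨t, z⟩ ⟨ht, hz⟩ s hs
    refine ⟨?_, hz⟩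
    simp only [Metric.mem_ball, dist_zero_right, norm_smul, Real.norm_eq_abs] at ht ⊢
    rw [abs_of_nonneg hs.1]
    nlinarith [norm_nonneg t, hs.2]
  have hball : ∀ q ∈ U, ∀ x : W, ‖x‖ ≤ ‖q.2‖ + r * M → ∀ s ∈ Icc (0 : ℝ) 1,
      ((s • q.1, x) : ℂ × W) ∈ Metric.ball 0 R := by
    intro q hq x hx s hs
    have h1 := (hstar q hq s hs).1
    have h2 := hq.2
    simp only [Metric.mem_ball, dist_zero_right] at h1 h2 ⊢
    rw [Prod.norm_mk, max_lt_iff]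
    exact ⟨by linarith, by linarith⟩
  -- analyticity and bound of the integral operator
  have hop : ∀ Y : ℂ × W → W, AnalyticOnNhd ℂ Y U → (∀ q ∈ U, ‖Y q‖ ≤ ‖q.2‖ + r * M) →
      AnalyticOnNhd ℂ (fun q : ℂ × W => q.2 + ∫ s in (0 : ℝ)..1,
        q.1 • F (s • q.1, Y (s • q.1, q.2))) U := by
    intro Y hY hYb
    have hmem : ∀ q ∈ U, ∀ s ∈ Icc (0 : ℝ) 1,
        (s • q.1, Y (s • q.1, q.2)) ∈ Metric.ball (0 : ℂ × W) R :=
      fun q hq s hs => hball q hq _ (hYb (s • q.1, q.2) (hstar q hq s hs)) s hs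
    refine AnalyticOnNhd.add analyticOnNhd_snd ?_
    refine AnalyticOnNhd.intervalIntegral_param hU zero_le_one ?_ ?_
    · refine ContinuousOn.smul (by fun_prop) ?_
      refine hF.continuousOn.comp (ContinuousOn.prodMk (by fun_prop) ?_) ?_
      · exact hY.continuousOn.comp (by fun_prop) fun q hq => hstar q.1 hq.1 q.2 hq.2
      · exact fun q hq => hmem q.1 hq.1 q.2 hq.2
    · intro s hs q hq
      have h0 : AnalyticAt ℂ (fun q : ℂ × W => s • q.1) q := by
        have : (fun q : ℂ × W => s • q.1) = fun q => (s : ℂ) • q.1 := by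
          ext q; simp
        rw [this]
        exact analyticAt_const.fun_smul analyticAt_fst
      have h1 : AnalyticAt ℂ (fun q : ℂ × W => Y (s • q.1, q.2)) q :=
        (hY _ (hstar q hq s hs)).comp_of_eq (h0.prod analyticAt_snd) rfl
      exact analyticAt_fst.fun_smul ((hF _ (hmem q hq s hs)).comp_of_eq (h0.prod h1) rfl)
  have hint : ∀ Y : ℂ × W → W, ContinuousOn Y U → (∀ q ∈ U, ‖Y q‖ ≤ ‖q.2‖ + r * M) → ∀ q ∈ U,
      IntervalIntegrable (fun s : ℝ => q.1 • F (s • q.1, Y (s • q.1, q.2)))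
        MeasureTheory.volume 0 1 := by
    intro Y hY hYb q hq
    refine ContinuousOn.intervalIntegrable_of_Icc zero_le_one ?_
    refine ContinuousOn.smul continuousOn_const ?_
    refine hF.continuousOn.comp (ContinuousOn.prodMk (by fun_prop) ?_) ?_
    · exact hY.comp (by fun_prop) fun s hs => hstar q hq s hs
    · exact fun s hs => hball q hq _ (hYb (s • q.1, q.2) (hstar q hq s hs)) s hs
  have hbd : ∀ Y : ℂ × W → W, (∀ q ∈ U, ‖Y q‖ ≤ ‖q.2‖ + r * M) → ∀ q ∈ U,
      ‖q.2 + ∫ s in (0 : ℝ)..1, q.1 • F (s • q.1, Y (s • q.1, q.2))‖ ≤ ‖q.2‖ + r * M := by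
    intro Y hYb q hq
    refine (norm_add_le _ _).trans (add_le_add_right ?_ _)
    have := intervalIntegral.norm_integral_le_of_norm_le_const (a := 0) (b := 1)
      (f := fun s : ℝ => q.1 • F (s • q.1, Y (s • q.1, q.2))) (C := r * M) ?_
    · simpa using this
    · intro s hs
      rw [uIoc_of_le zero_le_one] at hs
      rw [norm_smul]
      have h1 := hq.1
      simp only [Metric.mem_ball, dist_zero_right] at h1
      exact mul_le_mul h1.le (hFM _ (hball q hq _ (hYb (s • q.1, q.2) (hstar q hq s (Ioc_subset_Icc_self hs))) s
        (Ioc_subset_Icc_self hs))) (norm_nonneg _) hr.le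
  have hdiff : ∀ Y Y' : ℂ × W → W, ContinuousOn Y U → ContinuousOn Y' U →
      (∀ q ∈ U, ‖Y q‖ ≤ ‖q.2‖ + r * M) → (∀ q ∈ U, ‖Y' q‖ ≤ ‖q.2‖ + r * M) →
      ∀ C : ℝ, (∀ q ∈ U, dist (Y q) (Y' q) ≤ C) → ∀ q ∈ U,
      dist (q.2 + ∫ s in (0 : ℝ)..1, q.1 • F (s • q.1, Y (s • q.1, q.2)))
        (q.2 + ∫ s in (0 : ℝ)..1, q.1 • F (s • q.1, Y' (s • q.1, q.2))) ≤ C / 2 := by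
    intro Y Y' hYc hYc' hY hY' C hC q hq
    rw [dist_add_left, dist_eq_norm, ← intervalIntegral.integral_sub (hint Y hYc hY q hq)
      (hint Y' hYc' hY' q hq)]
    have hC0 : 0 ≤ C := dist_nonneg.trans (hC q hq)
    have := intervalIntegral.norm_integral_le_of_norm_le_const (a := 0) (b := 1)
      (f := fun s : ℝ => q.1 • F (s • q.1, Y (s • q.1, q.2)) -
        q.1 • F (s • q.1, Y' (s • q.1, q.2))) (C := C / 2) ?_
    · simpa using this
    · intro s hs
      rw [uIoc_of_le zero_le_one] at hs
      have hs' := Ioc_subset_Icc_self hs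
      rw [← smul_sub, norm_smul]
      have h1 := hq.1
      simp only [Metric.mem_ball, dist_zero_right] at h1
      have h2 := hFK.dist_le_mul _ (hball q hq _ (hY (s • q.1, q.2) (hstar q hq s hs')) s hs') _
        (hball q hq _ (hY' (s • q.1, q.2) (hstar q hq s hs')) s hs')
      rw [dist_eq_norm] at h2
      have h3 : dist ((s • q.1, Y (s • q.1, q.2)) : ℂ × W) (s • q.1, Y' (s • q.1, q.2)) ≤ C := by
        rw [dist_prod_same_left]
        exact hC _ (hstar q hq s hs')
      calc _ ≤ r * (K * C) := by
            refine mul_le_mul h1.le (h2.trans ?_) (norm_nonneg _) hr.le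
            exact mul_le_mul_of_nonneg_left h3 K.2
        _ = (r * K) * C := by ring
        _ ≤ 1 / 2 * C := by gcongr
        _ = C / 2 := by ring
  have hPk : ∀ k, AnalyticOnNhd ℂ (P k) U ∧ ∀ q ∈ U, ‖P k q‖ ≤ ‖q.2‖ + r * M := by
    intro k
    induction k with
    | zero =>
      refine ⟨analyticOnNhd_snd, fun q _ => ?_⟩
      have : 0 ≤ r * M := by positivity
      change ‖q.2‖ ≤ _
      linarith
    | succ k ih => exact ⟨hop _ ih.1 ih.2, hbd _ ih.2⟩
  have hPd : ∀ k, ∀ q ∈ U, dist (P k q) (P (k + 1) q) ≤ R * (1 / 2) ^ k := by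
    intro k
    induction k with
    | zero =>
      intro q hq
      have h1 := (hPk 1).2 q hq
      have h2 := hq.2
      simp only [Metric.mem_ball, dist_zero_right] at h2
      have : dist (P 0 q) (P 1 q) ≤ r * M := by
        have h3 := intervalIntegral.norm_integral_le_of_norm_le_const (a := 0) (b := 1)
          (f := fun s : ℝ => q.1 • F (s • q.1, P 0 (s • q.1, q.2))) (C := r * M) ?_
        · rw [dist_comm, dist_eq_norm]
          change ‖(q.2 + _) - q.2‖ ≤ _
          rw [add_sub_cancel_left]
          simpa using h3
        · intro s hs
          rw [uIoc_of_le zero_le_one] at hs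
          rw [norm_smul]
          have h1 := hq.1
          simp only [Metric.mem_ball, dist_zero_right] at h1
          exact mul_le_mul h1.le (hFM _ (hball q hq _ ((hPk 0).2 (s • q.1, q.2)
            (hstar q hq s (Ioc_subset_Icc_self hs))) s
            (Ioc_subset_Icc_self hs))) (norm_nonneg _) hr.le
      simp only [pow_zero, mul_one, zero_add]
      linarith
    | succ k ih =>
      intro q hq
      have := hdiff (P k) (P (k + 1)) (hPk k).1.continuousOn (hPk (k + 1)).1.continuousOn
        (hPk k).2 (hPk (k + 1)).2 _ ih q hq
      refine this.trans (le_of_eq ?_)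
      ring
  have hlim : ∀ q ∈ U, ∃ x, Tendsto (fun k => P k q) atTop (𝓝 x) := fun q hq =>
    cauchySeq_tendsto_of_complete
      (cauchySeq_of_le_geometric (1 / 2) R (by norm_num) fun k => hPd k q hq)
  classical
  -- the limit of the Picard iterates
  choose! X hX using hlim
  have hXd : ∀ k, ∀ q ∈ U, dist (P k q) (X q) ≤ R * (1 / 2) ^ k / (1 - 1 / 2) := fun k q hq =>
    dist_le_of_le_geometric_of_tendsto (1 / 2) R (by norm_num) (fun k => hPd k q hq) (hX q hq) k
  have hto0 : Tendsto (fun k : ℕ => R * (1 / 2 : ℝ) ^ k / (1 - 1 / 2)) atTop (𝓝 0) := by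
    have := ((tendsto_pow_atTop_nhds_zero_of_lt_one (r := (1 / 2 : ℝ)) (by norm_num)
      (by norm_num)).const_mul R).div_const (1 - 1 / 2)
    simpa using this
  have hunif : TendstoUniformlyOn P X atTop U := by
    rw [Metric.tendstoUniformlyOn_iff]
    intro ε hε
    filter_upwards [hto0.eventually (gt_mem_nhds hε)] with k hk q hq
    rw [dist_comm]
    exact (hXd k q hq).trans_lt hk
  have hXc : ContinuousOn X U :=
    hunif.continuousOn (Eventually.of_forall fun k => (hPk k).1.continuousOn).frequently
  have hXa : AnalyticOnNhd ℂ X U := by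
    refine LineHolomorphicOn.analyticOnNhd hU ⟨hXc, fun p hp v => ?_⟩
    have hl : Continuous fun t : ℂ => p + t • v := by fun_prop
    have hO := hU.preimage hl
    have h1 : TendstoLocallyUniformlyOn (fun k t => P k (p + t • v)) (fun t => X (p + t • v)) atTop
        ((fun t : ℂ => p + t • v) ⁻¹' U) :=
      (hunif.comp (fun t : ℂ => p + t • v)).tendstoLocallyUniformlyOn
    have h2 := h1.differentiableOn (Eventually.of_forall fun k t ht => ?_) hO
    · exact h2.differentiableAt (hO.mem_nhds (by simpa using hp))
    · exact ((hPk k).1.lineHolomorphicOn.differentiableAt ht).differentiableWithinAt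
  have hXb : ∀ q ∈ U, ‖X q‖ ≤ ‖q.2‖ + r * M := fun q hq =>
    le_of_tendsto (hX q hq).norm (Eventually.of_forall fun k => (hPk k).2 q hq)
  have hfix : ∀ q ∈ U, X q = q.2 + ∫ s in (0 : ℝ)..1, q.1 • F (s • q.1, X (s • q.1, q.2)) := by
    intro q hq
    have h1 : Tendsto (fun k => P (k + 1) q) atTop (𝓝 (X q)) :=
      (hX q hq).comp (tendsto_add_atTop_nat 1)
    refine tendsto_nhds_unique h1 ?_
    rw [tendsto_iff_dist_tendsto_zero]
    refine squeeze_zero (fun _ => dist_nonneg) (fun k => ?_)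
      (by have := hto0.div_const 2; rwa [zero_div] at this)
    exact hdiff (P k) X (hPk k).1.continuousOn hXc (hPk k).2 hXb _ (hXd k) q hq
  refine ⟨X, hXa, ?_, ?_⟩
  · intro z hz
    rw [hfix (0, z) ⟨Metric.mem_ball_self hr, hz⟩]
    simp
  · rintro ⟨t, z⟩ ⟨ht, hz⟩
    simp only at ht hz ⊢
    have hmem : ∀ t ∈ Metric.ball (0 : ℂ) r, (t, X (t, z)) ∈ Metric.ball (0 : ℂ × W) R := by
      intro t ht
      simpa using hball (t, z) ⟨ht, hz⟩ _ (hXb _ ⟨ht, hz⟩) 1 ⟨zero_le_one, le_rfl⟩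
    have hd : DifferentiableOn ℂ (fun t => F (t, X (t, z))) (Metric.ball 0 r) := by
      intro t ht
      refine DifferentiableAt.differentiableWithinAt ?_
      have h1 : DifferentiableAt ℂ (fun t => X (t, z)) t :=
        (hXa (t, z) ⟨ht, hz⟩).differentiableAt.comp t (by fun_prop)
      exact (hF _ (hmem t ht)).differentiableAt.comp t (differentiableAt_id.prodMk h1)
    obtain ⟨H, hH⟩ := hd.isExactOn_ball
    have h2 : ∀ t ∈ Metric.ball (0 : ℂ) r, X (t, z) = z + (H t - H 0) := by
      intro t ht
      rw [hfix (t, z) ⟨ht, hz⟩]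
      have hseg : ∀ s ∈ Icc (0 : ℝ) 1, s • t ∈ Metric.ball (0 : ℂ) r :=
        fun s hs => (hstar (t, z) ⟨ht, hz⟩ s hs).1
      have h3 := intervalIntegral.integral_eq_sub_of_hasDerivAt (a := 0) (b := 1)
        (f := fun s : ℝ => H (s • t)) (f' := fun s : ℝ => t • F (s • t, X (s • t, z))) ?_
        (hint X hXc hXb (t, z) ⟨ht, hz⟩)
      · simp only [one_smul, zero_smul] at h3
        rw [h3]
      · intro s hs
        rw [uIcc_of_le zero_le_one] at hs
        have h4 : HasDerivAt (fun s : ℝ => s • t) t s := by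
          simpa using (hasDerivAt_id s).smul_const t
        exact (hH _ (hseg s hs)).scomp s h4
    have h5 : HasDerivAt (fun t => z + (H t - H 0)) (F (t, X (t, z))) t :=
      ((hH t ht).sub_const _).const_add _
    refine h5.congr_of_eventuallyEq ?_
    filter_upwards [Metric.isOpen_ball.mem_nhds ht] with s hs using h2 s hs

/-- Rectification of the holomorphic vector field `(1, F)` near the origin of `ℂ × W`, by its flow. -/
theorem exists_rectification {F : ℂ × W → W} (hF : AnalyticAt ℂ F 0) {O : Set (ℂ × W)}
    (hO : O ∈ 𝓝 0) :
    ∃ Ψ : OpenPartialHomeomorph (ℂ × W) (ℂ × W), 0 ∈ Ψ.source ∧ Ψ 0 = 0 ∧ Ψ.target ⊆ O ∧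
      AnalyticOnNhd ℂ Ψ Ψ.source ∧ AnalyticOnNhd ℂ Ψ.symm Ψ.target ∧
      ∀ q ∈ Ψ.source, fderiv ℂ Ψ q (1, 0) = (1, F (Ψ q)) := by
  obtain ⟨K, T, hT, hK⟩ := (hF.contDiffAt (n := 1)).exists_lipschitzOnWith
  have hb : ∀ᶠ q in 𝓝 (0 : ℂ × W), ‖F q‖ ≤ ‖F 0‖ + 1 := by
    filter_upwards [hF.continuousAt.norm.eventually (gt_mem_nhds (lt_add_one ‖F 0‖))] with q hq
    exact hq.le
  obtain ⟨R, hR, hRs⟩ := Metric.mem_nhds_iff.1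
    (inter_mem (inter_mem hT hb) hF.eventually_analyticAt)
  set M := ‖F 0‖ + 1 with hM
  have hM0 : 0 < M := by positivity
  obtain ⟨r, hr, hr1, hr2, hr3⟩ : ∃ r > 0, r < R ∧ r * M ≤ R / 2 ∧ r * K ≤ 1 / 2 := by
    refine ⟨min (R / 2) (min (R / 2 / M) (1 / 2 / (K + 1))), by positivity, ?_, ?_, ?_⟩
    · exact (min_le_left _ _).trans_lt (by linarith)
    · calc _ ≤ (R / 2 / M) * M := by
            gcongr; exact (min_le_right _ _).trans (min_le_left _ _)
        _ = R / 2 := by field_simp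
    · have hK0 : (0 : ℝ) ≤ K := K.2
      calc _ ≤ (1 / 2 / (K + 1)) * (K : ℝ) := by
            gcongr; exact (min_le_right _ _).trans (min_le_right _ _)
        _ ≤ 1 / 2 := by
          rw [div_mul_eq_mul_div, div_le_iff₀ (by positivity)]
          linarith
  obtain ⟨X, hXa, hX0, hXd⟩ := exists_holomorphic_flow_on hr hr1 hM0.le
    (fun q hq => (hRs hq).2) (fun q hq => (hRs hq).1.2) (hK.mono fun q hq => (hRs hq).1.1) hr2 hr3
  set U : Set (ℂ × W) := Metric.ball 0 r ×ˢ Metric.ball 0 (R / 2) with hUdef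
  have hU : IsOpen U := Metric.isOpen_ball.prod Metric.isOpen_ball
  have h0U : (0 : ℂ × W) ∈ U := ⟨Metric.mem_ball_self hr, Metric.mem_ball_self (by positivity)⟩
  let g : ℂ × W → ℂ × W := fun q => (q.1, X q)
  have hga : ∀ q ∈ U, AnalyticAt ℂ g q := fun q hq => analyticAt_fst.prod (hXa q hq)
  have hg0 : g 0 = 0 := by
    have := hX0 0 (Metric.mem_ball_self (by positivity))
    exact Prod.ext rfl this
  have hgd : ∀ q ∈ U, fderiv ℂ g q (1, 0) = (1, F (g q)) := by
    intro q hq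
    have h1 : HasDerivAt (fun t : ℂ => g (t, q.2)) (1, F (g q)) q.1 :=
      (hasDerivAt_id q.1).prodMk (hXd q hq)
    have h2 : HasDerivAt (fun t : ℂ => (t, q.2)) ((1 : ℂ), (0 : W)) q.1 :=
      (hasDerivAt_id q.1).prodMk (hasDerivAt_const _ _)
    have h3 := (hga q hq).differentiableAt.hasFDerivAt.comp_hasDerivAt q.1 h2
    exact h3.unique h1
  have hgz : ∀ w : W, fderiv ℂ g 0 (0, w) = (0, w) := by
    intro w
    have h2 : HasFDerivAt (fun z : W => ((0 : ℂ), z)) (ContinuousLinearMap.inr ℂ ℂ W) 0 :=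
      (ContinuousLinearMap.inr ℂ ℂ W).hasFDerivAt
    have h3 := HasFDerivAt.comp (0 : W) (show HasFDerivAt g (fderiv ℂ g 0) ((0 : ℂ), (0 : W)) from
      (hga 0 h0U).differentiableAt.hasFDerivAt) h2
    have h4 : HasFDerivAt (g ∘ fun z : W => ((0 : ℂ), z)) (ContinuousLinearMap.inr ℂ ℂ W) 0 := by
      refine h2.congr_of_eventuallyEq ?_
      filter_upwards [Metric.ball_mem_nhds (0 : W) (half_pos hR)] with z hz
      exact Prod.ext rfl (hX0 z hz)
    have h5 := congrArg (fun L : W →L[ℂ] ℂ × W => L w) (h3.unique h4)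
    simpa using h5
  have hinj : Function.Injective (fderiv ℂ g 0) := by
    rw [injective_iff_map_eq_zero]
    rintro ⟨a, w⟩ h
    have h1 : ((a, w) : ℂ × W) = a • ((1 : ℂ), (0 : W)) + (0, w) := by simp
    rw [h1, map_add, map_smul, hgd 0 h0U, hgz, hg0] at h
    have ha : a = 0 := by simpa using congrArg Prod.fst h
    subst ha
    have hw : w = 0 := by simpa using congrArg Prod.snd h
    rw [hw]; rfl
  let e : (ℂ × W) ≃L[ℂ] (ℂ × W) :=
    (LinearEquiv.ofInjectiveEndo (fderiv ℂ g 0 : (ℂ × W) →ₗ[ℂ] (ℂ × W)) hinj).toContinuousLinearEquiv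
  have he : HasFDerivAt g (e : (ℂ × W) →L[ℂ] (ℂ × W)) 0 := by
    have : (e : (ℂ × W) →L[ℂ] (ℂ × W)) = fderiv ℂ g 0 := by ext x <;> rfl
    rw [this]
    exact (hga 0 h0U).differentiableAt.hasFDerivAt
  have hO' : g ⁻¹' O ∈ 𝓝 0 := (hga 0 h0U).continuousAt.preimage_mem_nhds (by rwa [hg0])
  obtain ⟨Φ, h0, hs, hΦ, ha, hb⟩ := (hga 0 h0U).exists_openPartialHomeomorph e he
    (inter_mem (hU.mem_nhds h0U) hO')
  refine ⟨Φ, h0, by rw [hΦ]; exact hg0, ?_, by rwa [hΦ], hb, ?_⟩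
  · intro q hq
    have h6 := (hs (Φ.map_target hq)).2
    rw [mem_preimage, ← hΦ, Φ.right_inv hq] at h6
    exact h6
  · intro q hq
    rw [hΦ]
    exact hgd q (hs hq).1

end Flow

/-! ### Roots of a holomorphic function depending on parameters -/

/-- Splitting off the zeros in a closed disc, repeated according to multiplicity, of a holomorphic
function of one variable. Here `N` is the number of distinct zeros. -/
theorem AnalyticOnNhd.exists_roots_of_finite {r r' : ℝ} : ∀ (N : ℕ) {φ : ℂ → ℂ}
    (_ : AnalyticOnNhd ℂ φ (Metric.ball 0 r')) (_ : r < r')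
    (_ : (Metric.closedBall 0 r ∩ φ ⁻¹' {0}).Finite)
    (_ : (Metric.closedBall 0 r ∩ φ ⁻¹' {0}).ncard = N)
    (_ : ∀ ζ ∈ Metric.closedBall 0 r, ∃ᶠ w in 𝓝 ζ, φ w ≠ 0),
    ∃ (p : ℕ) (ρ : Fin p → ℂ) (u : ℂ → ℂ), (∀ i, ρ i ∈ Metric.closedBall 0 r) ∧
      AnalyticOnNhd ℂ u (Metric.ball 0 r') ∧ (∀ ζ ∈ Metric.closedBall 0 r, u ζ ≠ 0) ∧
      ∀ ζ, φ ζ = (∏ i, (ζ - ρ i)) * u ζ := by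
  intro N
  induction N with
  | zero =>
    intro φ hφ hr hfin hN hz
    refine ⟨0, Fin.elim0, φ, fun i => i.elim0, hφ, ?_, by simp⟩
    intro ζ hζ h0
    have := (ncard_eq_zero hfin).1 hN
    exact (this ▸ (⟨hζ, h0⟩ : ζ ∈ Metric.closedBall 0 r ∩ φ ⁻¹' {0}) : ζ ∈ (∅ : Set ℂ))
  | succ N ih =>
    intro φ hφ hr hfin hN hz
    obtain ⟨ρ₀, hρ₀, hρ0⟩ : (Metric.closedBall 0 r ∩ φ ⁻¹' {0}).Nonempty := by
      rw [← ncard_pos hfin]; omega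
    have hρb : ρ₀ ∈ Metric.ball (0 : ℂ) r' := Metric.closedBall_subset_ball hr hρ₀
    obtain ⟨k, g, hg, hg0, hgφ⟩ := (hφ ρ₀ hρb).exists_eventuallyEq_pow_smul_nonzero_iff.2
      (fun h => (hz ρ₀ hρ₀) (h.mono fun w hw => not_not.2 hw))
    have hk : k ≠ 0 := by
      rintro rfl
      have := hgφ.self_of_nhds
      rw [mem_preimage, mem_singleton_iff] at hρ0
      rw [hρ0] at this
      simp at this
      exact hg0 this.symm
    classical
    let ψ : ℂ → ℂ := Function.update (fun ζ => φ ζ / (ζ - ρ₀) ^ k) ρ₀ (g ρ₀)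
    have hψe : ∀ ζ, φ ζ = (ζ - ρ₀) ^ k * ψ ζ := by
      intro ζ
      by_cases h : ζ = ρ₀
      · subst h
        rw [sub_self, zero_pow hk, zero_mul]
        exact hρ0
      · simp only [ψ, Function.update_of_ne h]
        rw [mul_div_cancel₀]
        exact pow_ne_zero _ (sub_ne_zero.2 h)
    have hψρ : ψ ρ₀ = g ρ₀ := by simp [ψ]
    have hψa : AnalyticOnNhd ℂ ψ (Metric.ball 0 r') := by
      intro ζ hζ
      by_cases h : ζ = ρ₀
      · subst h
        refine hg.congr ?_
        filter_upwards [hgφ] with w hw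
        by_cases h : w = ζ
        · subst h; exact hψρ.symm
        · simp only [ψ, Function.update_of_ne h]
          rw [hw, smul_eq_mul, mul_div_cancel_left₀]
          exact pow_ne_zero _ (sub_ne_zero.2 h)
      · have h1 : AnalyticAt ℂ (fun w => φ w / (w - ρ₀) ^ k) ζ :=
          (hφ ζ hζ).div ((analyticAt_id.sub analyticAt_const).pow k)
            (pow_ne_zero _ (sub_ne_zero.2 h))
        refine h1.congr ?_
        filter_upwards [isOpen_ne.mem_nhds h] with w hw
        simp only [ψ, Function.update_of_ne hw]
    have hset : Metric.closedBall 0 r ∩ ψ ⁻¹' {0} = (Metric.closedBall 0 r ∩ φ ⁻¹' {0}) \ {ρ₀} := by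
      ext ζ
      simp only [mem_inter_iff, mem_preimage, mem_singleton_iff, Set.mem_sdiff]
      rw [hψe ζ]
      constructor
      · rintro ⟨h1, h2⟩
        refine ⟨⟨h1, by rw [h2, mul_zero]⟩, ?_⟩
        rintro rfl
        exact hg0 (hψρ ▸ h2)
      · rintro ⟨⟨h1, h2⟩, h3⟩
        exact ⟨h1, (mul_eq_zero.1 h2).resolve_left (pow_ne_zero _ (sub_ne_zero.2 h3))⟩
    obtain ⟨p, ρ, u, hρ, hu, hu0, hψu⟩ := ih hψa hr (by rw [hset]; exact hfin.sdiff)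
      (by rw [hset, ncard_sdiff_singleton_of_mem (mem_inter hρ₀ hρ0), hN]; rfl) (fun ζ hζ =>
        (hz ζ hζ).mono fun w hw h => hw (by rw [hψe, h, mul_zero]))
    refine ⟨k + p, Fin.append (fun _ => ρ₀) ρ, u, ?_, hu, hu0, ?_⟩
    · intro i
      refine Fin.addCases (fun i => ?_) (fun i => ?_) i
      · rw [Fin.append_left]; exact hρ₀
      · rw [Fin.append_right]; exact hρ i
    · intro ζ
      rw [hψe, hψu, Fin.prod_univ_add]
      simp only [Fin.append_left, Fin.append_right, Finset.prod_const, Finset.card_univ,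
        Fintype.card_fin]
      ring

/-- Splitting off the zeros in an open disc of a holomorphic function without zeros on the boundary. -/
theorem AnalyticOnNhd.exists_roots {r r' : ℝ} (hr0 : 0 < r) (hr : r < r') {φ : ℂ → ℂ}
    (hφ : AnalyticOnNhd ℂ φ (Metric.ball 0 r')) (h0 : ∀ ζ ∈ Metric.sphere 0 r, φ ζ ≠ 0) :
    ∃ (p : ℕ) (ρ : Fin p → ℂ) (u : ℂ → ℂ), (∀ i, ρ i ∈ Metric.ball 0 r) ∧
      AnalyticOnNhd ℂ u (Metric.ball 0 r') ∧ (∀ ζ ∈ Metric.closedBall 0 r, u ζ ≠ 0) ∧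
      ∀ ζ, φ ζ = (∏ i, (ζ - ρ i)) * u ζ := by
  have hsub : Metric.closedBall (0 : ℂ) r ⊆ Metric.ball 0 r' := Metric.closedBall_subset_ball hr
  have hφc := hφ.mono hsub
  have hpre : IsPreconnected (Metric.closedBall (0 : ℂ) r) := (convex_closedBall _ _).isPreconnected
  have hsph : (r : ℂ) ∈ Metric.sphere (0 : ℂ) r := by simp [abs_of_pos hr0]
  have key : ∀ ζ ∈ Metric.closedBall (0 : ℂ) r, ¬ ∃ᶠ w in 𝓝[≠] ζ, φ w = 0 := fun ζ hζ h =>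
    h0 _ hsph (hφc.eqOn_zero_of_preconnected_of_frequently_eq_zero hpre hζ h
      (Metric.sphere_subset_closedBall hsph))
  have hfin : (Metric.closedBall 0 r ∩ φ ⁻¹' {0}).Finite := by
    by_contra hinf
    obtain ⟨ζ, hζ, hacc⟩ := Set.Infinite.exists_accPt_of_subset_isCompact hinf
      (isCompact_closedBall (0 : ℂ) r) inter_subset_left
    refine key ζ hζ ?_
    rw [accPt_iff_frequently_nhdsNE] at hacc
    exact hacc.mono fun w hw => hw.2
  obtain ⟨p, ρ, u, hρ, hu, hu0, hφu⟩ := AnalyticOnNhd.exists_roots_of_finite _ hφ hr hfin rfl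
    (fun ζ hζ h => key ζ hζ
      ((h.filter_mono nhdsWithin_le_nhds).frequently.mono fun w hw => not_not.1 hw))
  refine ⟨p, ρ, u, fun i => ?_, hu, hu0, hφu⟩
  rw [← Metric.closedBall_sdiff_sphere]
  refine ⟨hρ i, fun h => h0 _ h ?_⟩
  rw [hφu, Finset.prod_eq_zero (Finset.mem_univ i) (sub_self _), zero_mul]

/-- The weighted argument principle, for a function with its zeros split off. -/
theorem circleIntegral_mul_logDeriv_of_roots {r r' : ℝ} (hr0 : 0 < r) (hr : r < r') {p : ℕ}
    {ρ : Fin p → ℂ} {u h : ℂ → ℂ} (hρ : ∀ i, ρ i ∈ Metric.ball 0 r)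
    (hu : AnalyticOnNhd ℂ u (Metric.ball 0 r')) (hu0 : ∀ ζ ∈ Metric.closedBall 0 r, u ζ ≠ 0)
    (hh : AnalyticOnNhd ℂ h (Metric.ball 0 r')) :
    (2 * Real.pi * Complex.I : ℂ)⁻¹ •
      (∮ ζ in C(0, r), h ζ * logDeriv (fun ζ => (∏ i, (ζ - ρ i)) * u ζ) ζ) = ∑ i, h (ρ i) := by
  have hsub : Metric.closedBall (0 : ℂ) r ⊆ Metric.ball 0 r' := Metric.closedBall_subset_ball hr
  have hne : ∀ ζ ∈ Metric.sphere (0 : ℂ) r, ∀ i, ζ - ρ i ≠ 0 := by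
    intro ζ hζ i h0
    have := hρ i
    rw [← sub_eq_zero.1 h0] at this
    exact (Metric.mem_ball.1 this).ne hζ
  have h1 : EqOn (fun ζ => h ζ * logDeriv (fun ζ => (∏ i, (ζ - ρ i)) * u ζ) ζ)
      (fun ζ => (∑ i, (ζ - ρ i)⁻¹ • h ζ) + h ζ * (deriv u ζ / u ζ)) (Metric.sphere 0 r) := by
    intro ζ hζ
    have hζ' := Metric.sphere_subset_closedBall hζ
    simp only
    rw [logDeriv_mul ζ (Finset.prod_ne_zero_iff.2 fun i _ => hne ζ hζ i) (hu0 ζ hζ')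
      (by fun_prop) (hu ζ (hsub hζ')).differentiableAt, logDeriv_prod (fun i _ => hne ζ hζ i)
      (fun i _ => by fun_prop)]
    have h2 : ∀ i, logDeriv (fun x : ℂ => x - ρ i) ζ = (ζ - ρ i)⁻¹ := by
      intro i
      simp [logDeriv_apply]
    simp only [h2, logDeriv_apply u, smul_eq_mul, ← Finset.sum_mul]
    ring
  rw [circleIntegral.integral_congr hr0.le h1]
  have hcont : ContinuousOn h (Metric.sphere 0 r) :=
    hh.continuousOn.mono (Metric.sphere_subset_closedBall.trans hsub)
  have hci : ∀ i ∈ Finset.univ, CircleIntegrable (fun ζ => (ζ - ρ i)⁻¹ • h ζ) 0 r := by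
    intro i _
    refine ContinuousOn.circleIntegrable hr0.le ?_
    exact ((continuousOn_id.sub continuousOn_const).inv₀ fun ζ hζ => hne ζ hζ i).smul hcont
  have hda : AnalyticOnNhd ℂ (fun ζ => h ζ * (deriv u ζ / u ζ)) (Metric.closedBall 0 r) := by
    intro ζ hζ
    exact (hh ζ (hsub hζ)).mul ((hu ζ (hsub hζ)).deriv.div (hu ζ (hsub hζ)) (hu0 ζ hζ))
  rw [circleIntegral.integral_add (CircleIntegrable.fun_sum _ hci)
    ((hda.continuousOn.mono Metric.sphere_subset_closedBall).circleIntegrable hr0.le),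
    circleIntegral.integral_fun_sum hci]
  have h3 : (∮ ζ in C(0, r), h ζ * (deriv u ζ / u ζ)) = 0 :=
    Complex.circleIntegral_eq_zero_of_differentiable_on_off_countable hr0.le countable_empty
      hda.continuousOn fun z hz => (hda z (Metric.ball_subset_closedBall hz.1)).differentiableAt
  rw [h3, add_zero, Finset.smul_sum]
  refine Finset.sum_congr rfl fun i _ => ?_
  exact Complex.two_pi_I_inv_smul_circleIntegral_sub_inv_smul_of_differentiable_on_off_countable
    countable_empty (hρ i) (hh.mono hsub).continuousOn
    fun z hz => (hh z (hsub (Metric.ball_subset_closedBall hz.1))).differentiableAt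

/-- By Newton's identities a product is holomorphic as soon as all power sums are. -/
theorem analyticAt_prod_of_psum {E : Type*} [NormedAddCommGroup E] [NormedSpace ℂ E] {p : ℕ}
    {x : E → Fin p → ℂ} {z : E} (h : ∀ k : ℕ, AnalyticAt ℂ (fun z => ∑ i, x z i ^ k) z) :
    AnalyticAt ℂ (fun z => ∏ i, x z i) z := by
  have key : ∀ k : ℕ, AnalyticAt ℂ
      (fun z => MvPolynomial.aeval (x z) (MvPolynomial.esymm (Fin p) ℂ k)) z := by
    intro k
    induction k using Nat.strong_induction_on with
    | _ k ih =>
      rcases Nat.eq_zero_or_pos k with rfl | hk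
      · simpa [MvPolynomial.esymm_zero] using analyticAt_const
      have h1 : (fun z => MvPolynomial.aeval (x z) (MvPolynomial.esymm (Fin p) ℂ k)) =
          fun z => (k : ℂ)⁻¹ * ((-1) ^ (k + 1) *
            ∑ a ∈ Finset.HasAntidiagonal.antidiagonal k with a.1 < k, (-1) ^ a.1 *
              MvPolynomial.aeval (x z) (MvPolynomial.esymm (Fin p) ℂ a.1) *
                ∑ i, x z i ^ a.2) := by
        ext z
        have h2 := congrArg (MvPolynomial.aeval (x z)) (MvPolynomial.mul_esymm_eq_sum (Fin p) ℂ k)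
        have hk0 : (k : ℂ) ≠ 0 := Nat.cast_ne_zero.2 hk.ne'
        simp only [map_mul, map_natCast, map_pow, map_neg, map_one, map_sum, MvPolynomial.psum,
          MvPolynomial.aeval_X] at h2
        rw [← h2, inv_mul_cancel_left₀ hk0]
      rw [h1]
      refine analyticAt_const.mul (analyticAt_const.mul ?_)
      refine Finset.analyticAt_fun_sum _ fun a ha => ?_
      exact (analyticAt_const.mul (ih _ (Finset.mem_filter.1 ha).2)).mul (h _)
  have h2 := key p
  refine h2.congr (Eventually.of_forall fun z => ?_)
  simp only [MvPolynomial.esymm, map_sum, map_prod, MvPolynomial.aeval_X]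
  have h3 : Finset.powersetCard p (Finset.univ : Finset (Fin p)) = {Finset.univ} := by
    have h4 := Finset.powersetCard_self (Finset.univ : Finset (Fin p))
    rwa [Finset.card_univ, Fintype.card_fin] at h4
  rw [h3, Finset.sum_singleton]

/-- The zeros `ρ z i` of `F (z, ·)` in a disc whose boundary they avoid: their number is
constant, and the norm `∏ i, H (z, ρ z i)` of a holomorphic function is holomorphic. By the argument
principle the power sums of the values `H (z, ρ z i)` are integrals over the boundary, and Newton's
identities express the norm by the power sums. -/
theorem exists_roots_norm {E : Type*} [NormedAddCommGroup E] [NormedSpace ℂ E]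
    [FiniteDimensional ℂ E] {V : Set E} (hV : IsOpen V) (hVc : IsPreconnected V) {r r' : ℝ}
    (hr0 : 0 < r) (hr : r < r') {F : E × ℂ → ℂ} (hF : AnalyticOnNhd ℂ F (V ×ˢ Metric.ball 0 r'))
    (hF0 : ∀ z ∈ V, ∀ ζ ∈ Metric.sphere (0 : ℂ) r, F (z, ζ) ≠ 0) :
    ∃ (p : ℕ) (ρ : E → Fin p → ℂ), (∀ z ∈ V, ∀ i, ρ z i ∈ Metric.ball 0 r) ∧
      (∀ z ∈ V, ∀ ζ ∈ Metric.closedBall (0 : ℂ) r, F (z, ζ) = 0 ↔ ∃ i, ρ z i = ζ) ∧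
      ∀ H : E × ℂ → ℂ, AnalyticOnNhd ℂ H (V ×ˢ Metric.ball 0 r') →
        AnalyticOnNhd ℂ (fun z => ∏ i, H (z, ρ z i)) V := by
  rcases V.eq_empty_or_nonempty with rfl | ⟨z₀, hz₀⟩
  · exact ⟨0, fun _ => Fin.elim0, by simp, by simp, fun H _ => by simp [AnalyticOnNhd]⟩
  have hsub : Metric.closedBall (0 : ℂ) r ⊆ Metric.ball 0 r' := Metric.closedBall_subset_ball hr
  have hslice : ∀ H : E × ℂ → ℂ, AnalyticOnNhd ℂ H (V ×ˢ Metric.ball 0 r') → ∀ z ∈ V,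
      AnalyticOnNhd ℂ (fun ζ => H (z, ζ)) (Metric.ball 0 r') := by
    intro H hH z hz ζ hζ
    exact (hH (z, ζ) ⟨hz, hζ⟩).comp_of_eq (analyticAt_const.prod analyticAt_id) rfl
  have hroots := fun z (hz : z ∈ V) => (hslice F hF z hz).exists_roots hr0 hr (hF0 z hz)
  choose! P R u hR hu hu0 hFu using hroots
  have hderiv : ∀ z ∈ V, ∀ ζ ∈ Metric.ball (0 : ℂ) r',
      deriv (fun ζ => F (z, ζ)) ζ = fderiv ℂ F (z, ζ) (0, 1) := by
    intro z hz ζ hζ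
    have h1 : HasDerivAt (fun ζ : ℂ => (z, ζ)) ((0 : E), (1 : ℂ)) ζ :=
      (hasDerivAt_const _ _).prodMk (hasDerivAt_id ζ)
    exact ((hF _ ⟨hz, hζ⟩).differentiableAt.hasFDerivAt.comp_hasDerivAt ζ h1).deriv
  have hpsum : ∀ H : E × ℂ → ℂ, AnalyticOnNhd ℂ H (V ×ˢ Metric.ball 0 r') →
      AnalyticOnNhd ℂ (fun z => ∑ i, H (z, R z i)) V := by
    intro H hH
    have h1 : AnalyticOnNhd ℂ (fun z => (2 * Real.pi * Complex.I : ℂ)⁻¹ • ∮ ζ in C(0, r),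
        (fun q : E × ℂ => H q * (fderiv ℂ F q (0, 1) / F q)) (z, ζ)) V := by
      refine analyticOnNhd_const.smul (AnalyticOnNhd.circleIntegral_param hV hr0.le
        (F := fun q : E × ℂ => H q * (fderiv ℂ F q (0, 1) / F q)) ?_)
      rintro ⟨z, ζ⟩ ⟨hz, hζ⟩
      have hq : (z, ζ) ∈ V ×ˢ Metric.ball (0 : ℂ) r' :=
        ⟨hz, hsub (Metric.sphere_subset_closedBall hζ)⟩
      have h2 : AnalyticAt ℂ (fun q => fderiv ℂ F q (0, 1)) (z, ζ) :=
        ((ContinuousLinearMap.apply ℂ ℂ ((0 : E), (1 : ℂ))).analyticAt _).comp (hF _ hq).fderiv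
      exact (hH _ hq).mul (h2.div (hF _ hq) (hF0 z hz ζ hζ))
    refine h1.congr hV fun z hz => ?_
    rw [← circleIntegral_mul_logDeriv_of_roots hr0 hr (hR z hz) (hu z hz) (hu0 z hz)
      (hslice H hH z hz)]
    congr 1
    refine circleIntegral.integral_congr hr0.le fun ζ hζ => ?_
    have hζ' := hsub (Metric.sphere_subset_closedBall hζ)
    have h3 : (fun ζ => (∏ i, (ζ - R z i)) * u z ζ) = fun ζ => F (z, ζ) :=
      funext fun ζ => (hFu z hz ζ).symm
    simp only
    rw [h3, logDeriv_apply, hderiv z hz ζ hζ']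
  have hcard : ∀ z ∈ V, P z = P z₀ := by
    have h1 := (hpsum (fun _ => 1) analyticOnNhd_const).continuousOn.norm
    have h2 : ContinuousOn (fun z => (P z : ℝ)) V := by
      refine h1.congr fun z _ => ?_
      simp
    have h3 : ContinuousOn P V := by
      rw [continuousOn_iff_continuous_domRestrict] at h2 ⊢
      exact Nat.isClosedEmbedding_coe_real.isInducing.continuous_iff.2 h2
    intro z hz
    exact hVc.constant h3 hz hz₀
  classical
  refine ⟨P z₀, fun z => if h : z ∈ V then fun i => R z (Fin.cast (hcard z h).symm i) else 0,
    ?_, ?_, ?_⟩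
  · intro z hz i
    simp only [dif_pos hz]
    exact hR z hz _
  · intro z hz ζ hζ
    simp only [dif_pos hz]
    rw [hFu z hz, mul_eq_zero, or_iff_left (hu0 z hz ζ hζ), Finset.prod_eq_zero_iff]
    constructor
    · rintro ⟨i, -, hi⟩
      exact ⟨Fin.cast (hcard z hz) i, by simpa using (sub_eq_zero.1 hi).symm⟩
    · rintro ⟨i, hi⟩
      exact ⟨_, Finset.mem_univ _, sub_eq_zero.2 hi.symm⟩
  · intro H hH z hz
    refine analyticAt_prod_of_psum fun k => ?_
    refine (hpsum (fun q => H q ^ k) (hH.pow k) z hz).congr ?_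
    filter_upwards [hV.mem_nhds hz] with w hw
    simp only [dif_pos hw]
    exact (Fintype.sum_equiv (finCongr (hcard w hw).symm) _ _ fun i => rfl).symm

/-! ### Germs of analytic sets -/

section Germs

variable {E E' : Type*} [NormedAddCommGroup E] [NormedSpace ℂ E]
  [NormedAddCommGroup E'] [NormedSpace ℂ E']

/-- Near `x`, the set `S` is the common zero set of finitely many holomorphic functions. -/
def IsAnalyticGermAt (S : Set E) (x : E) : Prop :=
  ∃ (k : ℕ) (g : Fin k → E → ℂ), (∀ i, AnalyticAt ℂ (g i) x) ∧ ∀ᶠ q in 𝓝 x, q ∈ S ↔ ∀ i, g i q = 0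

theorem IsAnalyticGermAt.of_fintype {ι : Type*} [Fintype ι] {S : Set E} {x : E} {g : ι → E → ℂ}
    (hg : ∀ i, AnalyticAt ℂ (g i) x) (hS : ∀ᶠ q in 𝓝 x, q ∈ S ↔ ∀ i, g i q = 0) :
    IsAnalyticGermAt S x := by
  refine ⟨Fintype.card ι, fun i => g ((Fintype.equivFin ι).symm i), fun i => hg _, ?_⟩
  filter_upwards [hS] with q hq
  rw [hq]
  exact ⟨fun h i => h _, fun h i => by simpa using h (Fintype.equivFin ι i)⟩

theorem IsAnalyticGermAt.congr {S S' : Set E} {x : E} (hS : IsAnalyticGermAt S x)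
    (h : ∀ᶠ q in 𝓝 x, q ∈ S ↔ q ∈ S') : IsAnalyticGermAt S' x := by
  obtain ⟨k, g, hg, hS⟩ := hS
  refine ⟨k, g, hg, ?_⟩
  filter_upwards [hS, h] with q h1 h2
  rw [← h2, h1]

theorem IsAnalyticGermAt.preimage {S : Set E'} {φ : E → E'} {x : E}
    (hS : IsAnalyticGermAt S (φ x)) (hφ : AnalyticAt ℂ φ x) : IsAnalyticGermAt (φ ⁻¹' S) x := by
  obtain ⟨k, g, hg, hS⟩ := hS
  exact ⟨k, fun i => g i ∘ φ, fun i => (hg i).comp hφ, hφ.continuousAt.eventually hS⟩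

theorem AnalyticAt.exists_line_not_eventually_zero {F : E → ℂ} {p : E} (hF : AnalyticAt ℂ F p)
    (h : ¬ ∀ᶠ q in 𝓝 p, F q = 0) : ∃ v : E, ¬ ∀ᶠ t in 𝓝 (0 : ℂ), F (p + t • v) = 0 := by
  obtain ⟨r, hr, hrs⟩ := Metric.mem_nhds_iff.1 hF.eventually_analyticAt
  obtain ⟨q, hq, hqr⟩ : ∃ q, F q ≠ 0 ∧ q ∈ Metric.ball p r := by
    have := (not_eventually.1 h).and_eventually (Metric.ball_mem_nhds p hr)
    exact this.exists
  refine ⟨q - p, fun h0 => hq ?_⟩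
  have hl : Continuous fun t : ℂ => p + t • (q - p) := by fun_prop
  have hconv : Convex ℝ ((fun t : ℂ => p + t • (q - p)) ⁻¹' Metric.ball p r) := by
    intro a ha b hb α β hα hβ hαβ
    have h1 := convex_ball p r ha hb hα hβ hαβ
    have h2 : α • (p + a • (q - p)) + β • (p + b • (q - p))
        = (α + β) • p + (α • a + β • b) • (q - p) := by
      simp only [add_smul, smul_add, smul_assoc]
      abel
    rw [h2, hαβ, one_smul] at h1
    exact h1
  have ha : AnalyticOnNhd ℂ (fun t : ℂ => F (p + t • (q - p)))
      ((fun t : ℂ => p + t • (q - p)) ⁻¹' Metric.ball p r) := by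
    intro t ht
    refine AnalyticAt.comp (f := fun t : ℂ => p + t • (q - p)) (hrs ht) ?_
    exact analyticAt_const.add (analyticAt_id.smul analyticAt_const)
  have := ha.eqOn_zero_of_preconnected_of_eventuallyEq_zero hconv.isPreconnected (z₀ := 0)
    (by simpa using hr) h0 (x := 1) (by simpa using hqr)
  simpa using this

theorem exists_equiv_prod_of_ne_zero [FiniteDimensional ℂ E] {d : ℕ}
    (hd : Module.finrank ℂ E = d + 1) {v : E} (hv : v ≠ 0) :
    ∃ e : E ≃L[ℂ] (Fin d → ℂ) × ℂ, e v = (0, 1) := by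
  obtain ⟨l, hl⟩ := SeparatingDual.exists_eq_one (R := ℂ) hv
  have hinv : Function.RightInverse (ContinuousLinearMap.toSpanSingleton ℂ v) l := by
    intro t
    simp [hl]
  let e1 := ContinuousLinearEquiv.equivOfRightInverse l _ hinv
  have hdim : Module.finrank ℂ l.ker = d := by
    have h1 := e1.toLinearEquiv.finrank_eq
    rw [Module.finrank_prod, Module.finrank_self, hd] at h1
    omega
  let e2 : l.ker ≃L[ℂ] (Fin d → ℂ) := ContinuousLinearEquiv.ofFinrankEq (by simp [hdim])
  refine ⟨(e1.trans (ContinuousLinearEquiv.prodComm ℂ ℂ l.ker)).trans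
    (e2.prodCongr (ContinuousLinearEquiv.refl ℂ ℂ)), ?_⟩
  have h2 : e1 v = (1, 0) := by
    refine Prod.ext (by simp [e1, hl]) ?_
    ext
    simp [e1, hl]
  simp [h2]

/-- Product neighbourhoods adapted to a function that does not vanish identically on the last
coordinate axis. -/
theorem exists_weierstrass_nhds [FiniteDimensional ℂ E] {F : E × ℂ → ℂ} {x : E}
    (hF : AnalyticAt ℂ F (x, 0)) (h : ¬ ∀ᶠ ζ in 𝓝 (0 : ℂ), F (x, ζ) = 0) {O : Set (E × ℂ)}
    (hO : O ∈ 𝓝 (x, 0)) :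
    ∃ δ > 0, ∃ r > 0, ∃ r' > r, Metric.ball x δ ×ˢ Metric.ball 0 r' ⊆ O ∧
      AnalyticOnNhd ℂ F (Metric.ball x δ ×ˢ Metric.ball 0 r') ∧
      (∀ z ∈ Metric.ball x δ, ∀ ζ ∈ Metric.sphere (0 : ℂ) r, F (z, ζ) ≠ 0) := by
  have h1 : AnalyticAt ℂ (fun ζ => F (x, ζ)) 0 :=
    hF.comp_of_eq (analyticAt_const.prod analyticAt_id) rfl
  have h2 := h1.eventually_eq_zero_or_eventually_ne_zero.resolve_left h
  rw [eventually_nhdsWithin_iff] at h2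
  obtain ⟨ε, hε, hεs⟩ := Metric.mem_nhds_iff.1 (inter_mem hO hF.eventually_analyticAt)
  obtain ⟨ε', hε', hεs'⟩ := Metric.mem_nhds_iff.1 h2
  set r' := min ε ε' with hr'
  have hr'0 : 0 < r' := lt_min hε hε'
  have hprod : ∀ z ∈ Metric.ball x ε, ∀ ζ ∈ Metric.ball (0 : ℂ) r',
      (z, ζ) ∈ Metric.ball (x, (0 : ℂ)) ε := by
    intro z hz ζ hζ
    rw [← ball_prod_same]
    exact ⟨hz, Metric.ball_subset_ball (min_le_left _ _) hζ⟩
  have hsph : Metric.sphere (0 : ℂ) (r' / 2) ⊆ Metric.ball 0 r' := by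
    intro ζ hζ
    simp only [mem_sphere_iff_norm, sub_zero, Metric.mem_ball, dist_zero_right] at hζ ⊢
    linarith
  have h3 : ∀ᶠ z in 𝓝 x, ∀ ζ ∈ Metric.sphere (0 : ℂ) (r' / 2), F (z, ζ) ≠ 0 := by
    refine (isCompact_sphere (0 : ℂ) (r' / 2)).eventually_forall_of_forall_eventually ?_
    intro ζ hζ
    have h4 : F (x, ζ) ≠ 0 := by
      refine hεs' (Metric.ball_subset_ball (min_le_right _ _) (hsph hζ)) ?_
      rintro rfl
      simp only [mem_sphere_iff_norm, sub_zero, norm_zero] at hζ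
      linarith
    exact (hεs (hprod x (Metric.mem_ball_self hε) ζ (hsph hζ))).2.continuousAt.eventually_ne h4
  obtain ⟨δ, hδ, hδs⟩ := Metric.mem_nhds_iff.1 (inter_mem h3 (Metric.ball_mem_nhds x hε))
  refine ⟨δ, hδ, r' / 2, by positivity, r', by simp only [gt_iff_lt]; linarith, ?_, ?_, fun z hz => (hδs hz).1⟩
  · rintro ⟨z, ζ⟩ ⟨hz, hζ⟩
    exact (hεs (hprod z (hδs hz).2 ζ hζ)).1
  · rintro ⟨z, ζ⟩ ⟨hz, hζ⟩
    exact (hεs (hprod z (hδs hz).2 ζ hζ)).2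

/-- A polynomial identity behind elimination: if finitely many linear combinations of the
vectors `a i` with powers of a parameter multiply to zero for sufficiently many values of the
parameter, then one of the vectors is zero. -/
theorem exists_eq_zero_of_prod_eq_zero {p k : ℕ} (a : Fin p → Fin k → ℂ)
    (h : ∀ t : Fin (p * k + 1), ∏ i, ∑ j, a i j * ((t : ℕ) : ℂ) ^ (j : ℕ) = 0) : ∃ i, a i = 0 := by
  open Polynomial in
  let Q : Fin p → ℂ[X] := fun i => ∑ j, C (a i j) * X ^ (j : ℕ)
  have hQ : ∀ i, (Q i).natDegree ≤ k := fun i =>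
    Polynomial.natDegree_sum_le_of_forall_le _ _ fun j _ =>
      (Polynomial.natDegree_C_mul_X_pow_le _ _).trans j.2.le
  have hprod : ∏ i, Q i = 0 := by
    refine Polynomial.eq_zero_of_natDegree_lt_card_of_eval_eq_zero _
      (f := fun t : Fin (p * k + 1) => ((t : ℕ) : ℂ)) ?_ ?_ ?_
    · intro s t hst
      exact Fin.ext (Nat.cast_injective (R := ℂ) hst)
    · intro t
      rw [Polynomial.eval_prod, ← h t]
      refine Finset.prod_congr rfl fun i _ => ?_
      simp [Q, Polynomial.eval_finsetSum]
    · rw [Fintype.card_fin, Nat.lt_succ_iff]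
      refine (Polynomial.natDegree_prod_le _ _).trans ?_
      refine (Finset.sum_le_sum fun i _ => hQ i).trans ?_
      simp
  obtain ⟨i, -, hi⟩ := Finset.prod_eq_zero_iff.1 hprod
  refine ⟨i, funext fun j => ?_⟩
  have h1 := congrArg (fun q => Polynomial.coeff q (j : ℕ)) hi
  simp only [Q, Polynomial.finsetSum_coeff, Polynomial.coeff_C_mul, Polynomial.coeff_X_pow,
    Polynomial.coeff_zero] at h1
  rw [Finset.sum_eq_single j] at h1
  · simpa using h1
  · intro b _ hb
    rw [if_neg (fun h => hb (Fin.ext h.symm)), mul_zero]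
  · simp

/-- **Elimination**: the projection of the germ of an analytic set along a coordinate line meeting
it in an isolated point is again the germ of an analytic set. One equation has finitely many roots
on each line; the projection is cut out by the norms, over these roots, of sufficiently many linear
combinations of all equations. -/
theorem IsAnalyticGermAt.exists_image_fst [FiniteDimensional ℂ E] {S : Set (E × ℂ)} {x : E}
    (hS : IsAnalyticGermAt S (x, 0)) (hiso : ∀ᶠ ζ in 𝓝 (0 : ℂ), (x, ζ) ∈ S → ζ = 0)
    {O : Set (E × ℂ)} (hO : O ∈ 𝓝 (x, 0)) :
    ∃ O' ∈ 𝓝 (x, (0 : ℂ)), O' ⊆ O ∧ IsAnalyticGermAt (Prod.fst '' (S ∩ O')) x := by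
  obtain ⟨k, g, hg, hSg⟩ := hS
  have hl : Continuous fun ζ : ℂ => (x, ζ) := by fun_prop
  obtain ⟨i₀, hi₀⟩ : ∃ i, ¬ ∀ᶠ ζ in 𝓝 (0 : ℂ), g i (x, ζ) = 0 := by
    by_contra! hall
    have h1 : ∀ᶠ ζ in 𝓝 (0 : ℂ), ζ = 0 := by
      filter_upwards [hiso, eventually_all.2 hall, (hl.tendsto 0).eventually hSg] with ζ h1 h2 h3
      exact h1 (h3.2 h2)
    have h2 : ∃ᶠ ζ in 𝓝[≠] (0 : ℂ), ζ ≠ 0 :=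
      Eventually.frequently (eventually_mem_nhdsWithin)
    exact h2 ((h1.filter_mono nhdsWithin_le_nhds).mono fun _ h => not_not.2 h)
  have hgall : ∀ᶠ q in 𝓝 (x, (0 : ℂ)), ∀ i, AnalyticAt ℂ (g i) q :=
    eventually_all.2 fun i => (hg i).eventually_analyticAt
  obtain ⟨δ, hδ, r, hr, r', hr', hsub, hFa, hF0⟩ := exists_weierstrass_nhds (hg i₀) hi₀
    (inter_mem hO (inter_mem hSg hgall))
  have hrr : Metric.ball (0 : ℂ) r ⊆ Metric.ball 0 r' := Metric.ball_subset_ball hr'.le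
  obtain ⟨p, ρ, hρ, hρ0, hN⟩ := exists_roots_norm Metric.isOpen_ball
    (convex_ball x δ).isPreconnected hr hr' hFa hF0
  refine ⟨Metric.ball x δ ×ˢ Metric.ball 0 r, prod_mem_nhds (Metric.ball_mem_nhds _ hδ)
    (Metric.ball_mem_nhds _ hr), ?_, p * k + 1,
    fun t z => ∏ i, (fun q : E × ℂ => ∑ j, g j q * ((t : ℕ) : ℂ) ^ (j : ℕ)) (z, ρ z i), ?_, ?_⟩
  · rintro ⟨z, ζ⟩ ⟨hz, hζ⟩
    exact (hsub ⟨hz, hrr hζ⟩).1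
  · intro t
    exact hN (fun q : E × ℂ => ∑ j, g j q * ((t : ℕ) : ℂ) ^ (j : ℕ)) (fun q hq =>
      Finset.analyticAt_fun_sum _ fun j _ => ((hsub hq).2.2 j).mul analyticAt_const) x
      (Metric.mem_ball_self hδ)
  · filter_upwards [Metric.ball_mem_nhds x hδ] with z hz
    constructor
    · rintro ⟨⟨z', ζ⟩, ⟨hqS, -, hζ⟩, rfl⟩ t
      have hq := hsub (show (z', ζ) ∈ _ from ⟨hz, hrr hζ⟩)
      have h0 := hq.2.1.1 hqS
      obtain ⟨i, hi⟩ := (hρ0 z' hz ζ (Metric.ball_subset_closedBall hζ)).1 (h0 i₀)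
      refine Finset.prod_eq_zero (Finset.mem_univ i) ?_
      refine Finset.sum_eq_zero fun j _ => ?_
      simp only [hi]
      rw [h0 j, zero_mul]
    · intro h
      obtain ⟨i, hi⟩ := exists_eq_zero_of_prod_eq_zero (fun i j => g j (z, ρ z i)) h
      have hζ := hρ z hz i
      refine ⟨(z, ρ z i), ⟨?_, hz, hζ⟩, rfl⟩
      exact (hsub (show (z, ρ z i) ∈ _ from ⟨hz, hrr hζ⟩)).2.1.2 fun j => congrFun hi j

/-- Elimination of several coordinates, one at a time. -/
theorem IsAnalyticGermAt.exists_image_fst_pi [FiniteDimensional ℂ E] (k : ℕ) :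
    ∀ {S : Set (E × (Fin k → ℂ))} {x : E}
    (_ : IsAnalyticGermAt S (x, 0)) (_ : ∀ᶠ a in 𝓝 (0 : Fin k → ℂ), (x, a) ∈ S → a = 0)
    {O : Set (E × (Fin k → ℂ))} (_ : O ∈ 𝓝 (x, 0)),
    ∃ O' ∈ 𝓝 (x, (0 : Fin k → ℂ)), O' ⊆ O ∧ IsAnalyticGermAt (Prod.fst '' (S ∩ O')) x := by
  induction k with
  | zero =>
    intro S x hS hiso O hO
    refine ⟨O, hO, subset_rfl, ?_⟩
    have h1 : IsAnalyticGermAt ((fun z : E => (z, (0 : Fin 0 → ℂ))) ⁻¹' S) x :=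
      IsAnalyticGermAt.preimage (φ := fun z : E => (z, (0 : Fin 0 → ℂ))) hS
        (analyticAt_id.prod analyticAt_const)
    refine h1.congr ?_
    have h2 : Continuous fun z : E => (z, (0 : Fin 0 → ℂ)) := by fun_prop
    filter_upwards [h2.continuousAt.preimage_mem_nhds hO] with z hz
    constructor
    · exact fun h => ⟨(z, 0), ⟨h, hz⟩, rfl⟩
    · rintro ⟨⟨z', a⟩, ⟨h, -⟩, rfl⟩
      rwa [Subsingleton.elim a 0] at h
  | succ k ih =>
    intro S x hS hiso O hO
    let e : ((E × (Fin k → ℂ)) × ℂ) ≃L[ℂ] (E × (Fin (k + 1) → ℂ)) :=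
      (ContinuousLinearEquiv.prodAssoc ℂ E (Fin k → ℂ) ℂ).trans
        ((ContinuousLinearEquiv.refl ℂ E).prodCongr
          ((ContinuousLinearEquiv.prodComm ℂ (Fin k → ℂ) ℂ).trans
            (Fin.consEquivL ℂ (fun _ : Fin (k + 1) => ℂ))))
    have he : ∀ z a ζ, e ((z, a), ζ) = (z, Fin.cons ζ a) := fun z a ζ => rfl
    have he0 : e ((x, 0), 0) = (x, 0) := by
      rw [he]
      congr 1
      ext i
      refine Fin.cases rfl (fun _ => rfl) i
    obtain ⟨N, hN, hNiso⟩ : ∃ N ∈ 𝓝 (0 : Fin (k + 1) → ℂ), ∀ a ∈ N, (x, a) ∈ S → a = 0 :=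
      ⟨_, hiso, fun a ha => ha⟩
    have hO1 : e ⁻¹' (O ∩ (univ ×ˢ N)) ∈ 𝓝 ((x, (0 : Fin k → ℂ)), (0 : ℂ)) := by
      refine e.continuous.continuousAt.preimage_mem_nhds ?_
      rw [he0]
      exact inter_mem hO (prod_mem_nhds univ_mem hN)
    obtain ⟨O1, hO1n, hO1s, hO1g⟩ := IsAnalyticGermAt.exists_image_fst (S := e ⁻¹' S)
      (x := (x, (0 : Fin k → ℂ)))
      (IsAnalyticGermAt.preimage (by rw [he0]; exact hS) (e.analyticAt _)) (by
        have h1 : Continuous fun ζ : ℂ => (Fin.cons ζ 0 : Fin (k + 1) → ℂ) :=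
          continuous_pi fun i => by
            refine Fin.cases ?_ (fun _ => ?_) i
            · exact continuous_id
            · simpa using continuous_const
        have h2 : (Fin.cons (0 : ℂ) 0 : Fin (k + 1) → ℂ) = 0 := by
          ext i
          refine Fin.cases rfl (fun _ => rfl) i
        have h3 := h1.continuousAt.preimage_mem_nhds (x := (0 : ℂ)) (by rw [h2]; exact hN)
        filter_upwards [h3] with ζ hζ hζS
        exact congrFun (hNiso _ hζ hζS) 0) hO1
    obtain ⟨O2, hO2n, -, hO2g⟩ := ih hO1g (by
      refine Eventually.of_forall ?_
      rintro a ⟨⟨⟨z, a'⟩, ζ⟩, ⟨hS', hO'⟩, heq⟩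
      simp only [Prod.mk.injEq] at heq
      obtain ⟨rfl, rfl⟩ := heq
      have := hNiso _ (hO1s hO').2.2 hS'
      ext i
      exact congrFun this i.succ) (univ_mem (f := 𝓝 (x, (0 : Fin k → ℂ))))
    refine ⟨e '' (O1 ∩ Prod.fst ⁻¹' O2), ?_, ?_, ?_⟩
    · rw [← he0]
      refine e.toHomeomorph.isOpenMap.image_mem_nhds (inter_mem hO1n ?_)
      exact continuous_fst.continuousAt.preimage_mem_nhds hO2n
    · rintro _ ⟨q, ⟨hq, -⟩, rfl⟩
      exact (hO1s hq).1
    · refine hO2g.congr (Eventually.of_forall fun z => ?_)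
      constructor
      · rintro ⟨_, ⟨⟨q, ⟨hqS, hq1⟩, rfl⟩, hq2⟩, rfl⟩
        exact ⟨e q, ⟨hqS, q, ⟨hq1, hq2⟩, rfl⟩, rfl⟩
      · rintro ⟨_, ⟨hqS, q, ⟨hq1, hq2⟩, rfl⟩, rfl⟩
        exact ⟨q.1, ⟨⟨q, ⟨hqS, hq1⟩, rfl⟩, hq2⟩, rfl⟩

/-- **Finite mapping theorem** for germs: a holomorphic map with an isolated fibre maps germs of
analytic sets to germs of analytic sets. The source coordinates are eliminated from the graph. -/
theorem IsAnalyticGermAt.exists_image [FiniteDimensional ℂ E] [FiniteDimensional ℂ E'] {A : Set E}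
    {x₀ : E} (hA : IsAnalyticGermAt A x₀) {U : E → E'} (hU : AnalyticAt ℂ U x₀)
    (hiso : ∀ᶠ z in 𝓝 x₀, U z = U x₀ → z = x₀) {O : Set E} (hO : O ∈ 𝓝 x₀) :
    ∃ O' ∈ 𝓝 x₀, O' ⊆ O ∧ IsAnalyticGermAt (U '' (A ∩ O')) (U x₀) := by
  let e : E ≃L[ℂ] (Fin (Module.finrank ℂ E) → ℂ) := ContinuousLinearEquiv.ofFinrankEq (by simp)
  let e' : E' ≃L[ℂ] (Fin (Module.finrank ℂ E') → ℂ) := ContinuousLinearEquiv.ofFinrankEq (by simp)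
  let ψ : (Fin (Module.finrank ℂ E) → ℂ) → E := fun a => x₀ + e.symm a
  have hψ0 : ψ 0 = x₀ := by simp [ψ]
  have hψa : ∀ a, AnalyticAt ℂ ψ a := fun a => analyticAt_const.add (e.symm.analyticAt a)
  obtain ⟨k, g, hg, hAg⟩ := hA
  have hψ2 : AnalyticAt ℂ (fun q : E' × (Fin (Module.finrank ℂ E) → ℂ) => ψ q.2) (U x₀, 0) :=
    (hψa 0).comp_of_eq analyticAt_snd rfl
  -- the graph of `U` over `A`
  let Γ : Set (E' × (Fin (Module.finrank ℂ E) → ℂ)) := {q | ψ q.2 ∈ A ∧ U (ψ q.2) = q.1}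
  have hΓ : IsAnalyticGermAt Γ (U x₀, 0) := by
    refine IsAnalyticGermAt.of_fintype (ι := Fin k ⊕ Fin (Module.finrank ℂ E'))
      (g := Sum.elim (fun i q => g i (ψ q.2)) (fun j q => e' (U (ψ q.2) - q.1) j)) ?_ ?_
    · rintro (i | j)
      · exact (hg i).comp_of_eq hψ2 hψ0
      · have h1 : AnalyticAt ℂ (fun q : E' × (Fin (Module.finrank ℂ E) → ℂ) =>
            U (ψ q.2) - q.1) (U x₀, 0) := (hU.comp_of_eq hψ2 hψ0).sub analyticAt_fst
        exact (((ContinuousLinearMap.proj (R := ℂ) (φ := fun _ => ℂ) j).comp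
          (e' : E' →L[ℂ] (Fin (Module.finrank ℂ E') → ℂ))).analyticAt _).comp h1
    · have h2 : Tendsto (fun q : E' × (Fin (Module.finrank ℂ E) → ℂ) => ψ q.2) (𝓝 (U x₀, 0))
          (𝓝 x₀) := by
        have := hψ2.continuousAt.tendsto
        rwa [hψ0] at this
      filter_upwards [h2.eventually hAg] with q hq
      simp only [Γ, mem_ofPred_eq, hq, Sum.forall, Sum.elim_inl, Sum.elim_inr]
      refine and_congr_right fun _ => ?_
      rw [← sub_eq_zero, ← e'.map_eq_zero_iff]
      exact funext_iff
  obtain ⟨N, hN, hNiso⟩ : ∃ N ∈ 𝓝 x₀, ∀ z ∈ N, U z = U x₀ → z = x₀ := ⟨_, hiso, fun z hz => hz⟩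
  have hψc : ContinuousAt ψ 0 := (hψa 0).continuousAt
  have hO1 : (univ : Set E') ×ˢ (ψ ⁻¹' O) ∈ 𝓝 (U x₀, (0 : Fin (Module.finrank ℂ E) → ℂ)) :=
    prod_mem_nhds univ_mem (hψc.preimage_mem_nhds (by rwa [hψ0]))
  obtain ⟨O', hO'n, hO's, hO'g⟩ := hΓ.exists_image_fst_pi _ (by
    filter_upwards [hψc.preimage_mem_nhds (by rwa [hψ0])] with a ha haΓ
    have := hNiso _ ha haΓ.2
    simpa [ψ] using this) hO1
  let θ : E → E' × (Fin (Module.finrank ℂ E) → ℂ) := fun z => (U z, e (z - x₀))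
  have hθ : ContinuousAt θ x₀ := hU.continuousAt.prodMk (by fun_prop)
  have hθ0 : θ x₀ = (U x₀, 0) := by simp [θ]
  have hψe : ∀ z, ψ (e (z - x₀)) = z := fun z => by simp [ψ]
  refine ⟨θ ⁻¹' O', hθ.preimage_mem_nhds (by rwa [hθ0]), ?_, ?_⟩
  · intro z hz
    have := (hO's hz).2
    rwa [mem_preimage, hψe] at this
  · refine hO'g.congr (Eventually.of_forall fun v => ?_)
    constructor
    · rintro ⟨⟨v', a⟩, ⟨⟨h1, h2⟩, h3⟩, rfl⟩
      refine ⟨ψ a, ⟨h1, ?_⟩, h2⟩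
      have : θ (ψ a) = (v', a) := Prod.ext h2 (by simp [θ, ψ])
      rwa [mem_preimage, this]
    · rintro ⟨z, ⟨h1, h2⟩, rfl⟩
      refine ⟨θ z, ⟨⟨?_, ?_⟩, h2⟩, rfl⟩
      · simpa only [θ, hψe] using h1
      · simp only [θ, hψe]

/-- **Noether normalization** of the germ of an analytic set: after a linear projection it becomes
finite over a full neighbourhood of the origin. -/
theorem IsAnalyticGermAt.exists_finite_projection (d : ℕ) : ∀ {S : Set (Fin d → ℂ)}
    (_ : IsAnalyticGermAt S 0) (_ : (0 : Fin d → ℂ) ∈ S) {O : Set (Fin d → ℂ)} (_ : O ∈ 𝓝 0),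
    ∃ (k : ℕ) (l : (Fin d → ℂ) →L[ℂ] (Fin k → ℂ)), (∀ᶠ q in 𝓝 0, q ∈ S → l q = 0 → q = 0) ∧
      l '' (S ∩ O) ∈ 𝓝 0 ∧ (S ∉ 𝓝 0 → k < d) := by
  induction d with
  | zero =>
    intro S _ h0 O hO
    refine ⟨0, 0, Eventually.of_forall fun q _ _ => Subsingleton.elim _ _, ?_, ?_⟩
    · have : (0 : (Fin 0 → ℂ) →L[ℂ] (Fin 0 → ℂ)) '' (S ∩ O) = univ := by
        refine eq_univ_of_forall fun q => ⟨0, ⟨h0, mem_of_mem_nhds hO⟩, Subsingleton.elim _ _⟩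
      rw [this]
      exact univ_mem
    · intro h
      refine absurd ?_ h
      have : S = univ := eq_univ_of_forall fun q => by rwa [Subsingleton.elim q 0]
      rw [this]
      exact univ_mem
  | succ d ih =>
    intro S hS h0 O hO
    by_cases hSn : S ∈ 𝓝 0
    · refine ⟨d + 1, ContinuousLinearMap.id ℂ _, Eventually.of_forall fun q _ h => h, ?_,
        fun h => absurd hSn h⟩
      simpa using ⟨hSn, hO⟩
    obtain ⟨k, g, hg, hSg⟩ := id hS
    obtain ⟨i₀, hi₀⟩ : ∃ i, ¬ ∀ᶠ q in 𝓝 (0 : Fin (d + 1) → ℂ), g i q = 0 := by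
      by_contra! hall
      refine hSn ?_
      filter_upwards [hSg, eventually_all.2 hall] with q h1 h2
      exact h1.2 h2
    obtain ⟨v, hv⟩ := (hg i₀).exists_line_not_eventually_zero hi₀
    have hg0 : g i₀ 0 = 0 := hSg.self_of_nhds.1 h0 i₀
    have hv0 : v ≠ 0 := by
      rintro rfl
      exact hv (Eventually.of_forall fun t => by simpa using hg0)
    obtain ⟨e, he⟩ := exists_equiv_prod_of_ne_zero (d := d) (by simp) hv0
    have hline : ∀ ζ : ℂ, e.symm (0, ζ) = ζ • v := by
      intro ζ
      rw [e.symm_apply_eq, map_smul, he]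
      simp
    have hisoline : ∀ᶠ ζ in 𝓝 (0 : ℂ), ζ • v ∈ S → ζ = 0 := by
      have h1 : AnalyticAt ℂ (fun t : ℂ => g i₀ (0 + t • v)) 0 :=
        (hg i₀).comp_of_eq (analyticAt_const.add (analyticAt_id.smul analyticAt_const)) (by simp)
      have h2 := h1.eventually_eq_zero_or_eventually_ne_zero.resolve_left hv
      rw [eventually_nhdsWithin_iff] at h2
      have h3 : Tendsto (fun t : ℂ => t • v) (𝓝 0) (𝓝 0) := by
        have h4 : Continuous fun t : ℂ => t • v := by fun_prop
        simpa using h4.tendsto 0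
      filter_upwards [h2, h3.eventually hSg] with ζ h4 h5 h6
      by_contra h7
      exact h4 h7 (by simpa using h5.1 h6 i₀)
    have hO1 : e.symm ⁻¹' O ∈ 𝓝 ((0 : Fin d → ℂ), (0 : ℂ)) :=
      e.symm.continuous.continuousAt.preimage_mem_nhds (by
        rw [show ((0 : Fin d → ℂ), (0 : ℂ)) = 0 from rfl, map_zero]; exact hO)
    obtain ⟨O', hO'n, hO's, hO'g⟩ := IsAnalyticGermAt.exists_image_fst (S := e.symm ⁻¹' S)
      (x := (0 : Fin d → ℂ)) (IsAnalyticGermAt.preimage (by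
        rw [show ((0 : Fin d → ℂ), (0 : ℂ)) = 0 from rfl, map_zero]; exact hS)
        (e.symm.analyticAt _)) (by
        filter_upwards [hisoline] with ζ h1 h2
        rw [mem_preimage, hline] at h2
        exact h1 h2) hO1
    obtain ⟨k', l, hl1, hl2, hl3⟩ := ih hO'g
      ⟨(0, 0), ⟨by rw [mem_preimage, show ((0 : Fin d → ℂ), (0 : ℂ)) = 0 from rfl, map_zero]; exact h0,
        mem_of_mem_nhds hO'n⟩, rfl⟩ (univ_mem (f := 𝓝 (0 : Fin d → ℂ)))
    have hk' : k' ≤ d := by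
      by_contra hlt
      have h5 := hl3
      by_cases h6 : Prod.fst '' (e.symm ⁻¹' S ∩ O') ∈ 𝓝 (0 : Fin d → ℂ)
      · -- the image of a linear map has dimension at most `d`
        have h7 : Function.Surjective l := by
          have h8 : (LinearMap.range l.toLinearMap : Set (Fin k' → ℂ)) ∈ 𝓝 0 :=
            mem_of_superset hl2 (by rintro _ ⟨q, -, rfl⟩; exact ⟨q, rfl⟩)
          have h9 := Submodule.eq_top_of_nonempty_interior' (LinearMap.range l.toLinearMap)
            ⟨0, mem_interior_iff_mem_nhds.2 h8⟩
          exact LinearMap.range_eq_top.1 h9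
        have := LinearMap.finrank_le_finrank_of_surjective (f := l.toLinearMap) h7
        simp at this
        omega
      · have := hl3 h6
        omega
    refine ⟨k', l.comp ((ContinuousLinearMap.fst ℂ (Fin d → ℂ) ℂ).comp (e : (Fin (d + 1) → ℂ) →L[ℂ] (Fin d → ℂ) × ℂ)), ?_, ?_,
      fun _ => by omega⟩
    · have hec : Tendsto e (𝓝 0) (𝓝 ((0 : Fin d → ℂ), (0 : ℂ))) := by
        have := e.continuous.tendsto 0
        rwa [map_zero] at this
      have h1 : Tendsto (fun q => (e q).1) (𝓝 0) (𝓝 (0 : Fin d → ℂ)) :=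
        (continuous_fst.tendsto _).comp hec
      have h2 : Tendsto (fun q => (e q).2) (𝓝 0) (𝓝 (0 : ℂ)) :=
        (continuous_snd.tendsto _).comp hec
      filter_upwards [h1.eventually hl1, h2.eventually hisoline, hec.eventually hO'n]
        with q h3 h4 h5 h6 h7
      have h8 : (e q).1 = 0 := h3 ⟨e q, ⟨by simpa using h6, h5⟩, rfl⟩ h7
      have h9 : q = (e q).2 • v := by
        rw [← hline, ← h8]
        simp
      have h10 : (e q).2 = 0 := h4 (by rw [← h9]; exact h6)
      calc q = (e q).2 • v := h9
        _ = 0 := by rw [h10, zero_smul]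
    · refine mem_of_superset hl2 ?_
      rintro _ ⟨_, ⟨⟨q, ⟨hq1, hq2⟩, rfl⟩, -⟩, rfl⟩
      exact ⟨e.symm q, ⟨hq1, hO's hq2⟩, by simp⟩

/-- Zeros of a holomorphic function persist on nearby parallel lines: the zero set of a function
vanishing at `p` projects onto a neighbourhood in a space of one dimension less. -/
theorem AnalyticAt.exists_projection_zeros [FiniteDimensional ℂ E] {d : ℕ}
    (hd : Module.finrank ℂ E = d + 1) {F : E → ℂ} {p : E} (hF : AnalyticAt ℂ F p) (h0 : F p = 0)
    (h : ¬ ∀ᶠ q in 𝓝 p, F q = 0) :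
    ∃ l : E →L[ℂ] (Fin d → ℂ), ∀ O ∈ 𝓝 p, l '' (F ⁻¹' {0} ∩ O) ∈ 𝓝 (l p) := by
  obtain ⟨v, hv⟩ := hF.exists_line_not_eventually_zero h
  have hv0 : v ≠ 0 := by
    rintro rfl
    exact hv (Eventually.of_forall fun t => by simpa using h0)
  obtain ⟨e, he⟩ := exists_equiv_prod_of_ne_zero hd hv0
  let ψ : (Fin d → ℂ) × ℂ → E := fun q => p + e.symm q
  have hψa : ∀ q, AnalyticAt ℂ ψ q := fun q => analyticAt_const.add (e.symm.analyticAt q)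
  have hψ0 : ψ (0, 0) = p := by
    simp [ψ, show ((0 : Fin d → ℂ), (0 : ℂ)) = 0 from rfl]
  have hline : ∀ ζ : ℂ, ψ (0, ζ) = p + ζ • v := by
    intro ζ
    have : e.symm (0, ζ) = ζ • v := by
      rw [e.symm_apply_eq, map_smul, he]
      simp
    simp only [ψ, this]
  refine ⟨(ContinuousLinearMap.fst ℂ (Fin d → ℂ) ℂ).comp (e : E →L[ℂ] (Fin d → ℂ) × ℂ), fun O hO => ?_⟩
  have hFψ : AnalyticAt ℂ (F ∘ ψ) (0, 0) := by
    refine AnalyticAt.comp ?_ (hψa _)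
    rwa [hψ0]
  obtain ⟨δ, hδ, r, hr, r', hr', hsub, hFa, hF0⟩ := exists_weierstrass_nhds hFψ
    (by simpa only [Function.comp_apply, hline] using hv)
    ((hψa (0, 0)).continuousAt.preimage_mem_nhds (by rwa [hψ0]))
  obtain ⟨m, ρ, hρ, hρ0, -⟩ := exists_roots_norm Metric.isOpen_ball
    (convex_ball (0 : Fin d → ℂ) δ).isPreconnected hr hr' hFa hF0
  obtain ⟨i, -⟩ := (hρ0 0 (Metric.mem_ball_self hδ) 0 (Metric.mem_closedBall_self hr.le)).1
    (by rw [Function.comp_apply, hψ0, h0])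
  have hcont : ContinuousAt (fun w : Fin d → ℂ => w - (e p).1) (e p).1 := by fun_prop
  have hball : (fun w : Fin d → ℂ => w - (e p).1) ⁻¹' Metric.ball 0 δ ∈ 𝓝 (e p).1 :=
    hcont.preimage_mem_nhds (by rw [sub_self]; exact Metric.ball_mem_nhds _ hδ)
  refine mem_of_superset hball fun w hw => ?_
  have h1 := hρ _ hw i
  refine ⟨ψ (w - (e p).1, ρ (w - (e p).1) i), ⟨?_, ?_⟩, ?_⟩
  · exact (hρ0 _ hw _ (Metric.ball_subset_closedBall h1)).2 ⟨i, rfl⟩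
  · exact hsub ⟨hw, Metric.ball_subset_ball hr'.le h1⟩
  · simp [ψ]

/-- **Riemann's extension theorem** for continuous functions: a continuous function that is
holomorphic off a thin analytic set is holomorphic. It is given by Cauchy's integral over circles
transversal to the thin set. -/
theorem AnalyticAt.of_continuous_off_zeros [FiniteDimensional ℂ E] {F j : E → ℂ} {p : E}
    (hF : AnalyticAt ℂ F p) (h : ¬ ∀ᶠ q in 𝓝 p, F q = 0) (hjc : ∀ᶠ q in 𝓝 p, ContinuousAt j q)
    (hj : ∀ᶠ q in 𝓝 p, F q ≠ 0 → AnalyticAt ℂ j q) : AnalyticAt ℂ j p := by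
  by_cases h0 : F p = 0
  swap
  · exact hj.self_of_nhds h0
  obtain ⟨v, hv⟩ := hF.exists_line_not_eventually_zero h
  have hv0 : v ≠ 0 := by
    rintro rfl
    exact hv (Eventually.of_forall fun t => by simpa using h0)
  obtain ⟨d, hd⟩ : ∃ d, Module.finrank ℂ E = d + 1 :=
    Nat.exists_eq_succ_of_ne_zero (Module.finrank_pos_iff_exists_ne_zero.2 ⟨v, hv0⟩).ne'
  obtain ⟨e, he⟩ := exists_equiv_prod_of_ne_zero hd hv0
  let ψ : (Fin d → ℂ) × ℂ → E := fun q => p + e.symm q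
  have hψa : ∀ q, AnalyticAt ℂ ψ q := fun q => analyticAt_const.add (e.symm.analyticAt q)
  have hψ0 : ψ (0, 0) = p := by
    simp [ψ, show ((0 : Fin d → ℂ), (0 : ℂ)) = 0 from rfl]
  have hline : ∀ ζ : ℂ, ψ (0, ζ) = p + ζ • v := by
    intro ζ
    have : e.symm (0, ζ) = ζ • v := by
      rw [e.symm_apply_eq, map_smul, he]
      simp
    simp only [ψ, this]
  have hFψ : AnalyticAt ℂ (F ∘ ψ) (0, 0) := by
    refine AnalyticAt.comp ?_ (hψa _)
    rwa [hψ0]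
  obtain ⟨δ, hδ, r, hr, r', hr', hsub, hFa, hF0⟩ := exists_weierstrass_nhds hFψ
    (by simpa only [Function.comp_apply, hline] using hv)
    ((hψa (0, 0)).continuousAt.preimage_mem_nhds (by rw [hψ0]; exact inter_mem hjc hj))
  have hcl : Metric.closedBall (0 : ℂ) r ⊆ Metric.ball 0 r' := Metric.closedBall_subset_ball hr'
  have hJan : ∀ q ∈ Metric.ball (0 : Fin d → ℂ) δ ×ˢ Metric.ball (0 : ℂ) r', F (ψ q) ≠ 0 →
      AnalyticAt ℂ (j ∘ ψ) q := fun q hq hne => ((hsub hq).2 hne).comp (hψa q)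
  have hcauchy : AnalyticAt ℂ (fun q : (Fin d → ℂ) × ℂ => (2 * Real.pi * Complex.I : ℂ)⁻¹ •
      ∮ w in C(0, r), (fun y : ((Fin d → ℂ) × ℂ) × ℂ =>
        (y.2 - y.1.2)⁻¹ • (j ∘ ψ) (y.1.1, y.2)) (q, w)) (0, 0) := by
    have h1 : AnalyticOnNhd ℂ (fun y : ((Fin d → ℂ) × ℂ) × ℂ =>
        (y.2 - y.1.2)⁻¹ • (j ∘ ψ) (y.1.1, y.2))
        ((Metric.ball 0 δ ×ˢ Metric.ball 0 r) ×ˢ Metric.sphere 0 r) := by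
      rintro ⟨⟨z, ζ⟩, w⟩ ⟨⟨hz, hζ⟩, hw⟩
      have h2 : w - ζ ≠ 0 := by
        intro h3
        rw [sub_eq_zero] at h3
        subst h3
        exact (Metric.mem_ball.1 hζ).ne hw
      have h4 : AnalyticAt ℂ (fun y : ((Fin d → ℂ) × ℂ) × ℂ => (y.1.1, y.2)) ((z, ζ), w) :=
        (analyticAt_fst.comp analyticAt_fst).prod analyticAt_snd
      refine AnalyticAt.fun_smul (AnalyticAt.inv (analyticAt_snd.sub
        (analyticAt_snd.comp analyticAt_fst)) h2) ?_
      refine AnalyticAt.comp_of_eq (g := j ∘ ψ) (hJan (z, w) ⟨hz, hcl (Metric.sphere_subset_closedBall hw)⟩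
        (hF0 z hz w hw)) h4 rfl
    exact analyticAt_const.fun_smul (AnalyticOnNhd.circleIntegral_param
      (Metric.isOpen_ball.prod Metric.isOpen_ball) hr.le h1 (0, 0)
      ⟨Metric.mem_ball_self hδ, Metric.mem_ball_self hr⟩)
  have hjψ : AnalyticAt ℂ (j ∘ ψ) (0, 0) := by
    refine hcauchy.congr ?_
    filter_upwards [prod_mem_nhds (Metric.ball_mem_nhds (0 : Fin d → ℂ) hδ)
      (Metric.ball_mem_nhds (0 : ℂ) hr)]
    rintro ⟨z, ζ⟩ ⟨hz, hζ⟩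
    simp only at hz hζ ⊢
    have hinc : ∀ w, AnalyticAt ℂ (fun w : ℂ => (z, w)) w :=
      fun w => analyticAt_const.prod analyticAt_id
    have hFz : AnalyticOnNhd ℂ (fun w => F (ψ (z, w))) (Metric.ball 0 r') := fun w hw =>
      (hFa (z, w) ⟨hz, hw⟩).comp_of_eq (hinc w) rfl
    obtain ⟨m, ρ, u, -, -, hu0, hρu⟩ := hFz.exists_roots hr hr' (hF0 z hz)
    refine Complex.two_pi_I_inv_smul_circleIntegral_sub_inv_smul_of_differentiable_on_off_countable
      (s := range ρ) (countable_range ρ) (f := fun w => (j ∘ ψ) (z, w)) hζ ?_ ?_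
    · intro w hw
      refine ContinuousAt.continuousWithinAt ?_
      have h1 : ContinuousAt j (ψ (z, w)) := (hsub ⟨hz, hcl hw⟩).1
      exact ContinuousAt.comp (f := fun w : ℂ => ψ (z, w)) h1
        ((hψa (z, w)).continuousAt.comp (f := fun w : ℂ => (z, w)) (hinc w).continuousAt)
    · rintro w ⟨hw, hwρ⟩
      have hw' := Metric.ball_subset_closedBall hw
      refine ((hJan (z, w) ⟨hz, hcl hw'⟩ ?_).comp_of_eq (hinc w) rfl).differentiableAt
      rw [hρu]
      refine mul_ne_zero (Finset.prod_ne_zero_iff.2 fun i _ => ?_) (hu0 w hw')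
      exact sub_ne_zero.2 fun h => hwρ ⟨i, h.symm⟩
  have h5 : AnalyticAt ℂ (fun q : E => e (q - p)) p :=
    (e.analyticAt _).comp (analyticAt_id.sub analyticAt_const)
  have h6 := hjψ.comp_of_eq h5 (by simp; rfl)
  refine h6.congr (Eventually.of_forall fun q => ?_)
  simp [ψ]

end Germs

/-! ### Riemann extension and Sard's theorem on analytic sets -/

section Sard

variable {E : Type*} [NormedAddCommGroup E] [NormedSpace ℂ E]
variable {E' : Type*} [NormedAddCommGroup E'] [NormedSpace ℂ E']

/-- If the derivative of each function in a sequence is, up to a fixed factor, the next one, and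
all the functions vanish at `0`, then the first one vanishes identically near `0`: its order of
vanishing exceeds that of the next one. -/
theorem eventually_eq_zero_of_deriv_chain {a : ℕ → ℂ → ℂ} {s : ℂ → ℂ}
    (ha : ∀ k, AnalyticAt ℂ (a k) 0) (hs : AnalyticAt ℂ s 0)
    (hd : ∀ k, deriv (a k) =ᶠ[𝓝 0] s * a (k + 1)) (h0 : ∀ k, a k 0 = 0) :
    ∀ᶠ t in 𝓝 0, a 0 t = 0 := by
  have key : ∀ m k : ℕ, (m : ℕ∞) ≤ analyticOrderAt (a k) 0 := by
    intro m
    induction m with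
    | zero => simp
    | succ m ih =>
      intro k
      have h1 := (ha k).analyticOrderAt_deriv_add_one
      simp only [h0 k, sub_zero] at h1
      rw [← h1, analyticOrderAt_congr (hd k), analyticOrderAt_mul hs (ha _)]
      push_cast
      gcongr
      exact (ih (k + 1)).trans le_add_self
  rw [← analyticOrderAt_eq_top]
  exact ENat.eq_top_iff_forall_ge.2 fun m => key m 0

/-- Coordinates in which a holomorphic function with nonzero differential is the last
coordinate. -/
theorem AnalyticAt.exists_straighten [FiniteDimensional ℂ E] {m : ℕ}
    (hE : Module.finrank ℂ E = m + 1) {h : E → ℂ} {p v : E} (hh : AnalyticAt ℂ h p)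
    (hv : fderiv ℂ h p v ≠ 0) {O : Set E} (hO : O ∈ 𝓝 p) :
    ∃ Φ : OpenPartialHomeomorph E ((Fin m → ℂ) × ℂ), p ∈ Φ.source ∧ Φ.source ⊆ O ∧
      (∀ q, (Φ q).2 = h q) ∧ AnalyticOnNhd ℂ Φ Φ.source ∧ AnalyticOnNhd ℂ Φ.symm Φ.target := by
  have hv0 : v ≠ 0 := by
    rintro rfl
    simp at hv
  obtain ⟨e, he⟩ := exists_equiv_prod_of_ne_zero hE hv0
  let g : E → (Fin m → ℂ) × ℂ := fun q => ((e q).1, h q)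
  let L : E →L[ℂ] (Fin m → ℂ) :=
    (ContinuousLinearMap.fst ℂ (Fin m → ℂ) ℂ).comp (e : E →L[ℂ] (Fin m → ℂ) × ℂ)
  have hg : AnalyticAt ℂ g p := (L.analyticAt p).prod hh
  have hdg : HasFDerivAt g (L.prod (fderiv ℂ h p)) p :=
    L.hasFDerivAt.prodMk hh.differentiableAt.hasFDerivAt
  have hinj : Function.Injective (L.prod (fderiv ℂ h p)) := by
    rw [injective_iff_map_eq_zero]
    intro w hw
    have h1 : (e w).1 = 0 := congrArg Prod.fst hw
    have h2 : fderiv ℂ h p w = 0 := congrArg Prod.snd hw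
    have h3 : w = (e w).2 • v := by
      apply e.injective
      rw [map_smul, he]
      ext1 <;> simp [h1]
    rw [h3, map_smul, smul_eq_mul] at h2
    rw [h3, (mul_eq_zero.1 h2).resolve_right hv, zero_smul]
  let e' : E ≃L[ℂ] (Fin m → ℂ) × ℂ :=
    (LinearEquiv.ofInjectiveOfFinrankEq (L.prod (fderiv ℂ h p)).toLinearMap hinj
      (by simp [hE])).toContinuousLinearEquiv
  have he' : HasFDerivAt g (e' : E →L[ℂ] (Fin m → ℂ) × ℂ) p := by
    refine hdg.congr_fderiv ?_
    ext1 w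
    rfl
  obtain ⟨Φ, hp, hΦO, hΦg, ha, hb⟩ := hg.exists_openPartialHomeomorph e' he' hO
  exact ⟨Φ, hp, hΦO, fun q => by rw [hΦg], by rwa [hΦg], hb⟩

/-- Sard's theorem in equal dimensions. -/
theorem volume_image_eq_zero_of_not_surjective {m : ℕ} {Λ : (Fin m → ℂ) → (Fin m → ℂ)}
    {S : Set (Fin m → ℂ)} (hΛ : ∀ x ∈ S, DifferentiableAt ℂ Λ x)
    (hS : ∀ x ∈ S, ¬ Function.Surjective (fderiv ℂ Λ x)) :
    MeasureTheory.volume (Λ '' S) = 0 := by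
  refine MeasureTheory.addHaar_image_eq_zero_of_det_fderivWithin_eq_zero MeasureTheory.volume
    (f' := fun x => (fderiv ℂ Λ x).restrictScalars ℝ)
    (fun x hx => ((hΛ x hx).hasFDerivAt.restrictScalars ℝ).hasFDerivWithinAt) fun x hx => ?_
  by_contra h0
  refine hS x hx ?_
  exact (LinearMap.equivOfDetNeZero
    ((fderiv ℂ Λ x).restrictScalars ℝ : (Fin m → ℂ) →L[ℝ] (Fin m → ℂ)).toLinearMap h0).surjective

/-- Sard's theorem on a smooth hypersurface. -/
theorem AnalyticAt.exists_volume_image_zeros_eq_zero [FiniteDimensional ℂ E] {m : ℕ}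
    (hE : Module.finrank ℂ E = m + 1) {h : E → ℂ} {p v : E} (hh : AnalyticAt ℂ h p)
    (hv : fderiv ℂ h p v ≠ 0) {Λ : E → Fin m → ℂ} (hΛ : AnalyticAt ℂ Λ p) {A : Set E}
    (hA : ∀ᶠ q in 𝓝 p, q ∈ A → ¬ Function.Surjective (fderiv ℂ Λ q)) :
    ∃ O ∈ 𝓝 p, MeasureTheory.volume (Λ '' (A ∩ h ⁻¹' {0} ∩ O)) = 0 := by
  obtain ⟨Φ, hp, hΦO, hΦh, ha, hb⟩ :=
    hh.exists_straighten hE hv (hA.and hΛ.eventually_analyticAt)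
  refine ⟨Φ.source, Φ.open_source.mem_nhds hp, ?_⟩
  let ι : (Fin m → ℂ) →L[ℂ] (Fin m → ℂ) × ℂ := ContinuousLinearMap.inl ℂ (Fin m → ℂ) ℂ
  let S : Set (Fin m → ℂ) := {a | ι a ∈ Φ.target ∧ Φ.symm (ι a) ∈ A}
  have hd1 : ∀ x ∈ S, DifferentiableAt ℂ Λ (Φ.symm (ι x)) := fun x hx =>
    (hΦO (Φ.map_target hx.1)).2.differentiableAt
  have hd2 : ∀ x ∈ S, DifferentiableAt ℂ (fun a => Φ.symm (ι a)) x := fun x hx =>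
    (hb _ hx.1).differentiableAt.comp x ι.differentiableAt
  refine MeasureTheory.measure_mono_null ?_
    (volume_image_eq_zero_of_not_surjective (Λ := fun a => Λ (Φ.symm (ι a))) (S := S) ?_ ?_)
  · rintro _ ⟨q, ⟨⟨hqA, hqh⟩, hq⟩, rfl⟩
    have h1 : ι (Φ q).1 = Φ q := by
      ext1
      · rfl
      · exact ((hΦh q).trans hqh).symm
    exact ⟨(Φ q).1, ⟨by rw [h1]; exact Φ.map_source hq, by rwa [h1, Φ.left_inv hq]⟩,
      by simp only [h1, Φ.left_inv hq]⟩
  · exact fun x hx => (hd1 x hx).comp x (hd2 x hx)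
  · intro x hx hsurj
    rw [show (fun a => Λ (Φ.symm (ι a))) = Λ ∘ (fun a => Φ.symm (ι a)) from rfl,
      fderiv_comp x (hd1 x hx) (hd2 x hx)] at hsurj
    exact (hΦO (Φ.map_target hx.1)).1 hx.2 (Function.Surjective.of_comp hsurj)

theorem volume_image_eq_zero_of_locally {X : Type*} [TopologicalSpace X]
    [SecondCountableTopology X] {m : ℕ} {Λ : X → Fin m → ℂ} {A : Set X}
    (h : ∀ q ∈ A, ∃ O ∈ 𝓝 q, MeasureTheory.volume (Λ '' (A ∩ O)) = 0) :
    MeasureTheory.volume (Λ '' A) = 0 := by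
  choose! O hO hv using h
  obtain ⟨t, htA, htc, htO⟩ := countable_cover_nhdsWithin (s := A) (f := O)
    fun x hx => mem_nhdsWithin_of_mem_nhds (hO x hx)
  refine MeasureTheory.measure_mono_null ?_
    ((MeasureTheory.measure_biUnion_null_iff htc (s := fun x => Λ '' (A ∩ O x))).2
      fun x hx => hv x (htA hx))
  rintro _ ⟨q, hq, rfl⟩
  obtain ⟨x, hx, hqx⟩ := mem_iUnion₂.1 (htO hq)
  exact mem_iUnion₂.2 ⟨x, hx, q, ⟨hq, hqx⟩, rfl⟩

/-- The iterated derivatives of a nonzero holomorphic function in a suitable fixed direction have no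
common zero near a given point. -/
theorem AnalyticAt.exists_iterated_derivs [FiniteDimensional ℂ E] {M : E → ℂ} {p : E}
    (hM : AnalyticAt ℂ M p) (hM0 : ¬ ∀ᶠ q in 𝓝 p, M q = 0) :
    ∃ (v : E) (Dv : ℕ → E → ℂ), Dv 0 = M ∧ (∀ j q, Dv (j + 1) q = fderiv ℂ (Dv j) q v) ∧
      (∀ q, AnalyticAt ℂ M q → ∀ j, AnalyticAt ℂ (Dv j) q) ∧ ∀ᶠ q in 𝓝 p, ∃ j, Dv j q ≠ 0 := by
  obtain ⟨v, hv⟩ := hM.exists_line_not_eventually_zero hM0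
  let F : E × ℂ → ℂ := fun x => M (x.1 + x.2 • v)
  have hF : AnalyticAt ℂ F (p, 0) :=
    hM.comp_of_eq (analyticAt_fst.add (analyticAt_snd.smul analyticAt_const)) (by simp)
  obtain ⟨δ, hδ, r, hr, r', hr', -, hFa, hF0⟩ := exists_weierstrass_nhds hF hv univ_mem
  have hline : ∀ q ∈ Metric.ball p δ, ¬ ∀ᶠ t in 𝓝 (0 : ℂ), M (q + t • v) = 0 := by
    intro q hq h0
    have h1 : AnalyticOnNhd ℂ (fun t => F (q, t)) (Metric.ball 0 r') := fun t ht =>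
      (hFa (q, t) ⟨hq, ht⟩).comp (analyticAt_const.prod analyticAt_id)
    have h2 := h1.eqOn_zero_of_preconnected_of_eventuallyEq_zero
      (convex_ball _ _).isPreconnected (Metric.mem_ball_self (hr.trans hr')) h0
    have h3 : ((r : ℝ) : ℂ) ∈ Metric.sphere (0 : ℂ) r := by simp [abs_of_pos hr]
    exact hF0 q hq _ h3 (h2 (Metric.sphere_subset_ball hr' h3))
  let Dv : ℕ → E → ℂ := fun j => (fun (h : E → ℂ) q => fderiv ℂ h q v)^[j] M
  have hDs : ∀ j q, Dv (j + 1) q = fderiv ℂ (Dv j) q v := fun j q => by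
    simp only [Dv, Function.iterate_succ_apply']
  have hDa : ∀ q, AnalyticAt ℂ M q → ∀ j, AnalyticAt ℂ (Dv j) q := by
    intro q hq j
    induction j with
    | zero => exact hq
    | succ j ih =>
      have : Dv (j + 1) = fun q => fderiv ℂ (Dv j) q v := funext (hDs j)
      rw [this]
      exact ((ContinuousLinearMap.apply ℂ ℂ v).analyticAt _).comp ih.fderiv
  refine ⟨v, Dv, rfl, hDs, hDa, ?_⟩
  filter_upwards [Metric.ball_mem_nhds p hδ, hM.eventually_analyticAt] with q hq hqa
  by_contra! hall
  have hl : ∀ t : ℂ, HasDerivAt (fun t : ℂ => q + t • v) v t := fun t => by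
    simpa using ((hasDerivAt_id t).smul_const v).const_add q
  have hl0 : Tendsto (fun t : ℂ => q + t • v) (𝓝 0) (𝓝 q) := by
    simpa using (hl 0).continuousAt.tendsto
  refine hline q hq (eventually_eq_zero_of_deriv_chain
    (a := fun j t => Dv j (q + t • v)) (s := 1) (fun j => ?_) analyticAt_const (fun j => ?_)
    fun j => by simpa using hall j)
  · exact (hDa q hqa j).comp_of_eq
      (analyticAt_const.add (analyticAt_id.smul analyticAt_const)) (by simp)
  · filter_upwards [hl0.eventually (hDa q hqa j).eventually_analyticAt] with t ht
    have := (ht.differentiableAt.hasFDerivAt.comp_hasDerivAt t (hl t)).deriv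
    simp only [Pi.mul_apply, Pi.one_apply, one_mul, hDs]
    exact this

/-- A set contained in the zero set of a nonzero holomorphic function is contained in a smooth
hypersurface, near some of its points. -/
theorem AnalyticAt.exists_smooth_hypersurface [FiniteDimensional ℂ E] {F : E → ℂ} {p : E}
    (hF : AnalyticAt ℂ F p) (hF0 : ¬ ∀ᶠ q in 𝓝 p, F q = 0) {A : Set E} (hp : p ∈ A)
    (hA : ∀ᶠ q in 𝓝 p, q ∈ A → F q = 0) {O : Set E} (hO : O ∈ 𝓝 p) :
    ∃ q ∈ A ∩ O, ∃ (h : E → ℂ) (v : E), AnalyticAt ℂ h q ∧ fderiv ℂ h q v ≠ 0 ∧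
      ∀ᶠ q' in 𝓝 q, q' ∈ A → h q' = 0 := by
  classical
  obtain ⟨v, Dv, hD0, hDs, hDa, hDv⟩ := hF.exists_iterated_derivs hF0
  obtain ⟨W, hWs, hWo, hpW⟩ := eventually_nhds_iff.1
    ((hA.and (hDv.and hF.eventually_analyticAt)).and (eventually_mem_set.2 hO))
  -- the least order of a derivative that does not vanish at some point of `A`
  have hex : ∃ j, ∃ q ∈ A ∩ W, Dv j q ≠ 0 := by
    obtain ⟨j, hj⟩ := (hWs p hpW).1.2.1
    exact ⟨j, p, ⟨hp, hpW⟩, hj⟩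
  obtain ⟨q, hq, hqj⟩ := Nat.find_spec hex
  obtain ⟨j, hj⟩ : ∃ j, Nat.find hex = j + 1 := by
    refine Nat.exists_eq_succ_of_ne_zero fun h0 => ?_
    rw [h0, hD0] at hqj
    exact hqj ((hWs q hq.2).1.1 hq.1)
  rw [hj, hDs] at hqj
  refine ⟨q, ⟨hq.1, (hWs q hq.2).2⟩, Dv j, v, hDa q (hWs q hq.2).1.2.2 j, hqj, ?_⟩
  filter_upwards [hWo.mem_nhds hq.2] with q' hq' hqA
  by_contra hne
  exact Nat.find_min hex (m := j) (by omega) ⟨q', ⟨hqA, hq'⟩, hne⟩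

/-- Sard's theorem on a proper analytic subset: a map to affine space of one dimension less, whose
differential is not surjective at the points of a set `A` contained in the zero set of a nonzero
holomorphic function `M`, maps `A` to a null set near `p`. Here `A` is covered by countably many
pieces of smooth hypersurfaces, the zero sets of the iterated derivatives of `M` in a fixed
direction. -/
theorem AnalyticAt.exists_volume_image_eq_zero [FiniteDimensional ℂ E] {m : ℕ}
    (hE : Module.finrank ℂ E = m + 1) {M : E → ℂ} {p : E} (hM : AnalyticAt ℂ M p)
    (hM0 : ¬ ∀ᶠ q in 𝓝 p, M q = 0) {Λ : E → Fin m → ℂ} (hΛ : AnalyticAt ℂ Λ p) {A : Set E}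
    (hAM : ∀ᶠ q in 𝓝 p, q ∈ A → M q = 0)
    (hA : ∀ᶠ q in 𝓝 p, q ∈ A → ¬ Function.Surjective (fderiv ℂ Λ q)) :
    ∃ O ∈ 𝓝 p, MeasureTheory.volume (Λ '' (A ∩ O)) = 0 := by
  classical
  have : ProperSpace E := FiniteDimensional.proper ℂ E
  obtain ⟨v, Dv, hD0, hDs, hDa, hDv⟩ := hM.exists_iterated_derivs hM0
  obtain ⟨O, hOs, hOo, hpO⟩ := eventually_nhds_iff.1 (hAM.and (hA.and
    (hDv.and (hM.eventually_analyticAt.and hΛ.eventually_analyticAt))))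
  refine ⟨O, hOo.mem_nhds hpO, ?_⟩
  have hpiece : ∀ j, MeasureTheory.volume
      (Λ '' (A ∩ O ∩ {q | Dv j q = 0 ∧ Dv (j + 1) q ≠ 0})) = 0 := by
    refine fun j => volume_image_eq_zero_of_locally fun q hq => ?_
    obtain ⟨-, h2, -, h4, h5⟩ := hOs q hq.1.2
    have h6 := hq.2.2
    rw [hDs] at h6
    obtain ⟨O', hO', hv'⟩ := (hDa q h4 j).exists_volume_image_zeros_eq_zero hE h6 h5
      (A := A ∩ O) (by
        filter_upwards [hOo.mem_nhds hq.1.2] with q' hq' hqA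
        exact (hOs q' hq').2.1 hqA.1)
    refine ⟨O', hO', MeasureTheory.measure_mono_null (image_mono ?_) hv'⟩
    exact fun x hx => ⟨⟨hx.1.1, hx.1.2.1⟩, hx.2⟩
  refine MeasureTheory.measure_mono_null ?_ (MeasureTheory.measure_iUnion_null hpiece)
  rintro _ ⟨q, hq, rfl⟩
  obtain ⟨h1, -, h3, -, -⟩ := hOs q hq.2
  obtain ⟨j, hj⟩ : ∃ j, Nat.find h3 = j + 1 := by
    refine Nat.exists_eq_succ_of_ne_zero fun h0 => ?_
    have h4 := Nat.find_spec h3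
    rw [h0, hD0] at h4
    exact h4 (h1 hq.1)
  refine mem_iUnion.2 ⟨j, q, ⟨hq, ?_, ?_⟩, rfl⟩
  · by_contra hne
    exact Nat.find_min h3 (m := j) (by omega) hne
  · rw [← hj]
    exact Nat.find_spec h3

/-- A holomorphic map all of whose fibres are discrete is immersive at some point: where the rank is
maximal, the map is constant along a curve in any direction of the kernel of its differential. -/
theorem AnalyticOnNhd.exists_injective_fderiv [FiniteDimensional ℂ E] [FiniteDimensional ℂ E']
    {G : E → E'} {O : Set E} (hG : AnalyticOnNhd ℂ G O) (hO : IsOpen O) (hne : O.Nonempty)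
    (hiso : ∀ q ∈ O, ∀ᶠ q' in 𝓝 q, G q' = G q → q' = q) :
    ∃ q ∈ O, Function.Injective (fderiv ℂ G q) := by
  -- a point where the rank is maximal
  obtain ⟨q₀, hq₀, hmax⟩ : ∃ q₀ ∈ O, ∀ q ∈ O, Module.finrank ℂ (fderiv ℂ G q).range ≤
      Module.finrank ℂ (fderiv ℂ G q₀).range := by
    have hfin : ((fun q => Module.finrank ℂ (fderiv ℂ G q).range) '' O).Finite :=
      (Set.finite_le_nat (Module.finrank ℂ E')).subset (by
        rintro _ ⟨q, -, rfl⟩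
        exact Submodule.finrank_le _)
    obtain ⟨_, ⟨⟨q₀, hq₀, rfl⟩, hm⟩⟩ := hfin.exists_maximal (hne.image _)
    refine ⟨q₀, hq₀, fun q hq => ?_⟩
    by_contra hlt
    exact hlt (hm (mem_image_of_mem _ hq) (not_le.1 hlt).le)
  refine ⟨q₀, hq₀, ?_⟩
  set L : E →L[ℂ] E' := fderiv ℂ G q₀ with hL
  obtain ⟨π', hπ'⟩ := L.range.subtype.exists_leftInverse_of_injective (by simp)
  obtain ⟨κ', hκ'⟩ := L.ker.subtype.exists_leftInverse_of_injective (by simp)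
  let π : E' →L[ℂ] L.range := LinearMap.toContinuousLinearMap π'
  let κ : E →L[ℂ] L.ker := LinearMap.toContinuousLinearMap κ'
  have hπ : ∀ y : L.range, π y = y := fun y => LinearMap.congr_fun hπ' y
  have hκ : ∀ y : L.ker, κ y = y := fun y => LinearMap.congr_fun hκ' y
  let Λ : E →L[ℂ] L.range × L.ker := (π.comp L).prod κ
  have hΛinj : Function.Injective Λ := by
    rw [injective_iff_map_eq_zero]
    intro w hw
    have h1 : π (L w) = 0 := congrArg Prod.fst hw
    have h2 : κ w = 0 := congrArg Prod.snd hw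
    have h3 : L w = 0 := by
      have := hπ ⟨L w, w, rfl⟩
      rw [h1] at this
      exact (congrArg Subtype.val this).symm
    have := hκ ⟨w, h3⟩
    rw [h2] at this
    exact (congrArg Subtype.val this).symm
  let e' : E ≃L[ℂ] L.range × L.ker :=
    (LinearEquiv.ofInjectiveOfFinrankEq Λ.toLinearMap hΛinj (by
      rw [Module.finrank_prod, L.toLinearMap.finrank_range_add_finrank_ker])).toContinuousLinearEquiv
  let g : E → L.range × L.ker := fun q => (π (G q), κ q)
  have hga : ∀ q ∈ O, AnalyticAt ℂ g q := fun q hq =>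
    ((π.analyticAt _).comp (hG q hq)).prod (κ.analyticAt q)
  have hdg : ∀ q ∈ O, HasFDerivAt g ((π.comp (fderiv ℂ G q)).prod κ) q := fun q hq =>
    (π.hasFDerivAt.comp q (hG q hq).differentiableAt.hasFDerivAt).prodMk κ.hasFDerivAt
  obtain ⟨Ψ, hqΨ, hΨO, hΨg, ha, hb⟩ := (hga q₀ hq₀).exists_openPartialHomeomorph e' (by
    refine (hdg q₀ hq₀).congr_fderiv ?_
    ext1 w
    rfl) (hO.mem_nhds hq₀)
  -- near `q₀` the projection `π` is injective on the range of the differential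
  have hker : ∀ q ∈ Ψ.source, ∀ w, π (fderiv ℂ G q w) = 0 → fderiv ℂ G q w = 0 := by
    intro q hq w hw
    have hsurj : Function.Surjective
        (π.toLinearMap.comp (fderiv ℂ G q).range.subtype) := by
      intro y
      have h1 : HasFDerivAt Ψ.symm (fderiv ℂ Ψ.symm (Ψ q)) (Ψ q) :=
        (hb _ (Ψ.map_source hq)).differentiableAt.hasFDerivAt
      have h2 : HasFDerivAt g ((π.comp (fderiv ℂ G q)).prod κ) (Ψ.symm (Ψ q)) := by
        rw [Ψ.left_inv hq]
        exact hdg q (hΨO hq)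
      have h3 : HasFDerivAt (g ∘ Ψ.symm) (ContinuousLinearMap.id ℂ _) (Ψ q) := by
        refine (hasFDerivAt_id (Ψ q)).congr_of_eventuallyEq ?_
        filter_upwards [Ψ.open_target.mem_nhds (Ψ.map_source hq)] with z hz
        rw [← hΨg]
        exact Ψ.right_inv hz
      have h4 := congrArg (fun T => (T (y, 0)).1) ((h2.comp (Ψ q) h1).unique h3)
      exact ⟨⟨fderiv ℂ G q (fderiv ℂ Ψ.symm (Ψ q) (y, 0)), _, rfl⟩, h4⟩
    have hinj : Function.Injective
        (π.toLinearMap.comp (fderiv ℂ G q).range.subtype) := by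
      rw [LinearMap.injective_iff_surjective_of_finrank_eq_finrank]
      · exact hsurj
      · exact le_antisymm (hmax q (hΨO hq)) (LinearMap.finrank_le_finrank_of_surjective hsurj)
    exact congrArg Subtype.val (hinj (a₁ := ⟨fderiv ℂ G q w, w, rfl⟩) (a₂ := 0) (by simpa using hw))
  change Function.Injective L
  rw [injective_iff_map_eq_zero]
  intro w hw
  let k : L.ker := ⟨w, hw⟩
  let γ : ℂ → E := fun t => Ψ.symm (Ψ q₀ + t • (0, k))
  have hlin : ∀ t : ℂ, HasDerivAt (fun t : ℂ => Ψ q₀ + t • ((0 : L.range), k)) (0, k) t :=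
    fun t => by simpa using ((hasDerivAt_id t).smul_const ((0 : L.range), k)).const_add (Ψ q₀)
  have hlin0 : Tendsto (fun t : ℂ => Ψ q₀ + t • ((0 : L.range), k)) (𝓝 0) (𝓝 (Ψ q₀)) := by
    simpa using (hlin 0).continuousAt.tendsto
  have hT := hlin0.eventually (Ψ.open_target.mem_nhds (Ψ.map_source hqΨ))
  have hγ0 : γ 0 = q₀ := by
    change Ψ.symm (Ψ q₀ + (0 : ℂ) • (0, k)) = q₀
    rw [zero_smul, add_zero, Ψ.left_inv hqΨ]
  have hderiv : ∀ᶠ t in 𝓝 (0 : ℂ), HasDerivAt (G ∘ γ) 0 t := by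
    filter_upwards [hT.eventually_nhds] with t ht
    have htt := ht.self_of_nhds
    have h1 : HasDerivAt γ (fderiv ℂ Ψ.symm (Ψ q₀ + t • (0, k)) (0, k)) t :=
      (hb _ htt).differentiableAt.hasFDerivAt.comp_hasDerivAt t (hlin t)
    have hγt : γ t ∈ Ψ.source := Ψ.map_target htt
    have h2 := (hG _ (hΨO hγt)).differentiableAt.hasFDerivAt.comp_hasDerivAt t h1
    have h3 : HasDerivAt (π ∘ (G ∘ γ)) 0 t := by
      refine (hasDerivAt_const t (Ψ q₀).1).congr_of_eventuallyEq ?_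
      filter_upwards [ht] with t' ht'
      have h4 : (g (γ t')).1 = (Ψ q₀ + t' • ((0 : L.range), k)).1 := by
        rw [← hΨg]
        exact congrArg Prod.fst (Ψ.right_inv ht')
      simpa using h4
    have h5 := (π.hasFDerivAt.comp_hasDerivAt t h2).unique h3
    rw [hker _ hγt _ h5] at h2
    exact h2
  obtain ⟨ε, hε, hεs⟩ := Metric.eventually_nhds_iff_ball.1 hderiv
  have hconst : ∀ t ∈ Metric.ball (0 : ℂ) ε, G (γ t) = G q₀ := by
    intro t ht
    have := Metric.isOpen_ball.is_const_of_deriv_eq_zero (f := G ∘ γ)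
      (convex_ball (0 : ℂ) ε).isPreconnected
      (fun t ht => (hεs t ht).differentiableAt.differentiableWithinAt)
      (fun t ht => (hεs t ht).deriv) ht (Metric.mem_ball_self hε)
    simpa [hγ0] using this
  have hγc : Tendsto γ (𝓝 0) (𝓝 q₀) := by
    have := (Ψ.continuousAt_symm (Ψ.map_source hqΨ)).tendsto.comp hlin0
    rwa [Ψ.left_inv hqΨ] at this
  have hall : ∀ᶠ t in 𝓝 (0 : ℂ), t • k = 0 := by
    filter_upwards [hγc.eventually (hiso q₀ hq₀), hT, Metric.ball_mem_nhds _ hε] with t h1 h2 h3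
    have h4 := h1 (hconst t h3)
    have h5 : Ψ q₀ + t • ((0 : L.range), k) = Ψ q₀ := by
      rw [← Ψ.right_inv h2]
      exact congrArg Ψ h4
    simpa using congrArg Prod.snd (add_eq_left.1 h5)
  obtain ⟨t, ht, ht0⟩ := (hall.filter_mono nhdsWithin_le_nhds).and
    (self_mem_nhdsWithin (a := (0 : ℂ)) (s := {0}ᶜ)) |>.exists
  exact congrArg Subtype.val ((smul_eq_zero.1 ht).resolve_left ht0)

/-- A holomorphic function vanishing on a smooth hypersurface `h = 0` is divisible by `h`. -/
theorem AnalyticAt.exists_eq_mul_of_vanish [FiniteDimensional ℂ E] {m : ℕ}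
    (hE : Module.finrank ℂ E = m + 1) {h φ : E → ℂ} {p v : E} (hh : AnalyticAt ℂ h p)
    (hv : fderiv ℂ h p v ≠ 0) (hp : h p = 0) (hφ : AnalyticAt ℂ φ p)
    (h0 : ∀ᶠ q in 𝓝 p, h q = 0 → φ q = 0) :
    ∃ k : E → ℂ, AnalyticAt ℂ k p ∧ φ =ᶠ[𝓝 p] k * h := by
  obtain ⟨Φ, hpΦ, hΦO, hΦh, ha, hb⟩ :=
    hh.exists_straighten hE hv (h0.and hφ.eventually_analyticAt)
  let ψ : (Fin m → ℂ) × ℂ → ℂ := φ ∘ Φ.symm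
  have hψ : ∀ z ∈ Φ.target, AnalyticAt ℂ ψ z := fun z hz =>
    (hΦO (Φ.map_target hz)).2.comp (hb z hz)
  have hψ0 : ∀ z ∈ Φ.target, z.2 = 0 → ψ z = 0 := fun z hz hz0 =>
    (hΦO (Φ.map_target hz)).1 (by rw [← hΦh, Φ.right_inv hz, hz0])
  have hΦp : Φ p = ((Φ p).1, 0) := Prod.ext rfl ((hΦh p).trans hp)
  obtain ⟨ε, hε, hεs⟩ := Metric.mem_nhds_iff.1 (Φ.open_target.mem_nhds (Φ.map_source hpΦ))
  rw [hΦp, ← ball_prod_same] at hεs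
  set U := Metric.ball (Φ p).1 ε ×ˢ Metric.ball (0 : ℂ) ε with hU
  have hUo : IsOpen U := Metric.isOpen_ball.prod Metric.isOpen_ball
  have hsc : ∀ z ∈ U, ∀ s ∈ Icc (0 : ℝ) 1, (z.1, (s : ℂ) * z.2) ∈ U := by
    intro z hz s hs
    refine ⟨hz.1, ?_⟩
    have h2 := hz.2
    rw [mem_ball_zero_iff] at h2 ⊢
    rw [norm_mul, Complex.norm_real, Real.norm_of_nonneg hs.1]
    exact (mul_le_of_le_one_left (norm_nonneg _) hs.2).trans_lt h2
  -- the quotient of `ψ` by the last coordinate `ζ` is `∫₀¹ (∂ψ/∂ζ)(z, s ζ) ds`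
  let F : (Fin m → ℂ) × ℂ → ℝ → ℂ := fun z s => fderiv ℂ ψ (z.1, (s : ℂ) * z.2) (0, 1)
  have hk : AnalyticOnNhd ℂ (fun z => ∫ s in (0 : ℝ)..1, F z s) U := by
    refine AnalyticOnNhd.intervalIntegral_param hUo zero_le_one ?_ ?_
    · intro z hz
      have h1 : ContinuousAt (fderiv ℂ ψ) (z.1.1, (z.2 : ℂ) * z.1.2) :=
        (hψ _ (hεs (hsc _ hz.1 _ hz.2))).fderiv.continuousAt
      have h2 : ContinuousAt (fun z : ((Fin m → ℂ) × ℂ) × ℝ => (z.1.1, (z.2 : ℂ) * z.1.2)) z := by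
        fun_prop
      exact ((h1.comp_of_eq h2 rfl).clm_apply continuousAt_const).continuousWithinAt
    · intro s hs z hz
      have h1 : AnalyticAt ℂ (fderiv ℂ ψ) (z.1, (s : ℂ) * z.2) :=
        (hψ _ (hεs (hsc _ hz _ hs))).fderiv
      exact ((ContinuousLinearMap.apply ℂ ℂ ((0 : Fin m → ℂ), (1 : ℂ))).analyticAt _).comp
        (h1.comp_of_eq (f := fun z : (Fin m → ℂ) × ℂ => (z.1, (s : ℂ) * z.2))
          (analyticAt_fst.prod (analyticAt_const.mul analyticAt_snd)) rfl)
  have hpU : Φ p ∈ U := by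
    rw [hΦp]
    exact ⟨Metric.mem_ball_self hε, Metric.mem_ball_self hε⟩
  have hfac : ∀ z ∈ U, ψ z = (∫ s in (0 : ℝ)..1, F z s) * z.2 := by
    intro z hz
    have hder : ∀ s ∈ uIcc (0 : ℝ) 1,
        HasDerivAt (fun s : ℝ => ψ (z.1, (s : ℂ) * z.2)) (F z s * z.2) s := by
      intro s hs
      rw [uIcc_of_le zero_le_one] at hs
      have h1 := (hψ _ (hεs (hsc _ hz _ hs))).differentiableAt.hasFDerivAt
      have h2 : HasDerivAt (fun s : ℝ => (z.1, (s : ℂ) * z.2)) (0, z.2) s := by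
        have h4 := (Complex.ofRealCLM.hasDerivAt (x := s)).mul_const z.2
        simp only [Complex.ofRealCLM_apply, Complex.ofReal_one, one_mul] at h4
        exact (hasDerivAt_const s z.1).prodMk h4
      have h3 := (h1.restrictScalars ℝ).comp_hasDerivAt s h2
      refine h3.congr_deriv ?_
      have h5 : ((0 : Fin m → ℂ), z.2) = z.2 • ((0 : Fin m → ℂ), (1 : ℂ)) := by simp
      rw [ContinuousLinearMap.coe_restrictScalars', h5, map_smul, smul_eq_mul, mul_comm]
    have hcont : ContinuousOn (F z) (uIcc 0 1) := by
      rw [uIcc_of_le zero_le_one]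
      intro s hs
      have h1 : ContinuousAt (fderiv ℂ ψ) (z.1, (s : ℂ) * z.2) :=
        (hψ _ (hεs (hsc _ hz _ hs))).fderiv.continuousAt
      have h2 : ContinuousAt (fun s : ℝ => (z.1, (s : ℂ) * z.2)) s := by fun_prop
      exact ((h1.comp_of_eq h2 rfl).clm_apply continuousAt_const).continuousWithinAt
    have := intervalIntegral.integral_eq_sub_of_hasDerivAt hder
      (hcont.mul continuousOn_const).intervalIntegrable
    rw [intervalIntegral.integral_mul_const] at this
    rw [this]
    have h6 : ψ (z.1, ((0 : ℝ) : ℂ) * z.2) = 0 :=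
      hψ0 _ (hεs (hsc _ hz 0 (by simp))) (by simp)
    rw [h6]
    simp
  refine ⟨fun q => ∫ s in (0 : ℝ)..1, F (Φ q) s, (hk _ hpU).comp (ha p hpΦ), ?_⟩
  filter_upwards [Φ.open_source.mem_nhds hpΦ,
    (Φ.continuousAt hpΦ).preimage_mem_nhds (hUo.mem_nhds hpU)] with q hq hqU
  have := hfac _ hqU
  rw [hΦh] at this
  rw [Pi.mul_apply, ← this]
  simp [ψ, Φ.left_inv hq]

end Sard

/-! ### Differential forms in local parameters -/

section FormCoordinates

section

variable {m k : ℕ} {M : Type*} [TopologicalSpace M] [ChartedSpace (Cn m) M]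
  {F : Type*} [NormedAddCommGroup F] [NormedSpace ℂ F]

/-- The value of a form at a point, as a form on the model space. -/
def DForm.val (α : DForm m k M) (x : M) : Cn m [⋀^Fin k]→L[ℂ] ℂ := α x

/-- The differential of a map from a vector space to a manifold, as a map to the model space. -/
noncomputable def paramDeriv (m : ℕ) {M : Type*} [TopologicalSpace M] [ChartedSpace (Cn m) M]
    {F : Type*} [NormedAddCommGroup F] [NormedSpace ℂ F] (P : F → M) (p : F) : F →L[ℂ] Cn m :=
  mfderiv 𝓘(ℂ, F) 𝓘(ℂ, Cn m) P p

/-- The form `α`, expressed in the parameters given by a map `P` from a vector space to the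
manifold. -/
noncomputable def DForm.param (α : DForm m k M) (P : F → M) (p : F) : F [⋀^Fin k]→L[ℂ] ℂ :=
  (α.val (P p)).compContinuousLinearMap (paramDeriv m P p)

theorem DForm.param_apply (α : DForm m k M) (P : F → M) (p : F) (w : Fin k → F) :
    α.param P p w = α.val (P p) (fun i => paramDeriv m P p (w i)) := rfl

theorem DForm.param_congr (α : DForm m k M) {P Q : F → M} {p : F} (h : P =ᶠ[𝓝 p] Q) :
    α.param P p = α.param Q p := by
  have h1 : paramDeriv m P p = paramDeriv m Q p := h.mfderiv_eq
  rw [DForm.param, DForm.param, h1, h.self_of_nhds]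

theorem paramDeriv_comp {F' : Type*} [NormedAddCommGroup F'] [NormedSpace ℂ F'] {P : F → M}
    {h : F' → F} {q : F'} (hP : MDifferentiableAt 𝓘(ℂ, F) 𝓘(ℂ, Cn m) P (h q))
    (hh : DifferentiableAt ℂ h q) :
    paramDeriv m (P ∘ h) q = (paramDeriv m P (h q)).comp (fderiv ℂ h q) := by
  rw [paramDeriv, mfderiv_comp q hP hh.mdifferentiableAt, mfderiv_eq_fderiv]
  rfl

theorem DForm.param_comp (α : DForm m k M) {F' : Type*} [NormedAddCommGroup F'] [NormedSpace ℂ F']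
    {P : F → M} {h : F' → F} {q : F'} (hP : MDifferentiableAt 𝓘(ℂ, F) 𝓘(ℂ, Cn m) P (h q))
    (hh : DifferentiableAt ℂ h q) :
    α.param (P ∘ h) q = (α.param P (h q)).compContinuousLinearMap (fderiv ℂ h q) := by
  rw [DForm.param, paramDeriv_comp hP hh]
  rfl

end

variable {m k : ℕ} {M : Type*} [TopologicalSpace M] [ChartedSpace (Cn m) M]
  [IsManifold 𝓘(ℂ, Cn m) ω M] {F : Type*} [NormedAddCommGroup F] [NormedSpace ℂ F]

theorem ContMDiffAt.eventually_contMDiffAt {P : F → M} {p : F}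
    (hP : ContMDiffAt 𝓘(ℂ, F) 𝓘(ℂ, Cn m) ω P p) :
    ∀ᶠ q in 𝓝 p, ContMDiffAt 𝓘(ℂ, F) 𝓘(ℂ, Cn m) ω P q :=
  (contMDiffAt_iff_contMDiffAt_nhds (by simp)).1 hP

/-- Expansion of an alternating map on `ℂᵐ` in the standard basis. -/
theorem ContinuousAlternatingMap.apply_eq_sum_basis (τ : Cn m [⋀^Fin k]→L[ℂ] ℂ)
    (u : Fin k → Cn m) :
    τ u = ∑ r : Fin k → Fin m,
      (∏ i, u i (r i)) * τ (fun i => EuclideanSpace.single (r i) (1 : ℂ)) := by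
  classical
  have h1 : u = fun i => ∑ j, u i j • EuclideanSpace.single j (1 : ℂ) := by
    funext i
    ext j
    simp [Finset.sum_apply, Pi.single_apply]
  conv_lhs => rw [h1]
  have h2 := τ.toAlternatingMap.toMultilinearMap.map_sum
    (fun i j => u i j • EuclideanSpace.single j (1 : ℂ))
  refine h2.trans (Finset.sum_congr rfl fun r _ => ?_)
  exact τ.toAlternatingMap.toMultilinearMap.map_smul_univ (fun i => u i (r i))
    (fun i => EuclideanSpace.single (r i) (1 : ℂ))

/-- The coefficients of a holomorphic form are holomorphic in every holomorphic
parametrization. -/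
theorem DForm.IsHolomorphic.analyticAt_param {α : DForm m k M} (hα : α.IsHolomorphic)
    {P : F → M} {p : F} (hP : ContMDiffAt 𝓘(ℂ, F) 𝓘(ℂ, Cn m) ω P p) (w : Fin k → F) :
    AnalyticAt ℂ (fun q => α.param P q w) p := by
  set c := chartAt (Cn m) (P p) with hc
  have hcs : ContMDiffAt 𝓘(ℂ, Cn m) 𝓘(ℂ, Cn m) ω c (P p) :=
    contMDiffAt_of_mem_maximalAtlas (IsManifold.chart_mem_maximalAtlas _) (mem_chart_source _ _)
  have hcP : AnalyticAt ℂ (c ∘ P) p :=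
    (contMDiffAt_iff_contDiffAt.1 (hcs.comp p hP)).analyticAt
  have hexp : ∀ᶠ q in 𝓝 p, α.param P q w = ∑ r : Fin k → Fin m,
      (∏ i, (fderiv ℂ (c ∘ P) q (w i)) (r i)) *
        (fun z => α.param c.symm z (fun i => EuclideanSpace.single (r i) (1 : ℂ))) ((c ∘ P) q) := by
    filter_upwards [hP.eventually_contMDiffAt, hcP.eventually_analyticAt,
      hP.continuousAt.preimage_mem_nhds (c.open_source.mem_nhds (mem_chart_source _ _))]
      with q h1 h2 h3
    have h4 : MDifferentiableAt 𝓘(ℂ, Cn m) 𝓘(ℂ, Cn m) c.symm ((c ∘ P) q) :=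
      (contMDiffAt_symm_of_mem_maximalAtlas (n := ω)
        (IsManifold.chart_mem_maximalAtlas _) (c.map_source h3)).mdifferentiableAt (by simp)
    have h5 : P =ᶠ[𝓝 q] c.symm ∘ (c ∘ P) := by
      filter_upwards [h1.continuousAt.preimage_mem_nhds (c.open_source.mem_nhds h3)] with q' hq'
      exact (c.left_inv hq').symm
    rw [α.param_congr h5, α.param_comp h4 h2.differentiableAt]
    exact (α.param c.symm ((c ∘ P) q)).apply_eq_sum_basis (fun i => fderiv ℂ (c ∘ P) q (w i))
  refine AnalyticAt.congr ?_ (EventuallyEq.symm hexp)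
  refine Finset.analyticAt_fun_sum _ fun r _ => ?_
  refine AnalyticAt.fun_mul (Finset.analyticAt_fun_prod _ fun i _ => ?_) ?_
  · exact ((EuclideanSpace.proj (𝕜 := ℂ) (r i)).analyticAt _).comp
      (((ContinuousLinearMap.apply ℂ (Cn m) (w i)).analyticAt _).comp hcP.fderiv)
  · exact (hα (P p) fun i => EuclideanSpace.single (r i) (1 : ℂ)).comp_of_eq hcP rfl

end FormCoordinates

/-! ### The kernel of a form of codegree one -/

section FormKernel

variable {n : ℕ} {E : Type*} [NormedAddCommGroup E] [NormedSpace ℂ E]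

/-- The vector `v` lies in the kernel of the alternating form `τ`. -/
def InFormKernel (τ : E [⋀^Fin n]→L[ℂ] ℂ) (v : E) : Prop :=
  ∀ w : Fin n → E, (∃ i, w i = v) → τ w = 0

/-- The frame `∂/∂z₁, …, ∂/∂zₙ` of `ℂ × ℂⁿ`. -/
noncomputable def stdFrame (n : ℕ) (i : Fin n) : ℂ × Cn n := (0, EuclideanSpace.single i 1)

theorem update_frame_apply (τ : E [⋀^Fin n]→L[ℂ] ℂ) (w : Fin n → E) (i : Fin n) (t : ℂ)
    (z : Fin n → ℂ) (u : E) :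
    τ (Function.update w i (t • u + ∑ j, z j • w j)) =
      t * τ (Function.update w i u) + z i * τ w := by
  have h1 := τ.toAlternatingMap.toMultilinearMap.map_update_add w i (t • u) (∑ j, z j • w j)
  have h2 := τ.toAlternatingMap.toMultilinearMap.map_update_smul w i t u
  have h3 := τ.toAlternatingMap.toMultilinearMap.map_update_sum Finset.univ i
    (fun j => z j • w j) w
  have h4 : ∀ j, τ (Function.update w i (z j • w j)) = if j = i then z i * τ w else 0 := by
    intro j
    have h5 := τ.toAlternatingMap.toMultilinearMap.map_update_smul w i (z j) (w j)
    refine h5.trans ?_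
    split_ifs with h
    · subst h
      rw [Function.update_eq_self]
      rfl
    · have h6 := τ.toAlternatingMap.map_update_self w (Ne.symm h)
      exact (congrArg (z j • ·) h6).trans (smul_zero _)
  refine h1.trans (congrArg₂ (· + ·) h2 (h3.trans ?_))
  refine (Finset.sum_congr rfl fun j _ => h4 j).trans ?_
  simp

theorem update_stdFrame_apply (τ : (ℂ × Cn n) [⋀^Fin n]→L[ℂ] ℂ) (i : Fin n) (k : ℂ × Cn n) :
    τ (Function.update (stdFrame n) i k) =
      k.1 * τ (Function.update (stdFrame n) i (1, 0)) + k.2 i * τ (stdFrame n) := by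
  rw [← update_frame_apply]
  congr 2
  ext j
  · simp [stdFrame, Prod.fst_sum]
  · simp [stdFrame, Prod.snd_sum, Pi.single_apply]

theorem InFormKernel.snd_eq_zero {τ : (ℂ × Cn n) [⋀^Fin n]→L[ℂ] ℂ}
    (h : InFormKernel τ (1, 0)) (h0 : τ (stdFrame n) ≠ 0) {k : ℂ × Cn n}
    (hk : InFormKernel τ k) : k.2 = 0 := by
  ext i
  have h1 := update_stdFrame_apply τ i k
  rw [hk _ ⟨i, by simp⟩, h _ ⟨i, by simp⟩, mul_zero, zero_add] at h1
  exact (mul_eq_zero.1 h1.symm).resolve_right h0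

theorem InFormKernel.smul {τ : E [⋀^Fin n]→L[ℂ] ℂ} {v : E} (h : InFormKernel τ v) (a : ℂ) :
    InFormKernel τ (a • v) := by
  rintro w ⟨i, hi⟩
  have h1 := τ.toAlternatingMap.toMultilinearMap.map_update_smul w i a v
  rw [← hi, Function.update_eq_self] at h1
  refine h1.trans ?_
  exact (congrArg (a • ·) (h (Function.update w i v) ⟨i, by simp⟩)).trans (smul_zero _)

/-- The kernel of a form that does not vanish on the standard frame, if nonzero, is spanned by a
vector depending holomorphically on the form. -/
theorem InFormKernel.adapted {τ : (ℂ × Cn n) [⋀^Fin n]→L[ℂ] ℂ} (h0 : τ (stdFrame n) ≠ 0)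
    {k : ℂ × Cn n} (hk : InFormKernel τ k) (hk0 : k ≠ 0) :
    InFormKernel τ (1, WithLp.toLp 2 fun i =>
      -(τ (Function.update (stdFrame n) i (1, 0)) / τ (stdFrame n))) := by
  have h1 : ∀ i, k.2 i =
      k.1 * -(τ (Function.update (stdFrame n) i (1, 0)) / τ (stdFrame n)) := by
    intro i
    have h2 := update_stdFrame_apply τ i k
    rw [hk _ ⟨i, by simp⟩] at h2
    field_simp
    linear_combination -h2
  have h3 : k.1 ≠ 0 := by
    intro h
    refine hk0 (Prod.ext h ?_)
    ext i
    rw [h1, h, zero_mul]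
    rfl
  have h4 : ((1 : ℂ), (WithLp.toLp 2 fun i =>
      -(τ (Function.update (stdFrame n) i (1, 0)) / τ (stdFrame n)) : Cn n)) = k.1⁻¹ • k := by
    ext i
    · simp [h3]
    · have := h1 i
      simp only [Prod.smul_snd, PiLp.smul_apply, smul_eq_mul]
      rw [this]
      field_simp
  rw [h4]
  exact hk.smul _

/-- An `n`-form on `ℂ × ℂⁿ` killed by the first direction is a multiple of `dz₁ ∧ … ∧ dzₙ`. -/
theorem InFormKernel.eq_det {τ : (ℂ × Cn n) [⋀^Fin n]→L[ℂ] ℂ} (h : InFormKernel τ (1, 0))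
    (w : Fin n → ℂ × Cn n) :
    τ w = τ (stdFrame n) * Matrix.det (Matrix.of fun i j => (w i).2 j) := by
  classical
  have h1 : τ w = τ (fun i => (0, (w i).2)) := by
    have h2 : w = (fun i => (w i).1 • ((1 : ℂ), (0 : Cn n))) + fun i => (0, (w i).2) := by
      funext i
      simp
    have h3 := τ.toAlternatingMap.toMultilinearMap.map_add_univ
      (fun i => (w i).1 • ((1 : ℂ), (0 : Cn n))) (fun i => (0, (w i).2))
    rw [← h2] at h3
    refine h3.trans ((Finset.sum_eq_single ∅ (fun s _ hs => ?_) (by simp)).trans ?_)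
    · obtain ⟨i, hi⟩ := Finset.nonempty_iff_ne_empty.2 hs
      exact h.smul (w i).1 _ ⟨i, by simp [hi]⟩
    · simp
  let b := (EuclideanSpace.basisFun (Fin n) ℂ).toBasis
  let τ' : Cn n [⋀^Fin n]→ₗ[ℂ] ℂ := τ.toAlternatingMap.compLinearMap (LinearMap.inr ℂ ℂ (Cn n))
  have h4 := congrArg (fun T => T (fun i => (w i).2)) (τ'.eq_smul_basis_det b)
  rw [h1]
  refine h4.trans ?_
  have h5 : τ' b = τ (stdFrame n) := by
    change τ _ = τ _
    congr 1
    funext i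
    simp [b, stdFrame]
  rw [AlternatingMap.smul_apply, smul_eq_mul, h5, Module.Basis.det_apply, ← Matrix.det_transpose]
  congr 2

/-- A frame on which a form does not vanish, completed by a kernel vector, is a basis. -/
theorem InFormKernel.exists_equiv [FiniteDimensional ℂ E] (hE : Module.finrank ℂ E = n + 1)
    {τ : E [⋀^Fin n]→L[ℂ] ℂ} (hτ : τ ≠ 0) {u : E} (hu : InFormKernel τ u) (hu0 : u ≠ 0) :
    ∃ L : (ℂ × Cn n) ≃L[ℂ] E, τ (fun i => L (stdFrame n i)) ≠ 0 := by
  obtain ⟨w, hw⟩ : ∃ w, τ w ≠ 0 := by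
    by_contra! h
    exact hτ (ContinuousAlternatingMap.ext h)
  let L₀ : (ℂ × Cn n) →ₗ[ℂ] E :=
    { toFun := fun k => k.1 • u + ∑ j, k.2 j • w j
      map_add' := fun a b => by
        simp only [Prod.fst_add, Prod.snd_add, PiLp.add_apply, add_smul, Finset.sum_add_distrib]
        abel
      map_smul' := fun a b => by
        simp [smul_smul, Finset.smul_sum] }
  have hinj : Function.Injective L₀ := by
    rw [injective_iff_map_eq_zero]
    intro k hk
    have hk' : k.1 • u + ∑ j, k.2 j • w j = 0 := hk
    have h2 : k.2 = 0 := by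
      ext i
      have h1 := update_frame_apply τ w i k.1 k.2 u
      rw [hk', hu (Function.update w i u) ⟨i, by simp⟩, mul_zero, zero_add] at h1
      have h3 : τ (Function.update w i 0) = 0 := τ.map_coord_zero i (by simp)
      rw [h3] at h1
      exact (mul_eq_zero.1 h1.symm).resolve_right hw
    refine Prod.ext ?_ h2
    rw [h2] at hk'
    simpa [hu0] using hk'
  refine ⟨(LinearEquiv.ofInjectiveOfFinrankEq L₀ hinj
    (by simp [hE, add_comm])).toContinuousLinearEquiv, ?_⟩
  convert hw using 2
  funext i
  change (stdFrame n i).1 • u + ∑ j, (stdFrame n i).2 j • w j = w i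
  simp [stdFrame]

end FormKernel

/-! ### Flow boxes -/

section ParamCharts

variable {m : ℕ} {D : Type*} [TopologicalSpace D] [ChartedSpace (Cn m) D]
  {F : Type*} [NormedAddCommGroup F] [NormedSpace ℂ F]

/-- A holomorphic parametrization has an injective differential. -/
theorem mfderiv_paramDeriv {e : OpenPartialHomeomorph D F}
    (h1 : ContMDiffOn 𝓘(ℂ, Cn m) 𝓘(ℂ, F) ω e e.source)
    (h2 : ContMDiffOn 𝓘(ℂ, F) 𝓘(ℂ, Cn m) ω e.symm e.target) {p : F} (hp : p ∈ e.target) (w : F) :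
    mfderiv 𝓘(ℂ, Cn m) 𝓘(ℂ, F) e (e.symm p) (paramDeriv m e.symm p w) = w := by
  have ha : MDifferentiableAt 𝓘(ℂ, Cn m) 𝓘(ℂ, F) e (e.symm p) :=
    (h1.contMDiffAt (e.open_source.mem_nhds (e.map_target hp))).mdifferentiableAt (by simp)
  have hb : MDifferentiableAt 𝓘(ℂ, F) 𝓘(ℂ, Cn m) e.symm p :=
    (h2.contMDiffAt (e.open_target.mem_nhds hp)).mdifferentiableAt (by simp)
  have hc := mfderiv_comp p ha hb
  have hd : e ∘ e.symm =ᶠ[𝓝 p] id := by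
    filter_upwards [e.open_target.mem_nhds hp] with q hq using e.right_inv hq
  rw [hd.mfderiv_eq, mfderiv_id] at hc
  exact (DFunLike.congr_fun hc w).symm

theorem paramDeriv_mfderiv {e : OpenPartialHomeomorph D F}
    (h1 : ContMDiffOn 𝓘(ℂ, Cn m) 𝓘(ℂ, F) ω e e.source)
    (h2 : ContMDiffOn 𝓘(ℂ, F) 𝓘(ℂ, Cn m) ω e.symm e.target) {p : F} (hp : p ∈ e.target)
    (v : Cn m) :
    paramDeriv m e.symm p (mfderiv 𝓘(ℂ, Cn m) 𝓘(ℂ, F) e (e.symm p) v) = v := by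
  have ha : MDifferentiableAt 𝓘(ℂ, Cn m) 𝓘(ℂ, F) e (e.symm p) :=
    (h1.contMDiffAt (e.open_source.mem_nhds (e.map_target hp))).mdifferentiableAt (by simp)
  have hb : MDifferentiableAt 𝓘(ℂ, F) 𝓘(ℂ, Cn m) e.symm (e (e.symm p)) := by
    rw [e.right_inv hp]
    exact (h2.contMDiffAt (e.open_target.mem_nhds hp)).mdifferentiableAt (by simp)
  have hc := mfderiv_comp (e.symm p) hb ha
  have hd : e.symm ∘ e =ᶠ[𝓝 (e.symm p)] id := by
    filter_upwards [e.open_source.mem_nhds (e.map_target hp)] with q hq using e.left_inv hq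
  rw [hd.mfderiv_eq, mfderiv_id] at hc
  have hd := (DFunLike.congr_fun hc v).symm
  have he : paramDeriv m e.symm (e (e.symm p)) = paramDeriv m e.symm p := by
    rw [e.right_inv hp]
  rw [← he]
  exact hd

end ParamCharts

section FlowBox

variable {n : ℕ} {D B : Type*} [TopologicalSpace D] [ChartedSpace (Cn (n + 1)) D]
  [TopologicalSpace B]

/-- Coordinates `(t, z)` on a product of balls in which the kernel of the form `σ` is spanned by
`∂/∂t`. -/
structure IsFlowBox (σ : DForm (n + 1) n D) (e : OpenPartialHomeomorph D (ℂ × Cn n)) : Prop where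
  contMDiffOn : ContMDiffOn 𝓘(ℂ, Cn (n + 1)) 𝓘(ℂ, ℂ × Cn n) ω e e.source
  contMDiffOn_symm : ContMDiffOn 𝓘(ℂ, ℂ × Cn n) 𝓘(ℂ, Cn (n + 1)) ω e.symm e.target
  target_eq : ∃ ε > 0, e.target = Metric.ball 0 ε ×ˢ Metric.ball 0 ε
  inFormKernel : ∀ p ∈ e.target, InFormKernel (σ.param e.symm p) (1, 0)

/-- A holomorphic parametrization of the fibre through a point. Its velocity lies in the kernel of `σ`,
because it is annihilated by the differentials of all functions vanishing on the fibre. -/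
theorem exists_fibre_curve [ReducedComplexSpace B] {f : C(D, B)} (hf : IsUniSmoothFibration n f)
    {σ : DForm (n + 1) n D}
    (hker : IsGivenByKernel n f σ) (x : D) : ∃ γ : ℂ → D, γ 0 = x ∧
      (∀ᶠ ζ in 𝓝 (0 : ℂ), ContMDiffAt 𝓘(ℂ, ℂ) 𝓘(ℂ, Cn (n + 1)) ω γ ζ ∧ f (γ ζ) = f x ∧
        InFormKernel (σ.val (γ ζ)) (paramDeriv (n + 1) γ ζ 1) ∧ paramDeriv (n + 1) γ ζ 1 ≠ 0) ∧
      ∀ O ∈ 𝓝 (0 : ℂ), ∀ᶠ y in 𝓝 x, f y = f x → ∃ ζ ∈ O, γ ζ = y := by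
  obtain ⟨c, hc, hx, hfib⟩ := hf.smooth x
  have hc1 := contMDiffOn_of_mem_maximalAtlas hc
  have hc2 := contMDiffOn_symm_of_mem_maximalAtlas hc
  let ℓ : ℂ → Cn (n + 1) := fun ζ => c x + ζ • EuclideanSpace.single 0 1
  have hℓ : ∀ ζ, HasFDerivAt ℓ
      ((ContinuousLinearMap.id ℂ ℂ).smulRight (EuclideanSpace.single (0 : Fin (n + 1)) (1 : ℂ))) ζ :=
    fun ζ => ((hasFDerivAt_id ζ).smul_const _).const_add _
  have hℓ0 : ℓ 0 = c x := by simp [ℓ]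
  have hℓa : ∀ ζ, AnalyticAt ℂ ℓ ζ := fun ζ =>
    analyticAt_const.add (analyticAt_id.smul analyticAt_const)
  have hT : ∀ᶠ ζ in 𝓝 (0 : ℂ), ℓ ζ ∈ c.target := by
    refine (hℓ 0).continuousAt.preimage_mem_nhds (c.open_target.mem_nhds ?_)
    rw [hℓ0]
    exact c.map_source hx
  have hγs : ∀ ζ, ℓ ζ ∈ c.target → ContMDiffAt 𝓘(ℂ, ℂ) 𝓘(ℂ, Cn (n + 1)) ω (c.symm ∘ ℓ) ζ :=
    fun ζ hζ => (hc2.contMDiffAt (c.open_target.mem_nhds hζ)).comp ζ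
      (contMDiffAt_iff_contDiffAt.2 (hℓa ζ).contDiffAt)
  have hγf : ∀ ζ, ℓ ζ ∈ c.target → f (c.symm (ℓ ζ)) = f x := by
    intro ζ hζ
    refine (hfib _ (c.map_target hζ)).2 fun i => ?_
    rw [c.right_inv hζ]
    simp [ℓ]
  refine ⟨c.symm ∘ ℓ, by simp [hℓ0, c.left_inv hx], ?_, ?_⟩
  · filter_upwards [hT.eventually_nhds] with ζ hζ
    have hζ0 := hζ.self_of_nhds
    have hder : paramDeriv (n + 1) (c.symm ∘ ℓ) ζ 1 =
        paramDeriv (n + 1) c.symm (ℓ ζ) (EuclideanSpace.single 0 1) := by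
      rw [paramDeriv_comp ((hc2.contMDiffAt (c.open_target.mem_nhds hζ0)).mdifferentiableAt
        (by simp)) (hℓ ζ).differentiableAt, (hℓ ζ).fderiv]
      simp
    refine ⟨hγs ζ hζ0, hγf ζ hζ0, ?_, ?_⟩
    · refine (hker _ _).2 fun φ hφ hφ0 => ?_
      have h1 : (φ ∘ (c.symm ∘ ℓ)) =ᶠ[𝓝 ζ] fun _ => 0 := by
        filter_upwards [(hγs ζ hζ0).continuousAt.eventually hφ0, hζ] with ζ' h2 h3
        exact h2 (by
          change f (c.symm (ℓ ζ')) = f (c.symm (ℓ ζ))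
          rw [hγf ζ' h3, hγf ζ hζ0])
      have h2 := mfderiv_comp ζ (hφ.mdifferentiableAt (by simp))
        ((hγs ζ hζ0).mdifferentiableAt (by simp))
      rw [h1.mfderiv_eq, mfderiv_const] at h2
      exact (DFunLike.congr_fun h2 (1 : ℂ)).symm
    · rw [hder]
      intro h0
      have h1 := mfderiv_paramDeriv hc1 hc2 hζ0 (EuclideanSpace.single 0 1)
      rw [h0] at h1
      have h2 : (0 : Cn (n + 1)) = EuclideanSpace.single 0 1 := by
        refine Eq.trans ?_ h1
        exact (map_zero (mfderiv 𝓘(ℂ, Cn (n + 1)) 𝓘(ℂ, Cn (n + 1)) c (c.symm (ℓ ζ)))).symm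
      have h3 := congrArg (fun v : Cn (n + 1) => v 0) h2
      simp at h3
  · intro O hO
    have h1 : ContinuousAt (fun y => (c y - c x) 0) x := by
      have := c.continuousAt hx
      have h2 : Continuous fun v : Cn (n + 1) => (v - c x) 0 := by fun_prop
      exact h2.continuousAt.comp this
    have h2 : ∀ᶠ y in 𝓝 x, (c y - c x) 0 ∈ O := h1.preimage_mem_nhds (by simpa using hO)
    filter_upwards [h2, c.open_source.mem_nhds hx] with y hy1 hy2 hy3
    refine ⟨_, hy1, ?_⟩
    have h3 : ℓ ((c y - c x) 0) = c y := by
      ext i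
      refine Fin.cases ?_ (fun i => ?_) i
      · simp [ℓ]
      · simp [ℓ, (hfib y hy2).1 hy3 i]
    simp only [Function.comp_apply, h3, c.left_inv hy2]

end FlowBox

section FlowBoxExistence

variable {n : ℕ} {D B : Type*} [TopologicalSpace D] [ChartedSpace (Cn (n + 1)) D]
  [TopologicalSpace B] [IsManifold 𝓘(ℂ, Cn (n + 1)) ω D]

theorem InFormKernel.comp {E E' : Type*} [NormedAddCommGroup E] [NormedSpace ℂ E]
    [NormedAddCommGroup E'] [NormedSpace ℂ E'] {τ : E [⋀^Fin n]→L[ℂ] ℂ} {L : E' →L[ℂ] E} {v : E'}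
    (h : InFormKernel τ (L v)) : InFormKernel (τ.compContinuousLinearMap L) v := by
  rintro w ⟨i, hi⟩
  exact h _ ⟨i, by simp [hi]⟩

/-- Around every point there are coordinates in which the kernel of `σ` is a coordinate direction:
the kernel is spanned by a holomorphic vector field, which is rectified by its flow. -/
theorem exists_isFlowBox {σ : DForm (n + 1) n D} (hσ : σ.IsHolomorphic) (hσ0 : σ.NowhereVanishing)
    (hv : ∀ y : D, ∃ v : Cn (n + 1), v ≠ 0 ∧ InFormKernel (σ.val y) v) (x : D) :
    ∃ e : OpenPartialHomeomorph D (ℂ × Cn n), IsFlowBox σ e ∧ x ∈ e.source ∧ e x = 0 := by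
  set c := chartAt (Cn (n + 1)) x with hc
  have hcx : x ∈ c.source := mem_chart_source _ _
  have hcm := IsManifold.chart_mem_maximalAtlas (I := 𝓘(ℂ, Cn (n + 1))) (n := ω) x
  have hc1 : ContMDiffOn 𝓘(ℂ, Cn (n + 1)) 𝓘(ℂ, Cn (n + 1)) ω c c.source :=
    contMDiffOn_of_mem_maximalAtlas hcm
  have hc2 : ContMDiffOn 𝓘(ℂ, Cn (n + 1)) 𝓘(ℂ, Cn (n + 1)) ω c.symm c.target :=
    contMDiffOn_symm_of_mem_maximalAtlas hcm
  have hsurj : ∀ q ∈ c.target, Function.Surjective (paramDeriv (n + 1) c.symm q) := fun q hq v =>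
    ⟨_, paramDeriv_mfderiv hc1 hc2 hq v⟩
  -- the kernel vectors in the chart
  have hk : ∀ q ∈ c.target, ∃ u : Cn (n + 1), u ≠ 0 ∧ InFormKernel (σ.param c.symm q) u := by
    intro q hq
    obtain ⟨v, hv0, hv1⟩ := hv (c.symm q)
    obtain ⟨u, rfl⟩ := hsurj q hq v
    refine ⟨u, ?_, hv1.comp⟩
    rintro rfl
    exact hv0 (map_zero _)
  obtain ⟨u, hu0, hu⟩ := hk (c x) (c.map_source hcx)
  have hτ0 : σ.param c.symm (c x) ≠ 0 := by
    intro h0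
    refine hσ0 (c.symm (c x)) ?_
    refine ContinuousAlternatingMap.ext fun w => ?_
    choose R hR using hsurj (c x) (c.map_source hcx)
    have h1 := DFunLike.congr_fun h0 (fun i => R (w i))
    have h2 : (fun i => paramDeriv (n + 1) c.symm (c x) (R (w i))) = w := funext fun i => hR _
    exact (congrArg (σ.val (c.symm (c x))) h2).symm.trans h1
  obtain ⟨L, hL⟩ := hu.exists_equiv (by simp) hτ0 hu0
  -- affine coordinates in which the standard frame is transversal to the kernel at the origin
  let A : (ℂ × Cn n) ≃ₜ Cn (n + 1) := L.toHomeomorph.trans (Homeomorph.addLeft (c x))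
  have hA : ∀ p, A p = c x + L p := fun p => rfl
  have hA0 : A 0 = c x := by simp [hA]
  have hAa : ∀ p, AnalyticAt ℂ A p := fun p => analyticAt_const.add (L.analyticAt p)
  have hAd : ∀ p, HasFDerivAt A (L : (ℂ × Cn n) →L[ℂ] Cn (n + 1)) p := fun p =>
    L.hasFDerivAt.const_add _
  have hAs : ∀ q, AnalyticAt ℂ A.symm q := fun q => by
    have : (A.symm : Cn (n + 1) → ℂ × Cn n) = fun q => L.symm (-(c x) + q) := rfl
    rw [this]
    exact (L.symm.analyticAt _).comp (analyticAt_const.add analyticAt_id)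
  let P : ℂ × Cn n → D := c.symm ∘ A
  have hP : ∀ p, A p ∈ c.target → ContMDiffAt 𝓘(ℂ, ℂ × Cn n) 𝓘(ℂ, Cn (n + 1)) ω P p := fun p hp =>
    (hc2.contMDiffAt (c.open_target.mem_nhds hp)).comp p
      (contMDiffAt_iff_contDiffAt.2 (hAa p).contDiffAt)
  have hPτ : ∀ p, A p ∈ c.target → σ.param P p = (σ.param c.symm (A p)).compContinuousLinearMap
      (L : (ℂ × Cn n) →L[ℂ] Cn (n + 1)) := fun p hp => by
    rw [σ.param_comp ((hc2.contMDiffAt (c.open_target.mem_nhds hp)).mdifferentiableAt (by simp))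
      (hAa p).differentiableAt, (hAd p).fderiv]
  have hT : ∀ᶠ p in 𝓝 (0 : ℂ × Cn n), A p ∈ c.target := by
    refine A.continuous.continuousAt.preimage_mem_nhds (c.open_target.mem_nhds ?_)
    rw [hA0]
    exact c.map_source hcx
  have hτa : ∀ w, AnalyticAt ℂ (fun p => σ.param P p w) 0 := fun w =>
    hσ.analyticAt_param (hP 0 hT.self_of_nhds) w
  have hs0 : σ.param P 0 (stdFrame n) ≠ 0 := by
    rw [hPτ 0 hT.self_of_nhds, hA0]
    exact hL
  -- the kernel vector of `σ` with first component `1` has the second component `F`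
  let F : ℂ × Cn n → Cn n := fun p => WithLp.toLp 2 fun i =>
    -(σ.param P p (Function.update (stdFrame n) i (1, 0)) / σ.param P p (stdFrame n))
  have hF : AnalyticAt ℂ F 0 := by
    have h1 : AnalyticAt ℂ (fun p => fun i : Fin n =>
      -(σ.param P p (Function.update (stdFrame n) i (1, 0)) / σ.param P p (stdFrame n))) 0 :=
      AnalyticAt.pi fun i => ((hτa _).div (hτa _) hs0).neg
    exact ((PiLp.continuousLinearEquiv 2 ℂ (fun _ : Fin n => ℂ)).symm.analyticAt _).comp h1
  obtain ⟨Ψ, h0Ψ, hΨ0, hΨT, hΨa, hΨb, hΨd⟩ :=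
    exists_rectification hF (hT.and ((hτa (stdFrame n)).continuousAt.eventually_ne hs0))
  obtain ⟨ε, hε, hεs⟩ := Metric.mem_nhds_iff.1 (Ψ.open_source.mem_nhds h0Ψ)
  rw [← Prod.mk_zero_zero, ← ball_prod_same] at hεs
  set V : Set (ℂ × Cn n) := Metric.ball 0 ε ×ˢ Metric.ball 0 ε with hVdef
  have hV : IsOpen V := Metric.isOpen_ball.prod Metric.isOpen_ball
  have h0V : (0 : ℂ × Cn n) ∈ V := ⟨Metric.mem_ball_self hε, Metric.mem_ball_self hε⟩
  let e : OpenPartialHomeomorph D (ℂ × Cn n) :=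
    (((Ψ.restrOpen V hV).trans A.toOpenPartialHomeomorph).trans c.symm).symm
  have het : e.target = V := by
    ext p
    constructor
    · intro hp
      exact hp.1.1.2
    · intro hp
      have h1 : p ∈ Ψ.source := hεs hp
      exact ⟨⟨⟨h1, hp⟩, mem_univ _⟩, (hΨT (Ψ.map_source h1)).1⟩
  have hes : ∀ p, e.symm p = P (Ψ p) := fun p => rfl
  have hes' : (e.symm : ℂ × Cn n → D) = P ∘ Ψ := rfl
  have he : ∀ y, e y = Ψ.symm (A.symm (c y)) := fun y => rfl
  refine ⟨e, ⟨?_, ?_, ⟨ε, hε, het⟩, ?_⟩, ?_, ?_⟩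
  · intro y hy
    have hp : e y ∈ V := het ▸ e.map_source hy
    have h1 := hΨT (Ψ.map_source (hεs hp))
    have h2 : c.symm (A (Ψ (e y))) = y := e.left_inv hy
    have h3 : c y = A (Ψ (e y)) := by rw [← c.right_inv h1.1, h2]
    have h4 : y ∈ c.source := h2 ▸ c.map_target h1.1
    have h5 : A.symm (c y) ∈ Ψ.target := by
      rw [h3, A.symm_apply_apply]
      exact Ψ.map_source (hεs hp)
    exact ((contMDiffAt_iff_contDiffAt.2 ((hΨb _ h5).comp (hAs _)).contDiffAt).comp y
      (hc1.contMDiffAt (c.open_source.mem_nhds h4))).contMDiffWithinAt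
  · intro p hp
    rw [het] at hp
    refine ContMDiffAt.contMDiffWithinAt ?_
    rw [hes']
    exact (hP _ (hΨT (Ψ.map_source (hεs hp))).1).comp p
      (contMDiffAt_iff_contDiffAt.2 (hΨa p (hεs hp)).contDiffAt)
  · intro p hp
    rw [het] at hp
    have h1 := hΨT (Ψ.map_source (hεs hp))
    rw [hes', σ.param_comp ((hP _ h1.1).mdifferentiableAt (by simp))
      (hΨa p (hεs hp)).differentiableAt]
    refine InFormKernel.comp ?_
    rw [hΨd p (hεs hp)]
    obtain ⟨u, hu0, hu⟩ := hk _ h1.1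
    have h2 : InFormKernel (σ.param P (Ψ p)) (L.symm u) := by
      rw [hPτ _ h1.1]
      refine InFormKernel.comp ?_
      simpa using hu
    exact h2.adapted h1.2 (by simpa using hu0)
  · have h1 : e.symm 0 = x := by
      rw [hes, hΨ0]
      change c.symm (A 0) = x
      rw [hA0, c.left_inv hcx]
    rw [← h1]
    exact e.map_target (het ▸ h0V)
  · have h1 : e.symm 0 = x := by
      rw [hes, hΨ0]
      change c.symm (A 0) = x
      rw [hA0, c.left_inv hcx]
    rw [← h1]
    exact e.right_inv (het ▸ h0V)

end FlowBoxExistence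

/-! ### Fibres in flow boxes -/

section FlowBoxFibres

variable {n : ℕ} {D B : Type*} [TopologicalSpace D] [ChartedSpace (Cn (n + 1)) D]
  {σ : DForm (n + 1) n D} {e : OpenPartialHomeomorph D (ℂ × Cn n)}

namespace IsFlowBox

theorem surjective_paramDeriv (h : IsFlowBox σ e) {p : ℂ × Cn n} (hp : p ∈ e.target) :
    Function.Surjective (paramDeriv (n + 1) e.symm p) := fun v =>
  ⟨_, paramDeriv_mfderiv h.contMDiffOn h.contMDiffOn_symm hp v⟩

/-- In a flow box, `σ` is its density, the value on the frame `∂/∂z₁, …, ∂/∂zₙ`, times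
`dz₁ ∧ … ∧ dzₙ`. -/
theorem param_apply (h : IsFlowBox σ e) {p : ℂ × Cn n} (hp : p ∈ e.target)
    (w : Fin n → ℂ × Cn n) : σ.param e.symm p w =
      σ.param e.symm p (stdFrame n) * Matrix.det (Matrix.of fun i j => (w i).2 j) :=
  (h.inFormKernel p hp).eq_det w

theorem density_ne_zero (h : IsFlowBox σ e) (hσ0 : σ.NowhereVanishing) {p : ℂ × Cn n}
    (hp : p ∈ e.target) : σ.param e.symm p (stdFrame n) ≠ 0 := by
  intro h0
  refine hσ0 (e.symm p) (ContinuousAlternatingMap.ext fun w => ?_)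
  choose R hR using h.surjective_paramDeriv hp
  have h2 : (fun i => paramDeriv (n + 1) e.symm p (R (w i))) = w := funext fun i => hR _
  have h3 := h.param_apply hp fun i => R (w i)
  rw [h0, zero_mul] at h3
  exact (congrArg (σ.val (e.symm p)) h2).symm.trans h3

theorem contMDiffAt (h : IsFlowBox σ e) {y : D} (hy : y ∈ e.source) :
    ContMDiffAt 𝓘(ℂ, Cn (n + 1)) 𝓘(ℂ, ℂ × Cn n) ω e y :=
  h.contMDiffOn.contMDiffAt (e.open_source.mem_nhds hy)

theorem contMDiffAt_symm (h : IsFlowBox σ e) {p : ℂ × Cn n} (hp : p ∈ e.target) :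
    ContMDiffAt 𝓘(ℂ, ℂ × Cn n) 𝓘(ℂ, Cn (n + 1)) ω e.symm p :=
  h.contMDiffOn_symm.contMDiffAt (e.open_target.mem_nhds hp)

theorem manifoldHolAt_iff (h : IsFlowBox σ e) {y : D} (hy : y ∈ e.source) {φ : D → ℂ} :
    ManifoldHolAt (n + 1) φ y ↔ AnalyticAt ℂ (φ ∘ e.symm) (e y) := by
  constructor
  · intro hφ
    refine (contMDiffAt_iff_contDiffAt.1 (ContMDiffAt.comp (I' := 𝓘(ℂ, Cn (n + 1))) (e y) ?_
      (h.contMDiffAt_symm (e.map_source hy)))).analyticAt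
    rw [e.left_inv hy]
    exact hφ
  · intro hφ
    have h1 := (contMDiffAt_iff_contDiffAt.2 hφ.contDiffAt).comp y (h.contMDiffAt hy)
    refine h1.congr_of_eventuallyEq ?_
    filter_upwards [e.open_source.mem_nhds hy] with y' hy'
    simp [e.left_inv hy']

theorem analyticAt_density [IsManifold 𝓘(ℂ, Cn (n + 1)) ω D] (h : IsFlowBox σ e) (hσ : σ.IsHolomorphic) {p : ℂ × Cn n}
    (hp : p ∈ e.target) : AnalyticAt ℂ (fun q => σ.param e.symm q (stdFrame n)) p :=
  hσ.analyticAt_param (h.contMDiffAt_symm hp) _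

variable [TopologicalSpace B] [ReducedComplexSpace B] {f : C(D, B)}

/-- Near a point of a flow box, the fibre of `f` is exactly the leaf `z = const`. -/
theorem eventually_fibre (h : IsFlowBox σ e) (hσ0 : σ.NowhereVanishing)
    (hf : IsUniSmoothFibration n f) (hker : IsGivenByKernel n f σ) {y : D} (hy : y ∈ e.source) :
    (∀ᶠ y' in 𝓝 y, f y' = f y → (e y').2 = (e y).2) ∧
      ∀ᶠ t in 𝓝 (e y).1, f (e.symm (t, (e y).2)) = f y := by
  obtain ⟨γ, hγ0, hγ, hγs⟩ := exists_fibre_curve hf hker y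
  have hγc : ContinuousAt γ 0 := hγ.self_of_nhds.1.continuousAt
  have hsrc : ∀ᶠ ζ in 𝓝 (0 : ℂ), γ ζ ∈ e.source :=
    hγc.preimage_mem_nhds (e.open_source.mem_nhds (hγ0 ▸ hy))
  let δ : ℂ → ℂ × Cn n := e ∘ γ
  have hδ0 : δ 0 = e y := congrArg e hγ0
  have hδa : ∀ᶠ ζ in 𝓝 (0 : ℂ), AnalyticAt ℂ δ ζ := by
    filter_upwards [hγ, hsrc] with ζ h1 h2
    exact (contMDiffAt_iff_contDiffAt.1 ((h.contMDiffAt h2).comp ζ h1.1)).analyticAt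
  have hδd : ∀ᶠ ζ in 𝓝 (0 : ℂ), (deriv δ ζ).2 = 0 ∧ deriv δ ζ ≠ 0 := by
    filter_upwards [hγ, hsrc.eventually_nhds, hδa] with ζ h1 h2 h3
    have hp : δ ζ ∈ e.target := e.map_source h2.self_of_nhds
    have h4 : γ =ᶠ[𝓝 ζ] e.symm ∘ δ := by
      filter_upwards [h2] with ζ' h5 using (e.left_inv h5).symm
    have h5 : paramDeriv (n + 1) γ ζ 1 = paramDeriv (n + 1) e.symm (δ ζ) (deriv δ ζ) := by
      have h6 : paramDeriv (n + 1) γ ζ = paramDeriv (n + 1) (e.symm ∘ δ) ζ := h4.mfderiv_eq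
      rw [h6, paramDeriv_comp ((h.contMDiffAt_symm hp).mdifferentiableAt (by simp))
        h3.differentiableAt]
      rfl
    have h6 := h1.2.2.1
    rw [h5, show γ ζ = e.symm (δ ζ) from h4.self_of_nhds] at h6
    refine ⟨(h.inFormKernel _ hp).snd_eq_zero (h.density_ne_zero hσ0 hp) h6.comp, ?_⟩
    intro h7
    refine h1.2.2.2 ?_
    rw [h5, h7, map_zero]
  obtain ⟨ε, hε, hεs⟩ := Metric.eventually_nhds_iff_ball.1 (hδa.and hδd)
  have hconst : ∀ᶠ ζ in 𝓝 (0 : ℂ), (δ ζ).2 = (e y).2 := by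
    filter_upwards [Metric.ball_mem_nhds _ hε] with ζ hζ
    have hd : ∀ ζ ∈ Metric.ball (0 : ℂ) ε, HasDerivAt (fun ζ => (δ ζ).2) 0 ζ := by
      intro ζ hζ
      have h1 := (hεs ζ hζ).1.differentiableAt.hasDerivAt
      have h2 := (ContinuousLinearMap.snd ℂ ℂ (Cn n)).hasFDerivAt.comp_hasDerivAt ζ h1
      exact h2.congr_deriv (hεs ζ hζ).2.1
    have := Metric.isOpen_ball.is_const_of_deriv_eq_zero (f := fun ζ => (δ ζ).2)
      (convex_ball (0 : ℂ) ε).isPreconnected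
      (fun t ht => (hd t ht).differentiableAt.differentiableWithinAt)
      (fun t ht => (hd t ht).deriv) hζ (Metric.mem_ball_self hε)
    rw [this, hδ0]
  have hopen : map (fun ζ => (δ ζ).1) (𝓝 0) = 𝓝 (e y).1 := by
    have h1 := hεs 0 (Metric.mem_ball_self hε)
    have h2 : HasStrictDerivAt (fun ζ => (δ ζ).1) (deriv δ 0).1 0 := by
      have h3 : AnalyticAt ℂ (fun ζ => (δ ζ).1) 0 := analyticAt_fst.comp_of_eq h1.1 rfl
      have h4 := (ContinuousLinearMap.fst ℂ ℂ (Cn n)).hasFDerivAt.comp_hasDerivAt 0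
        h1.1.differentiableAt.hasDerivAt
      have h5 := h3.hasStrictDerivAt
      rwa [show deriv (fun ζ => (δ ζ).1) 0 = (deriv δ 0).1 from h4.deriv] at h5
    have h3 := h2.map_nhds_eq fun h4 => h1.2.2 (Prod.ext h4 h1.2.1)
    rw [h3, hδ0]
  constructor
  · filter_upwards [hγs _ (hconst)] with y' h1 h2
    obtain ⟨ζ, h3, rfl⟩ := h1 h2
    exact h3
  · rw [← hopen, eventually_map]
    filter_upwards [hconst, hγ, hsrc] with ζ h1 h2 h3
    have h4 : ((δ ζ).1, (e y).2) = e (γ ζ) := Prod.ext rfl h1.symm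
    rw [h4, e.left_inv h3, h2.2.1]

/-- In a flow box, `f` does not depend on the first coordinate. -/
theorem eq_of_snd_eq (h : IsFlowBox σ e) (hσ0 : σ.NowhereVanishing)
    (hf : IsUniSmoothFibration n f) (hker : IsGivenByKernel n f σ) {t t' : ℂ} {z : Cn n}
    (ht : (t, z) ∈ e.target) (ht' : (t', z) ∈ e.target) :
    f (e.symm (t, z)) = f (e.symm (t', z)) := by
  obtain ⟨ε, hε, hε'⟩ := h.target_eq
  rw [hε'] at ht ht'
  have hz := ht.2
  have hpc : PreconnectedSpace (Metric.ball (0 : ℂ) ε) :=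
    Subtype.preconnectedSpace (convex_ball (0 : ℂ) ε).isPreconnected
  have hl : IsLocallyConstant fun t : Metric.ball (0 : ℂ) ε => f (e.symm (t, z)) := by
    rw [IsLocallyConstant.iff_eventually_eq]
    intro t
    have hp : ((t : ℂ), z) ∈ e.target := by
      rw [hε']
      exact ⟨t.2, hz⟩
    have h1 := (h.eventually_fibre hσ0 hf hker (e.map_target hp)).2
    rw [e.right_inv hp] at h1
    exact continuous_subtype_val.continuousAt.eventually h1
  exact hl.apply_eq_of_preconnectedSpace ⟨t, ht.1⟩ ⟨t', ht'.1⟩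

/-- The images under `f` of neighbourhoods of points on the same leaf agree. -/
theorem map_nhds_eq (h : IsFlowBox σ e) (hσ0 : σ.NowhereVanishing)
    (hf : IsUniSmoothFibration n f) (hker : IsGivenByKernel n f σ) {t : ℂ} {z : Cn n}
    (ht : (t, z) ∈ e.target) :
    map f (𝓝 (e.symm (t, z))) = map (fun z => f (e.symm (0, z))) (𝓝 z) := by
  obtain ⟨ε, hε, hε'⟩ := h.target_eq
  have h1 : map e.symm (𝓝 (t, z)) = 𝓝 (e.symm (t, z)) := e.symm.map_nhds_eq ht
  rw [← h1, map_map]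
  have h2 : (f ∘ e.symm) =ᶠ[𝓝 (t, z)] (fun z => f (e.symm (0, z))) ∘ Prod.snd := by
    filter_upwards [e.open_target.mem_nhds ht] with p hp
    refine h.eq_of_snd_eq hσ0 hf hker (t := p.1) (t' := 0) (z := p.2) hp ?_
    rw [hε'] at hp ⊢
    exact ⟨Metric.mem_ball_self hε, hp.2⟩
  rw [map_congr h2, ← map_map, nhds_prod_eq, map_snd_prod]

end IsFlowBox

variable [TopologicalSpace B] [ReducedComplexSpace B] {f : C(D, B)}

theorem IsGivenByKernel.exists_kernel_vector (hf : IsUniSmoothFibration n f)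
    (hker : IsGivenByKernel n f σ) (y : D) : ∃ v : Cn (n + 1), v ≠ 0 ∧ InFormKernel (σ.val y) v := by
  obtain ⟨γ, rfl, hγ, -⟩ := exists_fibre_curve hf hker y
  exact ⟨_, hγ.self_of_nhds.2.2.2, hγ.self_of_nhds.2.2.1⟩

/-- A fibration given by the kernel of a form is an open map: the images of the neighbourhoods of a
point only depend on the fibre, by connectedness of the fibres, so that the saturation of an open
set is open. -/
theorem IsUniSmoothFibration.map_nhds [IsManifold 𝓘(ℂ, Cn (n + 1)) ω D]
    (hf : IsUniSmoothFibration n f) (hσ : σ.IsHolomorphic)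
    (hσ0 : σ.NowhereVanishing) (hker : IsGivenByKernel n f σ) (x : D) : map f (𝓝 x) = 𝓝 (f x) := by
  have hmap : ∀ y, f y = f x → map f (𝓝 x) = map f (𝓝 y) := by
    intro y hy
    refine (hf.connected (f x)).isPreconnected.induction₂'
      (fun a b => map f (𝓝 a) = map f (𝓝 b)) (fun a ha => ?_)
      (fun a b c _ _ _ h1 h2 => h1.trans h2) rfl hy
    obtain ⟨e, he, hae, -⟩ := exists_isFlowBox hσ hσ0 (hker.exists_kernel_vector hf) a
    filter_upwards [nhdsWithin_le_nhds (he.eventually_fibre hσ0 hf hker hae).1,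
      nhdsWithin_le_nhds (e.open_source.mem_nhds hae), self_mem_nhdsWithin] with b h1 h2 h3
    have h4 := h1 (Eq.trans h3 ha.symm)
    have h5 := he.map_nhds_eq hσ0 hf hker (t := (e a).1) (z := (e a).2) (e.map_source hae)
    have h6 := he.map_nhds_eq hσ0 hf hker (t := (e b).1) (z := (e b).2) (e.map_source h2)
    rw [Prod.mk.eta, e.left_inv hae] at h5
    rw [Prod.mk.eta, e.left_inv h2, h4] at h6
    exact ⟨h5.trans h6.symm, h6.trans h5.symm⟩
  refine le_antisymm f.continuous.continuousAt fun N hN => ?_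
  have hcl : IsClosedMap f := hf.proper.isClosedMap
  have h1 : ∀ y, f y = f x → f ⁻¹' N ∈ 𝓝 y := fun y hy => by
    have : N ∈ map f (𝓝 x) := hN
    rw [hmap y hy] at this
    exact this
  have h2 : f ⁻¹' N ∈ 𝓝ˢ (f ⁻¹' {f x}) := mem_nhdsSet_iff_forall.2 h1
  rw [← hcl.comap_nhds_eq f.continuous] at h2
  obtain ⟨V, hV, hVN⟩ := h2
  refine mem_of_superset hV fun b hb => ?_
  obtain ⟨y, rfl⟩ := hf.surjective b
  exact hVN hb

end FlowBoxFibres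

/-! ### Quotients of Jacobian forms by the given form -/

section JacobianQuotient

variable {n : ℕ} {D B : Type*} [TopologicalSpace D] [ChartedSpace (Cn (n + 1)) D]
  {σ : DForm (n + 1) n D} {e : OpenPartialHomeomorph D (ℂ × Cn n)}

open Classical in
/-- The quotient `dY₁ ∧ … ∧ dYₙ / σ` at a point, for functions whose differentials vanish on the
kernel of `σ`: the two forms are compared on a chosen frame on which `σ` does not vanish. It is `0`
where `σ` vanishes. -/
noncomputable def jacQuot (σ : DForm (n + 1) n D) (Y : Fin n → D → ℂ) (x : D) : ℂ :=
  if h : ∃ w : Fin n → Cn (n + 1), σ.val x w ≠ 0 then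
    Matrix.det (Matrix.of fun i j =>
      (mfderiv 𝓘(ℂ, Cn (n + 1)) 𝓘(ℂ, ℂ) (Y i) x : Cn (n + 1) →L[ℂ] ℂ) (h.choose j)) /
        σ.val x h.choose
  else 0

/-- The defining property of the quotient in a flow box, where a form killed by `∂/∂t` is a multiple
of `dz₁ ∧ … ∧ dzₙ`. -/
theorem IsFlowBox.jacQuot_mul (h : IsFlowBox σ e) (hσ0 : σ.NowhereVanishing)
    {Y : Fin n → D → ℂ} {p : ℂ × Cn n} (hp : p ∈ e.target)
    (hY : ∀ i, ManifoldHolAt (n + 1) (Y i) (e.symm p))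
    (hY0 : ∀ i, fderiv ℂ (Y i ∘ e.symm) p (1, 0) = 0) :
    jacQuot σ Y (e.symm p) * σ.param e.symm p (stdFrame n) =
      Matrix.det (Matrix.of fun i j => fderiv ℂ (Y i ∘ e.symm) p (stdFrame n j)) := by
  have hs := h.density_ne_zero hσ0 hp
  have hex : ∃ w : Fin n → Cn (n + 1), σ.val (e.symm p) w ≠ 0 := ⟨_, hs⟩
  rw [jacQuot, dif_pos hex]
  set w := hex.choose with hw
  have hw0 : σ.val (e.symm p) w ≠ 0 := hex.choose_spec
  choose R hR using h.surjective_paramDeriv hp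
  have h1 : (fun i => paramDeriv (n + 1) e.symm p (R (w i))) = w := funext fun i => hR _
  have h2 : σ.val (e.symm p) w = σ.param e.symm p (stdFrame n) *
      Matrix.det (Matrix.of fun i j => (R (w i)).2 j) := by
    rw [← h.param_apply hp, DForm.param_apply, h1]
  have h3 : ∀ i j, (mfderiv 𝓘(ℂ, Cn (n + 1)) 𝓘(ℂ, ℂ) (Y i) (e.symm p) : Cn (n + 1) →L[ℂ] ℂ) (w j)
      = ∑ k, fderiv ℂ (Y i ∘ e.symm) p (stdFrame n k) * (R (w j)).2 k := by
    intro i j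
    have h4 := mfderiv_comp p ((hY i).mdifferentiableAt (by simp))
      ((h.contMDiffAt_symm hp).mdifferentiableAt (by simp))
    rw [mfderiv_eq_fderiv] at h4
    have h5 : fderiv ℂ (Y i ∘ e.symm) p (R (w j)) =
        (mfderiv 𝓘(ℂ, Cn (n + 1)) 𝓘(ℂ, ℂ) (Y i) (e.symm p) : Cn (n + 1) →L[ℂ] ℂ)
          (paramDeriv (n + 1) e.symm p (R (w j))) := DFunLike.congr_fun h4 (R (w j))
    rw [hR] at h5
    rw [← h5]
    have h6 : R (w j) = (R (w j)).1 • ((1 : ℂ), (0 : Cn n)) +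
        ∑ k, (R (w j)).2 k • stdFrame n k := by
      ext k
      · simp [stdFrame, Prod.fst_sum]
      · simp [stdFrame, Prod.snd_sum, Pi.single_apply]
    conv_lhs => rw [h6]
    rw [map_add, map_smul, hY0, smul_zero, zero_add, map_sum]
    refine Finset.sum_congr rfl fun k _ => ?_
    rw [map_smul, smul_eq_mul, mul_comm]
  have h7 : (Matrix.of fun i j =>
      (mfderiv 𝓘(ℂ, Cn (n + 1)) 𝓘(ℂ, ℂ) (Y i) (e.symm p) : Cn (n + 1) →L[ℂ] ℂ) (w j)) =
      (Matrix.of fun i j => fderiv ℂ (Y i ∘ e.symm) p (stdFrame n j)) *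
        (Matrix.of fun i j => (R (w i)).2 j).transpose := by
    ext i j
    simp only [Matrix.of_apply, Matrix.mul_apply, Matrix.transpose_apply]
    exact h3 i j
  rw [h7, Matrix.det_mul, Matrix.det_transpose]
  rw [h2] at hw0 ⊢
  have h8 := right_ne_zero_of_mul hw0
  field_simp

variable [TopologicalSpace B] [ReducedComplexSpace B] {f : C(D, B)}

/-- The restriction of `f` to the transversal `t = 0` of a flow box, as a parametrization of a part of
the base. -/
noncomputable def boxSlice (f : C(D, B)) (e : OpenPartialHomeomorph D (ℂ × Cn n)) (z : Cn n) : B :=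
  f (e.symm (0, z))

namespace IsFlowBox

theorem zero_mem_target (h : IsFlowBox σ e) {p : ℂ × Cn n} (hp : p ∈ e.target) :
    ((0 : ℂ), p.2) ∈ e.target := by
  obtain ⟨ε, hε, hε'⟩ := h.target_eq
  rw [hε'] at hp ⊢
  exact ⟨Metric.mem_ball_self hε, hp.2⟩

theorem apply_eq_boxSlice (h : IsFlowBox σ e) (hσ0 : σ.NowhereVanishing)
    (hf : IsUniSmoothFibration n f) (hker : IsGivenByKernel n f σ) {p : ℂ × Cn n}
    (hp : p ∈ e.target) : f (e.symm p) = boxSlice f e p.2 :=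
  h.eq_of_snd_eq hσ0 hf hker (t := p.1) (z := p.2) hp (h.zero_mem_target hp)

theorem analyticAt_boxSlice (h : IsFlowBox σ e) (hf : IsUniSmoothFibration n f) {z : Cn n}
    (hz : ((0 : ℂ), z) ∈ e.target) {φ : B → ℂ} (hφ : HolAt φ (boxSlice f e z)) :
    AnalyticAt ℂ (φ ∘ boxSlice f e) z := by
  have h1 := (h.manifoldHolAt_iff (e.map_target hz)).1 (hf.holomorphic _ φ hφ)
  rw [e.right_inv hz] at h1
  exact h1.comp_of_eq (f := fun z : Cn n => ((0 : ℂ), z)) (analyticAt_const.prod analyticAt_id) rfl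

theorem jacQuot_comp_mul (h : IsFlowBox σ e) (hσ0 : σ.NowhereVanishing)
    (hf : IsUniSmoothFibration n f) (hker : IsGivenByKernel n f σ) {p : ℂ × Cn n}
    (hp : p ∈ e.target) {y : Fin n → B → ℂ} (hy : ∀ i, HolAt (y i) (f (e.symm p))) :
    jacQuot σ (fun i => y i ∘ f) (e.symm p) * σ.param e.symm p (stdFrame n) =
      Matrix.det (Matrix.of fun i j =>
        fderiv ℂ (y i ∘ boxSlice f e) p.2 (EuclideanSpace.single j 1)) := by
  have h1 : ∀ i, (y i ∘ f) ∘ e.symm =ᶠ[𝓝 p] (y i ∘ boxSlice f e) ∘ Prod.snd := by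
    intro i
    filter_upwards [e.open_target.mem_nhds hp] with q hq
    simp only [Function.comp_apply]
    rw [h.apply_eq_boxSlice hσ0 hf hker hq]
  have h2 : ∀ i, HasFDerivAt ((y i ∘ f) ∘ e.symm) ((fderiv ℂ (y i ∘ boxSlice f e) p.2).comp
      (ContinuousLinearMap.snd ℂ ℂ (Cn n))) p := by
    intro i
    refine HasFDerivAt.congr_of_eventuallyEq ?_ (h1 i)
    have h3 := hy i
    rw [h.apply_eq_boxSlice hσ0 hf hker hp] at h3
    exact (h.analyticAt_boxSlice hf (h.zero_mem_target hp) h3).differentiableAt.hasFDerivAt.comp p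
      (ContinuousLinearMap.snd ℂ ℂ (Cn n)).hasFDerivAt
  rw [h.jacQuot_mul hσ0 hp (fun i => hf.holomorphic _ _ (hy i))
    (fun i => by rw [(h2 i).fderiv]; simp)]
  congr 2
  ext i j
  rw [(h2 i).fderiv]
  rfl

end IsFlowBox

variable [IsManifold 𝓘(ℂ, Cn (n + 1)) ω D]

/-- The quotient `d(y₁ ∘ f) ∧ … ∧ d(yₙ ∘ f) / σ` is constant on the fibres of `f`, by the maximum
principle: the fibres are compact and connected. -/
theorem jacQuot_comp_eq (hf : IsUniSmoothFibration n f) (hσ : σ.IsHolomorphic)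
    (hσ0 : σ.NowhereVanishing) (hker : IsGivenByKernel n f σ) {y : Fin n → B → ℂ} {x x' : D}
    (hx : f x = f x') (hy : ∀ i, HolAt (y i) (f x)) :
    jacQuot σ (fun i => y i ∘ f) x = jacQuot σ (fun i => y i ∘ f) x' := by
  set M := jacQuot σ (fun i => y i ∘ f) with hM
  set C := f ⁻¹' {f x} with hC
  have hbox : ∀ a ∈ C, ∃ e : OpenPartialHomeomorph D (ℂ × Cn n), IsFlowBox σ e ∧ a ∈ e.source :=
    fun a _ => by
      obtain ⟨e, he, hae, -⟩ := exists_isFlowBox hσ hσ0 (hker.exists_kernel_vector hf) a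
      exact ⟨e, he, hae⟩
  -- along a leaf the quotient is a constant divided by the density of the form
  have hleaf : ∀ a ∈ C, ∀ e : OpenPartialHomeomorph D (ℂ × Cn n), IsFlowBox σ e → a ∈ e.source →
      ∃ d : ℂ, (∀ t, (t, (e a).2) ∈ e.target →
        M (e.symm (t, (e a).2)) = d / σ.param e.symm (t, (e a).2) (stdFrame n)) ∧
        ∀ᶠ b in 𝓝[C] a, b ∈ e.source ∧ (e b).2 = (e a).2 := by
    intro a ha e he hae
    refine ⟨Matrix.det (Matrix.of fun i j => fderiv ℂ (y i ∘ boxSlice f e) (e a).2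
      (EuclideanSpace.single j 1)), fun t ht => (eq_div_iff (he.density_ne_zero hσ0 ht)).2
      (he.jacQuot_comp_mul hσ0 hf hker ht (y := y) fun i => ?_), ?_⟩
    · have h1 := he.eq_of_snd_eq hσ0 hf hker ht (t' := (e a).1) (e.map_source hae)
      rw [Prod.mk.eta, e.left_inv hae] at h1
      rw [h1, ha]
      exact hy i
    · filter_upwards [nhdsWithin_le_nhds (he.eventually_fibre hσ0 hf hker hae).1,
        nhdsWithin_le_nhds (e.open_source.mem_nhds hae), self_mem_nhdsWithin] with b h1 h2 h3
      exact ⟨h2, h1 (Eq.trans h3 ha.symm)⟩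
  have hcont : ContinuousOn M C := by
    intro a ha
    obtain ⟨e, he, hae⟩ := hbox a ha
    obtain ⟨d, hd, hb⟩ := hleaf a ha e he hae
    have h1 : M =ᶠ[𝓝[C] a] fun b => d / σ.param e.symm (e b) (stdFrame n) := by
      filter_upwards [hb] with b hb
      have h2 := hd (e b).1
      rw [← hb.2, Prod.mk.eta] at h2
      rw [← h2 (e.map_source hb.1), e.left_inv hb.1]
    have h2 : ContinuousAt (fun b => d / σ.param e.symm (e b) (stdFrame n)) a :=
      continuousAt_const.div ((he.analyticAt_density hσ (e.map_source hae)).continuousAt.comp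
        (e.continuousAt hae)) (he.density_ne_zero hσ0 (e.map_source hae))
    refine h2.continuousWithinAt.congr_of_eventuallyEq h1 ?_
    have h3 := hd (e a).1
    rw [Prod.mk.eta] at h3
    rw [← h3 (e.map_source hae), e.left_inv hae]
  have hcomp : IsCompact C := hf.proper.isCompact_preimage isCompact_singleton
  obtain ⟨a₀, ha₀, hmax⟩ := hcomp.exists_isMaxOn ⟨x, rfl⟩ hcont.norm
  have hloc : ∀ a ∈ C, M a = M a₀ → ∀ᶠ b in 𝓝[C] a, M b = M a₀ := by
    intro a ha haM
    obtain ⟨e, he, hae⟩ := hbox a ha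
    obtain ⟨d, hd, hb⟩ := hleaf a ha e he hae
    have hT : ∀ᶠ t in 𝓝 (e a).1, (t, (e a).2) ∈ e.target := by
      have h1 : ContinuousAt (fun t : ℂ => (t, (e a).2)) (e a).1 := by fun_prop
      exact h1.preimage_mem_nhds (e.open_target.mem_nhds (e.map_source hae))
    have ha' : e.symm ((e a).1, (e a).2) = a := by rw [Prod.mk.eta, e.left_inv hae]
    have h1 : ∀ᶠ t in 𝓝 (e a).1, M (e.symm (t, (e a).2)) = M (e.symm ((e a).1, (e a).2)) := by
      refine Complex.eventually_eq_of_isLocalMax_norm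
        (f := fun t => M (e.symm (t, (e a).2))) (c := (e a).1) ?_ ?_
      · filter_upwards [hT.eventually_nhds] with t ht
        have h2 : (fun t => M (e.symm (t, (e a).2))) =ᶠ[𝓝 t]
            fun t => d / σ.param e.symm (t, (e a).2) (stdFrame n) := by
          filter_upwards [ht] with t' ht' using hd t' ht'
        refine DifferentiableAt.congr_of_eventuallyEq ?_ h2
        refine (differentiableAt_const d).div ?_ (he.density_ne_zero hσ0 ht.self_of_nhds)
        exact ((he.analyticAt_density hσ ht.self_of_nhds).comp_of_eq
          (f := fun t : ℂ => (t, (e a).2)) (analyticAt_id.prod analyticAt_const) rfl).differentiableAt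
      · filter_upwards [hT] with t ht
        change ‖M _‖ ≤ ‖M _‖
        rw [ha', haM]
        refine hmax ?_
        have h3 := he.eq_of_snd_eq hσ0 hf hker ht (t' := (e a).1) (e.map_source hae)
        rw [ha'] at h3
        exact h3.trans ha
    have h2 : Tendsto (fun b => (e b).1) (𝓝[C] a) (𝓝 (e a).1) :=
      ((continuous_fst.continuousAt.comp (e.continuousAt hae)).tendsto).mono_left
        nhdsWithin_le_nhds
    filter_upwards [hb, h2.eventually h1] with b h3 h4
    rw [ha', haM, ← h3.2, Prod.mk.eta, e.left_inv h3.1] at h4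
    exact h4
  have key : ∀ a ∈ C, M a = M a₀ := by
    intro a ha
    refine ((hf.connected (f x)).isPreconnected.induction₂'
      (fun a b => M a = M a₀ ↔ M b = M a₀) (fun a ha => ?_)
      (fun a b c _ _ _ h1 h2 => h1.trans h2) ha₀ ha).1 rfl
    by_cases haM : M a = M a₀
    · filter_upwards [hloc a ha haM] with b hb
      simp [haM, hb]
    · filter_upwards [(hcont a ha).eventually_ne haM] with b hb
      simp [haM, hb]
  rw [key x rfl, key x' hx.symm]

end JacobianQuotient

/-! ### Holomorphic germs on a complex space -/

section HolomorphicGerms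

variable {B : Type*} [TopologicalSpace B] [ReducedComplexSpace B]

/-- Near every point, a reduced complex space is embedded in some `ℂᴺ` in such a way that the
holomorphic germs are the restrictions of holomorphic germs of the ambient space. -/
theorem exists_local_embedding (b : B) : ∃ (N : ℕ) (U : Set B) (χ : B → Cn N),
    IsOpen U ∧ b ∈ U ∧ InjOn χ U ∧ (∀ y ∈ U, ContinuousAt χ y) ∧
    (∀ y ∈ U, ∀ i, HolAt (fun x => χ x i) y) ∧
    ∀ y ∈ U, ∀ φ : B → ℂ,
      HolAt φ y ↔ ∃ Φ : Cn N → ℂ, AnalyticAt ℂ Φ (χ y) ∧ φ =ᶠ[𝓝 y] Φ ∘ χ := by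
  obtain ⟨N, U, V, χ, hU, hb, hV, -, hχ, hφ⟩ := local_model b
  refine ⟨N, U, χ, hU, hb, injOn_iff_injective.2 hχ.injective, fun y hy => ?_, fun y hy i => ?_, hφ⟩
  · exact (continuousOn_iff_continuous_domRestrict.2 hχ.continuous).continuousAt (hU.mem_nhds hy)
  · exact (hφ y hy _).2 ⟨fun q => q i, (EuclideanSpace.proj (𝕜 := ℂ) i).analyticAt _,
      EventuallyEq.rfl⟩

namespace ReducedComplexSpace

theorem HolAt.congr {φ ψ : B → ℂ} {b : B} (hφ : HolAt φ b) (h : φ =ᶠ[𝓝 b] ψ) : HolAt ψ b := by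
  obtain ⟨N, U, χ, hU, hb, -, -, -, hiff⟩ := exists_local_embedding b
  obtain ⟨Φ, hΦ, h1⟩ := (hiff b hb φ).1 hφ
  exact (hiff b hb ψ).2 ⟨Φ, hΦ, h.symm.trans h1⟩

theorem HolAt.continuousAt {φ : B → ℂ} {b : B} (hφ : HolAt φ b) : ContinuousAt φ b := by
  obtain ⟨N, U, χ, hU, hb, -, hc, -, hiff⟩ := exists_local_embedding b
  obtain ⟨Φ, hΦ, h1⟩ := (hiff b hb φ).1 hφ
  exact (hΦ.continuousAt.comp (hc b hb)).congr h1.symm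

theorem HolAt.eventually {φ : B → ℂ} {b : B} (hφ : HolAt φ b) : ∀ᶠ y in 𝓝 b, HolAt φ y := by
  obtain ⟨N, U, χ, hU, hb, -, hc, -, hiff⟩ := exists_local_embedding b
  obtain ⟨Φ, hΦ, h1⟩ := (hiff b hb φ).1 hφ
  filter_upwards [hU.mem_nhds hb, (hc b hb).eventually hΦ.eventually_analyticAt,
    h1.eventually_nhds] with y h2 h3 h4
  exact (hiff y h2 φ).2 ⟨Φ, h3, h4⟩

/-- Analytic functions of holomorphic germs are holomorphic. The linear map `L` takes the tuple of germs
to the space, with its norm, on which the analytic function is given. -/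
theorem HolAt.analytic_comp {ι : Type*} [Fintype ι] {y : ι → B → ℂ} {b : B}
    (hy : ∀ i, HolAt (y i) b) {E : Type*} [NormedAddCommGroup E] [NormedSpace ℂ E]
    (L : (ι → ℂ) →L[ℂ] E) {Φ : E → ℂ} (hΦ : AnalyticAt ℂ Φ (L fun i => y i b)) :
    HolAt (fun x => Φ (L fun i => y i x)) b := by
  obtain ⟨N, U, χ, hU, hb, -, hc, -, hiff⟩ := exists_local_embedding b
  choose Y hY hyY using fun i => (hiff b hb (y i)).1 (hy i)
  refine (hiff b hb _).2 ⟨fun q => Φ (L fun i => Y i q), ?_, ?_⟩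
  · have h1 : AnalyticAt ℂ (fun q i => Y i q) (χ b) := AnalyticAt.pi hY
    refine (hΦ.comp_of_eq ((L.analyticAt _).comp h1) ?_)
    exact congrArg L (funext fun i => (hyY i).self_of_nhds.symm)
  · filter_upwards [eventually_all.2 hyY] with x hx
    simp only [Function.comp_apply]
    congr 2
    funext i
    exact hx i

theorem HolAt.clm_comp {ι : Type*} [Fintype ι] {y : ι → B → ℂ} {b : B} (hy : ∀ i, HolAt (y i) b)
    (L : (ι → ℂ) →L[ℂ] ℂ) : HolAt (fun x => L fun i => y i x) b :=
  HolAt.analytic_comp hy L (Φ := fun t => t) analyticAt_id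

/-- The coordinate functions of a chart are holomorphic. -/
theorem IsChart.holAt_coord {n : ℕ} {e : OpenPartialHomeomorph B (Cn n)} (he : IsChart e) {b : B}
    (hb : b ∈ e.source) (i : Fin n) : HolAt (fun x => e x i) b := by
  rw [he b hb]
  refine ((EuclideanSpace.proj (𝕜 := ℂ) i).analyticAt (e b)).congr ?_
  filter_upwards [e.open_target.mem_nhds (e.map_source hb)] with q hq
  simp [e.right_inv hq]

end ReducedComplexSpace

end HolomorphicGerms

/-! ### Slices and Jacobian determinants -/

section Slices

variable {n : ℕ} {B : Type*} [TopologicalSpace B] [ReducedComplexSpace B]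

/-- A finite open holomorphic parametrization `g` of a part of `B` by an open subset of `ℂⁿ`, for
which the Jacobian determinants of holomorphic functions on `B` descend to `B`, up to a common
nonvanishing factor `s`: the Jacobian determinant of `y ∘ g` is `s` times `m y ∘ g`. -/
structure IsSlice (m : (Fin n → B → ℂ) → B → ℂ) (g : Cn n → B) (s : Cn n → ℂ) (T : Set (Cn n)) :
    Prop where
  isOpen : IsOpen T
  map_nhds : ∀ z ∈ T, map g (𝓝 z) = 𝓝 (g z)
  eventually_eq : ∀ z ∈ T, ∀ᶠ z' in 𝓝 z, g z' = g z → z' = z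
  analyticAt : ∀ z ∈ T, ∀ φ : B → ℂ, HolAt φ (g z) → AnalyticAt ℂ (φ ∘ g) z
  analyticAt_density : ∀ z ∈ T, AnalyticAt ℂ s z
  density_ne_zero : ∀ z ∈ T, s z ≠ 0
  jac : ∀ z ∈ T, ∀ y : Fin n → B → ℂ, (∀ i, HolAt (y i) (g z)) →
    s z * m y (g z) = Matrix.det (Matrix.of fun i j =>
      fderiv ℂ (y i ∘ g) z (EuclideanSpace.single j 1))

/-- The points at which all Jacobian determinants vanish. -/
def degeneracyLocus (m : (Fin n → B → ℂ) → B → ℂ) : Set B :=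
  {b | ∀ y : Fin n → B → ℂ, (∀ i, HolAt (y i) b) → m y b = 0}

variable {m : (Fin n → B → ℂ) → B → ℂ} {g : Cn n → B} {s : Cn n → ℂ} {T : Set (Cn n)}

/-- The joint map of finitely many functions, in the parameters. -/
def jointMap {ι : Type*} (y : ι → B → ℂ) (g : Cn n → B) (z : Cn n) (i : ι) : ℂ := y i (g z)

namespace IsSlice

theorem continuousAt (h : IsSlice m g s T) {z : Cn n} (hz : z ∈ T) : ContinuousAt g z :=
  (h.map_nhds z hz).le

theorem analyticAt_jointMap (h : IsSlice m g s T) {ι : Type*} [Fintype ι] {y : ι → B → ℂ}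
    {z : Cn n} (hz : z ∈ T)
    (hy : ∀ i, HolAt (y i) (g z)) : AnalyticAt ℂ (jointMap y g) z :=
  AnalyticAt.pi fun i => h.analyticAt z hz _ (hy i)

theorem fderiv_jointMap (h : IsSlice m g s T) {ι : Type*} [Fintype ι] {y : ι → B → ℂ} {z : Cn n}
    (hz : z ∈ T) (hy : ∀ i, HolAt (y i) (g z)) (w : Cn n) (i : ι) :
    fderiv ℂ (jointMap y g) z w i = fderiv ℂ (y i ∘ g) z w := by
  have h1 := hasFDerivAt_pi'.1 (h.analyticAt_jointMap hz hy).differentiableAt.hasFDerivAt i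
  rw [show y i ∘ g = fun z => jointMap y g z i from rfl, h1.fderiv]
  rfl

theorem injective_fderiv_jointMap (h : IsSlice m g s T) {y : Fin n → B → ℂ} {z : Cn n}
    (hz : z ∈ T) (hy : ∀ i, HolAt (y i) (g z)) (hm : m y (g z) ≠ 0) :
    Function.Injective (fderiv ℂ (jointMap y g) z) := by
  rw [injective_iff_map_eq_zero]
  intro w hw
  have h1 := h.jac z hz y hy
  have h2 := mul_ne_zero (h.density_ne_zero z hz) hm
  rw [h1] at h2
  have h3 := Matrix.eq_zero_of_mulVec_eq_zero h2 (v := fun j => w j) (by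
    funext i
    have h4 := congrFun hw i
    rw [h.fderiv_jointMap hz hy] at h4
    have h5 : w = ∑ j, w j • EuclideanSpace.single j (1 : ℂ) := by
      ext j
      simp [Pi.single_apply]
    rw [h5, map_sum] at h4
    simp only [Matrix.mulVec, dotProduct, Matrix.of_apply, Pi.zero_apply] at h4 ⊢
    rw [← h4]
    refine Finset.sum_congr rfl fun j _ => ?_
    rw [map_smul, smul_eq_mul, mul_comm])
  ext j
  exact congrFun h3 j

/-- Where some Jacobian determinant is nonzero, the base is regular and the slice is the inverse of
a chart. -/
theorem exists_isChart (h : IsSlice m g s T) {z : Cn n} (hz : z ∈ T)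
    (hg : g z ∉ degeneracyLocus m) :
    ∃ e : OpenPartialHomeomorph B (Cn n), IsChart e ∧ g z ∈ e.source ∧ e (g z) = z ∧
      e.target ⊆ T ∧ (e.symm : Cn n → B) = g := by
  obtain ⟨y, hy, hm⟩ : ∃ y : Fin n → B → ℂ, (∀ i, HolAt (y i) (g z)) ∧ m y (g z) ≠ 0 := by
    simpa [degeneracyLocus] using hg
  let e' : Cn n ≃L[ℂ] (Fin n → ℂ) :=
    (LinearEquiv.ofInjectiveOfFinrankEq (fderiv ℂ (jointMap y g) z).toLinearMap
      (h.injective_fderiv_jointMap hz hy hm) (by simp)).toContinuousLinearEquiv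
  have hder : HasFDerivAt (jointMap y g) (e' : Cn n →L[ℂ] (Fin n → ℂ)) z := by
    refine (h.analyticAt_jointMap hz hy).differentiableAt.hasFDerivAt.congr_fderiv ?_
    ext1 w
    rfl
  have hO : {z | z ∈ T ∧ ∀ i, HolAt (y i) (g z)} ∈ 𝓝 z := by
    filter_upwards [h.isOpen.mem_nhds hz,
      (h.continuousAt hz).eventually (eventually_all.2 fun i => (hy i).eventually)] with z' h1 h2
    exact ⟨h1, h2⟩
  obtain ⟨Φ, hzΦ, hΦO, hΦ, -, hΦs⟩ :=
    (h.analyticAt_jointMap hz hy).exists_openPartialHomeomorph e' hder hO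
  have hinv : ∀ z ∈ Φ.source, Φ.symm (fun i => y i (g z)) = z := fun z hz => by
    have := Φ.left_inv hz
    rwa [hΦ] at this
  let e₀ : OpenPartialHomeomorph (Cn n) B :=
    { toFun := g
      invFun := fun b => Φ.symm fun i => y i b
      source := Φ.source
      target := g '' Φ.source
      map_source' := fun z hz => mem_image_of_mem g hz
      map_target' := by
        rintro _ ⟨z, hz, rfl⟩
        rwa [hinv z hz]
      left_inv' := hinv
      right_inv' := by
        rintro _ ⟨z, hz, rfl⟩
        rw [hinv z hz]
      open_source := Φ.open_source
      open_target := by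
        rw [isOpen_iff_mem_nhds]
        rintro _ ⟨z, hz, rfl⟩
        rw [← h.map_nhds z (hΦO hz).1]
        exact image_mem_map (Φ.open_source.mem_nhds hz)
      continuousOn_toFun := fun z hz => (h.continuousAt (hΦO hz).1).continuousWithinAt
      continuousOn_invFun := by
        rintro _ ⟨z, hz, rfl⟩
        refine ContinuousAt.continuousWithinAt ?_
        rw [ContinuousAt, ← h.map_nhds z (hΦO hz).1, tendsto_map'_iff, hinv z hz]
        refine tendsto_id.congr' ?_
        filter_upwards [Φ.open_source.mem_nhds hz] with z' hz' using (hinv z' hz').symm }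
  refine ⟨e₀.symm, ?_, mem_image_of_mem g hzΦ, hinv z hzΦ, fun z hz => (hΦO hz).1, rfl⟩
  rintro _ ⟨z, hz, rfl⟩ φ
  have h1 : e₀.symm (g z) = z := hinv z hz
  rw [h1]
  refine ⟨fun hφ => h.analyticAt z (hΦO hz).1 φ hφ, fun hφ => ?_⟩
  have hφ' : AnalyticAt ℂ (φ ∘ g) z := hφ
  have h2 : AnalyticAt ℂ (fun q => (φ ∘ g) (Φ.symm q))
      (ContinuousLinearMap.id ℂ (Fin n → ℂ) fun i => y i (g z)) := by
    refine hφ'.comp_of_eq (hΦs _ ?_) (hinv z hz)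
    have := Φ.map_source hz
    rwa [hΦ] at this
  refine (HolAt.analytic_comp (hΦO hz).2 (ContinuousLinearMap.id ℂ (Fin n → ℂ)) h2).congr ?_
  filter_upwards [e₀.open_target.mem_nhds (mem_image_of_mem g hz)] with b hb
  obtain ⟨z', hz', rfl⟩ := hb
  simp [hinv z' hz']

end IsSlice

end Slices

/-! ### The degeneracy locus -/

section Degeneracy

variable {n : ℕ} {B : Type*} [TopologicalSpace B] [ReducedComplexSpace B]
variable {m : (Fin n → B → ℂ) → B → ℂ} {g : Cn n → B} {s : Cn n → ℂ} {T : Set (Cn n)}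

/-- Every point of `B` lies in the image of a slice, as the image of the origin. -/
def HasSlices (m : (Fin n → B → ℂ) → B → ℂ) : Prop :=
  ∀ b : B, ∃ (g : Cn n → B) (s : Cn n → ℂ) (T : Set (Cn n)), IsSlice m g s T ∧ 0 ∈ T ∧ g 0 = b

namespace IsSlice

/-- If the functions `y i` are functions of `χ`, then the Jacobian matrix of `y` is a product. -/
theorem jac_eq_mul (h : IsSlice m g s T) {z : Cn n} (hz : z ∈ T) {N : ℕ} {χ : B → Cn N}
    (hχ : ∀ i, HolAt (fun x => χ x i) (g z)) {y : Fin n → B → ℂ} {Y : Fin n → Cn N → ℂ}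
    (hY : ∀ i, AnalyticAt ℂ (Y i) (χ (g z))) (hyY : ∀ i, y i =ᶠ[𝓝 (g z)] Y i ∘ χ) :
    (Matrix.of fun i j => fderiv ℂ (y i ∘ g) z (EuclideanSpace.single j 1)) =
      (Matrix.of fun i k => fderiv ℂ (Y i) (χ (g z)) (EuclideanSpace.single k 1)) *
        Matrix.of fun k j => fderiv ℂ ((fun x => χ x k) ∘ g) z (EuclideanSpace.single j 1) := by
  have hχa : AnalyticAt ℂ (χ ∘ g) z := by
    have h1 := h.analyticAt_jointMap (y := fun k x => χ x k) hz hχ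
    exact ((PiLp.continuousLinearEquiv 2 ℂ (fun _ : Fin N => ℂ)).symm.analyticAt _).comp h1
  have hk : ∀ k w, fderiv ℂ (χ ∘ g) z w k = fderiv ℂ ((fun x => χ x k) ∘ g) z w := by
    intro k w
    have h1 := ((EuclideanSpace.proj (𝕜 := ℂ) k : Cn N →L[ℂ] ℂ)).hasFDerivAt.comp z
      hχa.differentiableAt.hasFDerivAt
    rw [show (fun x => χ x k) ∘ g = (EuclideanSpace.proj (𝕜 := ℂ) k : Cn N →L[ℂ] ℂ) ∘ (χ ∘ g)
      from rfl, h1.fderiv]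
    rfl
  ext i j
  have h1 : y i ∘ g =ᶠ[𝓝 z] Y i ∘ (χ ∘ g) := (h.continuousAt hz).eventually (hyY i)
  have h2 := (hY i).differentiableAt.hasFDerivAt.comp z hχa.differentiableAt.hasFDerivAt
  simp only [Matrix.mul_apply, Matrix.of_apply]
  rw [h1.fderiv_eq, h2.fderiv, ContinuousLinearMap.comp_apply]
  have h3 : fderiv ℂ (χ ∘ g) z (EuclideanSpace.single j 1) =
      ∑ k, fderiv ℂ (χ ∘ g) z (EuclideanSpace.single j 1) k • EuclideanSpace.single k (1 : ℂ) := by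
    ext k
    simp [Pi.single_apply]
  rw [h3, map_sum]
  refine Finset.sum_congr rfl fun k _ => ?_
  rw [map_smul, smul_eq_mul, mul_comm, hk]

theorem analyticAt_jac (h : IsSlice m g s T) {z : Cn n} (hz : z ∈ T) {y : Fin n → B → ℂ}
    (hy : ∀ i, HolAt (y i) (g z)) : AnalyticAt ℂ (m y ∘ g) z := by
  have h1 : (m y ∘ g) =ᶠ[𝓝 z] fun z => Matrix.det (Matrix.of fun i j =>
      fderiv ℂ (y i ∘ g) z (EuclideanSpace.single j 1)) / s z := by
    filter_upwards [h.isOpen.mem_nhds hz,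
      (h.continuousAt hz).eventually (eventually_all.2 fun i => (hy i).eventually)] with z' h1 h2
    rw [eq_div_iff (h.density_ne_zero z' h1), mul_comm]
    exact h.jac z' h1 y h2
  refine AnalyticAt.congr ?_ h1.symm
  refine AnalyticAt.fun_div ?_ (h.analyticAt_density z hz) (h.density_ne_zero z hz)
  simp only [Matrix.det_apply']
  refine Finset.analyticAt_fun_sum _ fun π _ => ?_
  refine AnalyticAt.fun_mul analyticAt_const ?_
  refine Finset.analyticAt_fun_prod _ fun i _ => ?_
  exact ((ContinuousLinearMap.apply ℂ ℂ (EuclideanSpace.single i (1 : ℂ))).analyticAt _).comp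
    (h.analyticAt z hz _ (hy _)).fderiv

theorem continuousAt_jac (h : IsSlice m g s T) {z : Cn n} (hz : z ∈ T) {y : Fin n → B → ℂ}
    (hy : ∀ i, HolAt (y i) (g z)) : ContinuousAt (m y) (g z) := by
  have := (h.analyticAt_jac hz hy).continuousAt
  rw [ContinuousAt, ← h.map_nhds z hz, tendsto_map'_iff]
  exact this

end IsSlice

theorem HasSlices.continuousAt_jac (H : HasSlices m) {b : B} {y : Fin n → B → ℂ}
    (hy : ∀ i, HolAt (y i) b) : ContinuousAt (m y) b := by
  obtain ⟨g, s, T, h, h0, rfl⟩ := H b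
  exact h.continuousAt_jac h0 hy

/-- The chain rule for Jacobian determinants, in a chart. -/
theorem HasSlices.jac_eq_det_mul (H : HasSlices m) {e : OpenPartialHomeomorph B (Cn n)}
    (he : IsChart e) {b : B} (hb : b ∈ e.source) {y : Fin n → B → ℂ} (hy : ∀ i, HolAt (y i) b) :
    m y b = Matrix.det (Matrix.of fun i k =>
      fderiv ℂ (y i ∘ e.symm) (e b) (EuclideanSpace.single k 1)) * m (fun i x => e x i) b := by
  obtain ⟨g, s, T, h, h0, rfl⟩ := H b
  have h1 := h.jac 0 h0 y hy
  have h2 := h.jac 0 h0 (fun i x => e x i) fun i => he.holAt_coord hb i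
  rw [h.jac_eq_mul h0 (χ := e) (fun i => he.holAt_coord hb i) (Y := fun i => y i ∘ e.symm)
    (fun i => (he _ hb _).1 (hy i)) (fun i => by
      filter_upwards [e.open_source.mem_nhds hb] with x hx
      simp [e.left_inv hx]), Matrix.det_mul, ← h2] at h1
  refine mul_left_cancel₀ (h.density_ne_zero 0 h0) (h1.trans ?_)
  ring

theorem HasSlices.mem_degeneracyLocus_iff_chart (H : HasSlices m)
    {e : OpenPartialHomeomorph B (Cn n)} (he : IsChart e) {b : B} (hb : b ∈ e.source) :
    b ∈ degeneracyLocus m ↔ m (fun i x => e x i) b = 0 :=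
  ⟨fun h => h _ fun i => he.holAt_coord hb i,
    fun h y hy => by rw [H.jac_eq_det_mul he hb hy, h, mul_zero]⟩

/-- The degeneracy locus is the zero set of the minors of a local embedding. -/
theorem HasSlices.mem_degeneracyLocus_iff (H : HasSlices m) {b : B} {N : ℕ} {χ : B → Cn N}
    (hχ : ∀ i, HolAt (fun x => χ x i) b)
    (hiff : ∀ φ, HolAt φ b ↔ ∃ Φ : Cn N → ℂ, AnalyticAt ℂ Φ (χ b) ∧ φ =ᶠ[𝓝 b] Φ ∘ χ) :
    b ∈ degeneracyLocus m ↔ ∀ I : Fin n → Fin N, m (fun i x => χ x (I i)) b = 0 := by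
  refine ⟨fun h I => h _ fun i => hχ (I i), fun h0 y hy => ?_⟩
  obtain ⟨g, s, T, h, h0T, rfl⟩ := H b
  choose Y hY hyY using fun i => (hiff (y i)).1 (hy i)
  have h1 := h.jac 0 h0T y hy
  rw [h.jac_eq_mul h0T hχ hY hyY] at h1
  refine (mul_eq_zero.1 (h1.trans ?_)).resolve_left (h.density_ne_zero 0 h0T)
  set A : Matrix (Fin n) (Fin N) ℂ :=
    Matrix.of fun i k => fderiv ℂ (Y i) (χ (g 0)) (EuclideanSpace.single k 1) with hA
  set R : Matrix (Fin N) (Fin n) ℂ := Matrix.of fun k j =>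
    fderiv ℂ ((fun x => χ x k) ∘ g) 0 (EuclideanSpace.single j 1) with hR
  have h2 : (A * R) = fun i => ∑ k, A i k • R k := by
    funext i j
    simp [Matrix.mul_apply, Finset.sum_apply]
  have h3 := (Matrix.detRowAlternating (R := ℂ) (n := Fin n)).toMultilinearMap.map_sum
    (fun i k => A i k • R k)
  have h4 : Matrix.det (A * R) = ∑ I : Fin n → Fin N,
      (Matrix.detRowAlternating (R := ℂ) (n := Fin n)).toMultilinearMap
        (fun i => A i (I i) • R (I i)) := by
    rw [← h3]
    exact congrArg _ h2
  rw [h4]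
  refine Finset.sum_eq_zero fun I _ => ?_
  rw [MultilinearMap.map_smul_univ]
  refine smul_eq_zero_of_right _ ?_
  have h5 := h.jac 0 h0T (fun i x => χ x (I i)) fun i => hχ (I i)
  rw [h0 I, mul_zero] at h5
  exact h5.symm

/-- The degeneracy locus contains no open set: a finite map is immersive somewhere. -/
theorem HasSlices.degeneracyLocus_notMem_nhds (H : HasSlices m) (b : B) :
    degeneracyLocus m ∉ 𝓝 b := by
  intro hK
  obtain ⟨g, s, T, h, h0T, rfl⟩ := H b
  obtain ⟨N, U, χ, hU, hb, hinj, hc, hχ, hiff⟩ := exists_local_embedding (g 0)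
  set O : Set (Cn n) := interior {z | z ∈ T ∧ g z ∈ U ∧ g z ∈ degeneracyLocus m} with hO
  have h0O : (0 : Cn n) ∈ O := by
    rw [hO, mem_interior_iff_mem_nhds]
    filter_upwards [h.isOpen.mem_nhds h0T, (h.continuousAt h0T).eventually (hU.mem_nhds hb),
      (h.continuousAt h0T).eventually hK] with z h1 h2 h3
    exact ⟨h1, h2, h3⟩
  have hOs : ∀ z ∈ O, z ∈ T ∧ g z ∈ U ∧ g z ∈ degeneracyLocus m := fun z hz =>
    interior_subset (s := {z | z ∈ T ∧ g z ∈ U ∧ g z ∈ degeneracyLocus m}) hz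
  have hGa : AnalyticOnNhd ℂ (χ ∘ g) O := by
    intro z hz
    have h1 := h.analyticAt_jointMap (y := fun k x => χ x k) (hOs z hz).1 (hχ _ (hOs z hz).2.1)
    exact ((PiLp.continuousLinearEquiv 2 ℂ (fun _ : Fin N => ℂ)).symm.analyticAt _).comp h1
  obtain ⟨z, hz, hzi⟩ := hGa.exists_injective_fderiv isOpen_interior ⟨0, h0O⟩ (by
    intro z hz
    filter_upwards [h.eventually_eq z (hOs z hz).1, isOpen_interior.mem_nhds hz] with z' h1 h2 h3
    exact h1 (hinj (hOs z' h2).2.1 (hOs z hz).2.1 h3))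
  obtain ⟨hzT, hzU, hzK⟩ := hOs z hz
  obtain ⟨L', hL'⟩ := (fderiv ℂ (χ ∘ g) z).toLinearMap.exists_leftInverse_of_injective
    (LinearMap.ker_eq_bot.2 hzi)
  let L : Cn N →L[ℂ] Cn n := LinearMap.toContinuousLinearMap L'
  have hL : ∀ w, L (fderiv ℂ (χ ∘ g) z w) = w := fun w => LinearMap.congr_fun hL' w
  have hy : ∀ i, HolAt (fun x => L (χ x) i) (g z) := by
    intro i
    exact HolAt.clm_comp (y := fun k x => χ x k) (hχ _ hzU)
      (((EuclideanSpace.proj (𝕜 := ℂ) i : Cn n →L[ℂ] ℂ).comp L).comp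
        ((PiLp.continuousLinearEquiv 2 ℂ (fun _ : Fin N => ℂ)).symm :
          (Fin N → ℂ) →L[ℂ] PiLp 2 (fun _ : Fin N => ℂ)))
  have h1 := h.jac z hzT (fun i x => L (χ x) i) hy
  rw [hzK _ hy, mul_zero] at h1
  have h2 : (Matrix.of fun i j => fderiv ℂ ((fun x => L (χ x) i) ∘ g) z
      (EuclideanSpace.single j 1)) = (1 : Matrix (Fin n) (Fin n) ℂ) := by
    ext i j
    have h3 := ((EuclideanSpace.proj (𝕜 := ℂ) i : Cn n →L[ℂ] ℂ).comp L).hasFDerivAt.comp z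
      (hGa z hz).differentiableAt.hasFDerivAt
    have h4 : fderiv ℂ ((fun x => L (χ x) i) ∘ g) z =
      ((EuclideanSpace.proj (𝕜 := ℂ) i : Cn n →L[ℂ] ℂ).comp L).comp (fderiv ℂ (χ ∘ g) z) := h3.fderiv
    simp only [Matrix.of_apply]
    rw [h4]
    simp only [ContinuousLinearMap.comp_apply, hL]
    simp [Matrix.one_apply]
  rw [h2, Matrix.det_one] at h1
  exact one_ne_zero h1.symm

theorem HasSlices.mem_regularLocus (H : HasSlices m) {b : B} (hb : b ∉ degeneracyLocus m) :
    b ∈ regularLocus n B := by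
  obtain ⟨g, s, T, h, h0T, rfl⟩ := H b
  obtain ⟨e, he, hbe, -⟩ := h.exists_isChart h0T hb
  exact ⟨e, he, hbe⟩

theorem HasSlices.holAt_jac_of_notMem (H : HasSlices m) {b : B} (hb : b ∉ degeneracyLocus m)
    {y : Fin n → B → ℂ} (hy : ∀ i, HolAt (y i) b) : HolAt (m y) b := by
  obtain ⟨g, s, T, h, h0T, rfl⟩ := H b
  obtain ⟨e, he, hbe, h1, -, h2⟩ := h.exists_isChart h0T hb
  rw [he _ hbe, h2, h1]
  exact h.analyticAt_jac h0T hy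

/-- Jacobian determinants are holomorphic at regular points: they are continuous, and holomorphic off
the degeneracy locus, which is a proper analytic subset by the finite mapping theorem. -/
theorem HasSlices.holAt_jac_of_mem_regularLocus (H : HasSlices m) {b : B}
    (hb : b ∈ regularLocus n B) {y : Fin n → B → ℂ} (hy : ∀ i, HolAt (y i) b) : HolAt (m y) b := by
  obtain ⟨e, he, hbe⟩ := hb
  obtain ⟨g, s, T, h, h0T, rfl⟩ := H b
  have hUa : AnalyticAt ℂ (e ∘ g) 0 := by
    have h1 := h.analyticAt_jointMap (y := fun k x => e x k) h0T fun i => he.holAt_coord hbe i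
    exact ((PiLp.continuousLinearEquiv 2 ℂ (fun _ : Fin n => ℂ)).symm.analyticAt _).comp h1
  have hsrc : ∀ᶠ z in 𝓝 (0 : Cn n), g z ∈ e.source :=
    (h.continuousAt h0T).eventually (e.open_source.mem_nhds hbe)
  have hiso : ∀ᶠ z in 𝓝 (0 : Cn n), (e ∘ g) z = (e ∘ g) 0 → z = 0 := by
    filter_upwards [hsrc, h.eventually_eq 0 h0T] with z h1 h2 h3
    exact h2 (e.injOn h1 hbe h3)
  have hA : IsAnalyticGermAt (g ⁻¹' degeneracyLocus m) (0 : Cn n) := by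
    refine .of_fintype (ι := Unit) (g := fun _ => m (fun i x => e x i) ∘ g) (fun _ =>
      h.analyticAt_jac h0T fun i => he.holAt_coord hbe i) ?_
    filter_upwards [hsrc] with z hz
    simp only [mem_preimage, H.mem_degeneracyLocus_iff_chart he hz, forall_const]
    rfl
  obtain ⟨O', hO', hO's, k, F, hF, hFS⟩ := hA.exists_image hUa hiso hsrc
  have hlift : ∀ᶠ q in 𝓝 (e (g 0)), q ∈ e.target ∧ ∃ z ∈ O', g z = e.symm q := by
    have h1 : g '' O' ∈ 𝓝 (g 0) := by
      rw [← h.map_nhds 0 h0T]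
      exact image_mem_map hO'
    have h2 : ContinuousAt e.symm (e (g 0)) := e.continuousAt_symm (e.map_source hbe)
    have h3 : ∀ᶠ q in 𝓝 (e (g 0)), e.symm q ∈ g '' O' :=
      h2.preimage_mem_nhds (by rwa [e.left_inv hbe])
    filter_upwards [h3, e.open_target.mem_nhds (e.map_source hbe)] with q h4 hq
    obtain ⟨z, hz, hzq⟩ := h4
    exact ⟨hq, z, hz, hzq⟩
  have hy' : ∀ᶠ q in 𝓝 (e (g 0)), ∀ i, HolAt (y i) (e.symm q) := by
    have h2 : ContinuousAt e.symm (e (g 0)) := e.continuousAt_symm (e.map_source hbe)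
    refine h2.eventually (p := fun x => ∀ i, HolAt (y i) x) ?_
    rw [e.left_inv hbe]
    exact eventually_all.2 fun i => (hy i).eventually
  obtain ⟨i, hi⟩ : ∃ i, ¬ ∀ᶠ q in 𝓝 (e (g 0)), F i q = 0 := by
    by_contra! hall
    refine H.degeneracyLocus_notMem_nhds (g 0) ?_
    have h1 : ∀ᶠ q in 𝓝 (e (g 0)), q ∈ (e ∘ g) '' (g ⁻¹' degeneracyLocus m ∩ O') := by
      filter_upwards [hFS, eventually_all.2 hall] with q h1 h2 using h1.2 h2
    filter_upwards [(e.continuousAt hbe).eventually h1, e.open_source.mem_nhds hbe] with x hx hxs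
    obtain ⟨z, ⟨hz, hzO⟩, hzx⟩ := hx
    rwa [← e.injOn (hO's hzO) hxs hzx]
  rw [he _ hbe]
  refine (hF i).of_continuous_off_zeros hi ?_ ?_
  · filter_upwards [hy', e.open_target.mem_nhds (e.map_source hbe)] with q h1 h2
    exact (H.continuousAt_jac h1).comp (e.continuousAt_symm h2)
  · filter_upwards [hlift, hFS, hy'] with q h1 h2 h3 h4
    obtain ⟨hq, z, hz, hzq⟩ := h1
    have h5 : e.symm q ∉ degeneracyLocus m := by
      intro h6
      refine h4 (h2.1 ⟨z, ⟨?_, hz⟩, ?_⟩ i)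
      · rw [mem_preimage, hzq]
        exact h6
      · rw [Function.comp_apply, hzq, e.right_inv hq]
    have h6 := (he _ (e.map_target hq) _).1 (H.holAt_jac_of_notMem h5 h3)
    rwa [e.right_inv hq] at h6

/-- On a normal space, Jacobian determinants are holomorphic. -/
theorem HasSlices.holAt_jac (H : HasSlices m) (hnormal : IsNormal n B) {b : B}
    {y : Fin n → B → ℂ} (hy : ∀ i, HolAt (y i) b) : HolAt (m y) b := by
  obtain ⟨U, hUs, hU, hbU⟩ := eventually_nhds_iff.1 (eventually_all.2 fun i => (hy i).eventually)
  obtain ⟨ψ, hψ, hψm⟩ := hnormal U (m y) hU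
    (fun x hx => H.holAt_jac_of_mem_regularLocus hx.2 (hUs x hx.1)) (fun x hx => by
      have h1 := (H.continuousAt_jac (hUs x hx)).norm
      refine ⟨‖m y x‖ + 1, ?_⟩
      filter_upwards [h1.eventually (gt_mem_nhds (lt_add_one _))] with x' hx' _ using hx'.le)
  refine (hψ b hbU).congr ?_
  filter_upwards [hU.mem_nhds hbU] with x hx
  by_contra hne
  have h1 : ∀ᶠ x' in 𝓝 x, ψ x' ≠ m y x' :=
    ((hψ x hx).continuousAt.sub (H.continuousAt_jac (hUs x hx))).eventually_ne
      (sub_ne_zero.2 hne) |>.mono fun x' hx' => sub_ne_zero.1 hx'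
  refine H.degeneracyLocus_notMem_nhds x ?_
  filter_upwards [h1, hU.mem_nhds hx] with x' h2 h3
  by_contra hx'
  exact h2 (hψm ⟨h3, H.mem_regularLocus hx'⟩)

end Degeneracy

/-! ### Dependence of functions at degenerate points -/

section Core

variable {k : ℕ} {B : Type*} [TopologicalSpace B] [ReducedComplexSpace B]
variable {m : (Fin (k + 1) → B → ℂ) → B → ℂ} {g : Cn (k + 1) → B} {s : Cn (k + 1) → ℂ}
  {T : Set (Cn (k + 1))}

/-- A function with vanishing derivative near `0` is constant near `0`. -/
theorem eventually_eq_of_deriv_eq_zero {a : ℂ → ℂ} (ha : AnalyticAt ℂ a 0)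
    (h : ∀ᶠ t in 𝓝 0, deriv a t = 0) : ∀ᶠ t in 𝓝 0, a t = a 0 := by
  obtain ⟨ε, hε, hεs⟩ := Metric.eventually_nhds_iff_ball.1 (ha.eventually_analyticAt.and h)
  filter_upwards [Metric.ball_mem_nhds _ hε] with t ht
  exact Metric.isOpen_ball.is_const_of_deriv_eq_zero (convex_ball (0 : ℂ) ε).isPreconnected
    (fun t ht => (hεs t ht).1.differentiableAt.differentiableWithinAt)
    (fun t ht => (hεs t ht).2) ht (Metric.mem_ball_self hε)

/-- The Jacobian determinant of `(φ, y₁, …, yₖ)`, along a curve in a fibre of `y`, is the derivative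
of `φ`, up to a factor independent of `φ`. -/
theorem IsSlice.exists_curve (h : IsSlice m g s T) {z : Cn (k + 1)} (hz : z ∈ T)
    {y : Fin k → B → ℂ} (hy : ∀ i, HolAt (y i) (g z))
    (hsurj : Function.Surjective (fderiv ℂ (jointMap y g) z)) :
    ∃ (γ : ℂ → Cn (k + 1)) (u : ℂ → ℂ), γ 0 = z ∧ AnalyticAt ℂ γ 0 ∧ AnalyticAt ℂ u 0 ∧
      (¬ ∀ᶠ t in 𝓝 (0 : ℂ), γ t = z) ∧
      ∀ φ : B → ℂ, HolAt φ (g z) → ∀ᶠ t in 𝓝 (0 : ℂ),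
        deriv (φ ∘ g ∘ γ) t = u t * m (Fin.cons φ y : Fin (k + 1) → B → ℂ) (g (γ t)) := by
  set L := fderiv ℂ (jointMap y g) z with hL
  obtain ⟨w, hw, hw0⟩ : ∃ w, L w = 0 ∧ w ≠ 0 := by
    have h1 : ¬ Function.Injective L := fun h1 => by
      have := (LinearEquiv.ofBijective L.toLinearMap ⟨h1, hsurj⟩).finrank_eq
      simp at this
    rw [injective_iff_map_eq_zero] at h1
    push Not at h1
    exact h1
  obtain ⟨l, hl⟩ := SeparatingDual.exists_eq_one (R := ℂ) hw0
  have hsurj' : Function.Surjective (l.prod L) := by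
    rintro ⟨a, c⟩
    obtain ⟨v, hv⟩ := hsurj c
    refine ⟨v + (a - l v) • w, Prod.ext ?_ ?_⟩
    · simp [hl]
    · simp [hv, hw]
  have hinj' : Function.Injective (l.prod L).toLinearMap :=
    (LinearMap.injective_iff_surjective_of_finrank_eq_finrank (by simp [add_comm])).2 hsurj'
  let e' : Cn (k + 1) ≃L[ℂ] ℂ × (Fin k → ℂ) :=
    (LinearEquiv.ofBijective (l.prod L).toLinearMap ⟨hinj', hsurj'⟩).toContinuousLinearEquiv
  have hya := h.analyticAt_jointMap hz hy
  have hder : HasFDerivAt (fun q => (l q, jointMap y g q))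
      (e' : Cn (k + 1) →L[ℂ] ℂ × (Fin k → ℂ)) z := by
    refine (l.hasFDerivAt.prodMk hya.differentiableAt.hasFDerivAt).congr_fderiv ?_
    ext1 v
    rfl
  have hO : {z | z ∈ T ∧ ∀ i, HolAt (y i) (g z)} ∈ 𝓝 z := by
    filter_upwards [h.isOpen.mem_nhds hz,
      (h.continuousAt hz).eventually (eventually_all.2 fun i => (hy i).eventually)] with z' h1 h2
    exact ⟨h1, h2⟩
  obtain ⟨Φ, hzΦ, hΦO, hΦ, -, hΦs⟩ :=
    ((l.analyticAt z).prod hya).exists_openPartialHomeomorph e' hder hO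
  let ℓ : ℂ → ℂ × (Fin k → ℂ) := fun t => Φ z + t • (1, 0)
  have hℓ : ∀ t, HasDerivAt ℓ (1, 0) t := fun t => by
    have h1 := ((hasDerivAt_id t).smul_const ((1 : ℂ), (0 : Fin k → ℂ))).const_add (Φ z)
    rw [one_smul] at h1
    exact h1
  have hℓa : AnalyticAt ℂ ℓ 0 := analyticAt_const.add (analyticAt_id.smul analyticAt_const)
  have hℓ0 : ℓ 0 = Φ z := by
    change Φ z + (0 : ℂ) • _ = _
    rw [zero_smul, add_zero]
  have hT : ∀ᶠ t in 𝓝 (0 : ℂ), ℓ t ∈ Φ.target := by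
    refine (hℓ 0).continuousAt.preimage_mem_nhds (Φ.open_target.mem_nhds ?_)
    rw [hℓ0]
    exact Φ.map_source hzΦ
  let γ : ℂ → Cn (k + 1) := fun t => Φ.symm (ℓ t)
  have hγ0 : γ 0 = z := by
    change Φ.symm (ℓ 0) = z
    rw [hℓ0, Φ.left_inv hzΦ]
  have hγa : AnalyticAt ℂ γ 0 := (hΦs _ hT.self_of_nhds).comp hℓa
  -- a frame along the curve, dual to the coordinates given by `y`
  let fr : Fin (k + 1) → ℂ × (Fin k → ℂ) :=
    Fin.cons (1, 0) fun j => (0, Pi.single j 1)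
  let V : ℂ → Matrix (Fin (k + 1)) (Fin (k + 1)) ℂ := fun t =>
    Matrix.of fun a j => (fderiv ℂ Φ.symm (ℓ t) (fr j)) a
  have hVa : AnalyticAt ℂ (fun t => (V t).det) 0 := by
    simp only [Matrix.det_apply']
    refine Finset.analyticAt_fun_sum _ fun π _ => AnalyticAt.fun_mul analyticAt_const
      (Finset.analyticAt_fun_prod _ fun i _ => ?_)
    have h1 : AnalyticAt ℂ (fun t => fderiv ℂ Φ.symm (ℓ t)) 0 :=
      (hΦs _ hT.self_of_nhds).fderiv.comp hℓa
    exact ((EuclideanSpace.proj (𝕜 := ℂ) (π i)).analyticAt _).comp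
      (((ContinuousLinearMap.apply ℂ (Cn (k + 1)) (fr i)).analyticAt _).comp h1)
  refine ⟨γ, fun t => s (γ t) * (V t).det, hγ0, hγa, AnalyticAt.fun_mul
    ((h.analyticAt_density z hz).comp_of_eq hγa hγ0) hVa, fun hcon => ?_, fun φ hφ => ?_⟩
  · obtain ⟨t, ⟨h1, h2⟩, ht0⟩ := ((hcon.and hT).filter_mono nhdsWithin_le_nhds).and
      (self_mem_nhdsWithin (a := (0 : ℂ)) (s := {0}ᶜ)) |>.exists
    have h3 : ℓ t = Φ z := by rw [← h1, Φ.right_inv h2]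
    have h4 := congrArg Prod.fst (add_eq_left.1 h3)
    exact ht0 (by simpa using h4)
  · have hφ' : ∀ᶠ t in 𝓝 (0 : ℂ), HolAt φ (g (γ t)) := by
      have h1 := hγa.continuousAt
      rw [ContinuousAt, hγ0] at h1
      exact h1.eventually ((h.continuousAt hz).eventually hφ.eventually)
    filter_upwards [hT, hφ'] with t ht hφt
    have hγt : γ t ∈ T ∧ ∀ i, HolAt (y i) (g (γ t)) := hΦO (Φ.map_target ht)
    have hc : ∀ i, HolAt ((Fin.cons φ y : Fin (k + 1) → B → ℂ) i) (g (γ t)) :=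
      Fin.cases hφt hγt.2
    rw [mul_right_comm, h.jac _ hγt.1 _ hc, ← Matrix.det_mul]
    have hsd := (hΦs _ ht).differentiableAt.hasFDerivAt
    have hprod : ∀ i j, ((Matrix.of fun i j => fderiv ℂ ((Fin.cons φ y : Fin (k + 1) → B → ℂ) i ∘ g)
        (γ t) (EuclideanSpace.single j 1)) * V t) i j =
        fderiv ℂ ((Fin.cons φ y : Fin (k + 1) → B → ℂ) i ∘ g) (γ t)
          (fderiv ℂ Φ.symm (ℓ t) (fr j)) := by
      intro i j
      have h3 : fderiv ℂ Φ.symm (ℓ t) (fr j) = ∑ a,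
          (fderiv ℂ Φ.symm (ℓ t) (fr j)) a • EuclideanSpace.single a (1 : ℂ) := by
        ext a
        simp [Pi.single_apply]
      conv_rhs => rw [h3]
      rw [map_sum, Matrix.mul_apply]
      refine Finset.sum_congr rfl fun a _ => ?_
      rw [map_smul, smul_eq_mul, mul_comm]
      rfl
    have hdual : ∀ (i : Fin k) (v : ℂ × (Fin k → ℂ)),
        fderiv ℂ (y i ∘ g) (γ t) (fderiv ℂ Φ.symm (ℓ t) v) = v.2 i := by
      intro i v
      have h1 := (h.analyticAt (γ t) hγt.1 _ (hγt.2 i)).differentiableAt.hasFDerivAt.comp (ℓ t) hsd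
      have h2 : (y i ∘ g) ∘ Φ.symm =ᶠ[𝓝 (ℓ t)] fun q => q.2 i := by
        filter_upwards [Φ.open_target.mem_nhds ht] with q hq
        have h3 := Φ.right_inv hq
        rw [hΦ] at h3
        exact congrFun (congrArg Prod.snd h3) i
      have h4 := (((ContinuousLinearMap.proj (R := ℂ) (φ := fun _ : Fin k => ℂ) i).comp
        (ContinuousLinearMap.snd ℂ ℂ (Fin k → ℂ))).hasFDerivAt (x := ℓ t)).congr_of_eventuallyEq h2
      exact DFunLike.congr_fun (h1.unique h4) v
    have hφd : deriv (φ ∘ g ∘ γ) t = fderiv ℂ (φ ∘ g) (γ t) (fderiv ℂ Φ.symm (ℓ t) (1, 0)) :=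
      ((h.analyticAt (γ t) hγt.1 _ hφt).differentiableAt.hasFDerivAt.comp_hasDerivAt t
        (hsd.comp_hasDerivAt t (hℓ t))).deriv
    rw [Matrix.det_succ_column_zero, Fin.sum_univ_succ]
    have hzero : ∀ i : Fin k, ((Matrix.of fun i j => fderiv ℂ
        ((Fin.cons φ y : Fin (k + 1) → B → ℂ) i ∘ g) (γ t) (EuclideanSpace.single j 1)) * V t)
          i.succ 0 = 0 := by
      intro i
      rw [hprod]
      exact hdual i (1, 0)
    rw [Finset.sum_eq_zero fun i _ => by rw [hzero, mul_zero, zero_mul], add_zero, hprod]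
    have hone : (((Matrix.of fun i j => fderiv ℂ ((Fin.cons φ y : Fin (k + 1) → B → ℂ) i ∘ g)
        (γ t) (EuclideanSpace.single j 1)) * V t).submatrix (Fin.succAbove 0) Fin.succ) = 1 := by
      ext i j
      rw [Matrix.submatrix_apply, hprod, Fin.succAbove_zero]
      refine (hdual i (fr j.succ)).trans ?_
      simp [fr, Matrix.one_apply, Pi.single_apply]
    rw [hone, Matrix.det_one, hφd]
    simp [fr]

/-- At a point of the degeneracy locus, no `n - 1` holomorphic functions are independent: along a curve
in their common fibre all holomorphic functions would be constant, because their derivatives are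
Jacobian determinants, which vanish at the point, as do the derivatives of these, and so on. That
the Jacobian determinants are themselves holomorphic on the base is what makes the argument work. -/
theorem IsSlice.not_surjective_fderiv (h : IsSlice m g s T)
    (hm : ∀ b y, (∀ i, HolAt (y i) b) → HolAt (m y) b) {z : Cn (k + 1)} (hz : z ∈ T)
    (hK : g z ∈ degeneracyLocus m) {y : Fin k → B → ℂ} (hy : ∀ i, HolAt (y i) (g z)) :
    ¬ Function.Surjective (fderiv ℂ (jointMap y g) z) := by
  intro hsurj
  obtain ⟨γ, u, hγ0, hγ, hu, hγc, hder⟩ := h.exists_curve hz hy hsurj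
  have hana : ∀ φ, HolAt φ (g z) → AnalyticAt ℂ (φ ∘ g ∘ γ) 0 := fun φ hφ =>
    (h.analyticAt z hz φ hφ).comp_of_eq hγ hγ0
  have hconst : ∀ φ, HolAt φ (g z) → ∀ᶠ t in 𝓝 (0 : ℂ), φ (g (γ t)) = φ (g z) := by
    intro φ hφ
    let ψ : ℕ → B → ℂ := fun j => (fun φ => m (Fin.cons φ y : Fin (k + 1) → B → ℂ))^[j] φ
    have hψs : ∀ j, ψ (j + 1) = m (Fin.cons (ψ j) y : Fin (k + 1) → B → ℂ) := fun j => by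
      simp only [ψ, Function.iterate_succ_apply']
    have hcons : ∀ φ, HolAt φ (g z) →
        ∀ i, HolAt ((Fin.cons φ y : Fin (k + 1) → B → ℂ) i) (g z) := fun φ hφ => Fin.cases hφ hy
    have hψ : ∀ j, HolAt (ψ j) (g z) := by
      intro j
      induction j with
      | zero => exact hφ
      | succ j ih =>
        rw [hψs]
        exact hm _ _ (hcons _ ih)
    have h1 := eventually_eq_zero_of_deriv_chain (a := fun j => ψ (j + 1) ∘ g ∘ γ) (s := u)
      (fun j => hana _ (hψ (j + 1))) hu (fun j => by
        filter_upwards [hder _ (hψ (j + 1))] with t ht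
        rw [ht, ← hψs]
        rfl) (fun j => by
        simp only [Function.comp_apply, hγ0, hψs j]
        exact hK _ (hcons _ (hψ j)))
    have h2 := eventually_eq_of_deriv_eq_zero (hana φ hφ) (by
      filter_upwards [hder φ hφ, h1] with t h3 h4
      rw [h3]
      have h5 : m (Fin.cons φ y : Fin (k + 1) → B → ℂ) (g (γ t)) = 0 := by
        have := hψs 0
        rw [show ψ 0 = φ from rfl] at this
        rw [← this]
        exact h4
      rw [h5, mul_zero])
    filter_upwards [h2] with t ht
    simpa [hγ0] using ht
  obtain ⟨N, U, χ, hU, hb, hinj, -, hχ, -⟩ := exists_local_embedding (g z)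
  have hgγ : Tendsto (fun t => g (γ t)) (𝓝 0) (𝓝 (g z)) := by
    have h1 := hγ.continuousAt
    rw [ContinuousAt, hγ0] at h1
    exact (h.continuousAt hz).tendsto.comp h1
  have hγt : Tendsto γ (𝓝 0) (𝓝 z) := by
    have h1 := hγ.continuousAt
    rwa [ContinuousAt, hγ0] at h1
  refine hγc ?_
  filter_upwards [eventually_all.2 fun i => hconst _ (hχ _ hb i),
    hgγ.eventually (hU.mem_nhds hb), hγt.eventually (h.eventually_eq z hz)] with t h1 h2 h3
  refine h3 (hinj h2 hb ?_)
  ext i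
  exact h1 i

end Core

/-! ### The dimension of the degeneracy locus -/

section DegeneracyDimension

variable {k : ℕ} {B : Type*} [TopologicalSpace B] [ReducedComplexSpace B]
variable {m : (Fin (k + 1) → B → ℂ) → B → ℂ} {g : Cn (k + 1) → B} {s : Cn (k + 1) → ℂ}
  {T : Set (Cn (k + 1))}

/-- The image of the degeneracy locus under `n - 1` holomorphic functions is a null set, by Sard's
theorem, because their differentials are dependent along it. -/
theorem HasSlices.volume_image_degeneracyLocus (H : HasSlices m)
    (hm : ∀ b y, (∀ i, HolAt (y i) b) → HolAt (m y) b) (h : IsSlice m g s T)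
    {O : Set (Cn (k + 1))} (hOT : O ⊆ T) {y : Fin k → B → ℂ}
    (hy : ∀ z ∈ O, ∀ i, HolAt (y i) (g z)) :
    MeasureTheory.volume (jointMap y g '' (g ⁻¹' degeneracyLocus m ∩ O)) = 0 := by
  refine volume_image_eq_zero_of_locally fun q hq => ?_
  have hqT := hOT hq.2
  obtain ⟨N, U, χ, hU, hb, -, -, hχ, hiff⟩ := exists_local_embedding (g q)
  have hgU : ∀ᶠ z in 𝓝 q, g z ∈ U := (h.continuousAt hqT).eventually (hU.mem_nhds hb)
  obtain ⟨I, hI⟩ : ∃ I : Fin (k + 1) → Fin N,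
      ¬ ∀ᶠ z in 𝓝 q, (m (fun i x => χ x (I i)) ∘ g) z = 0 := by
    by_contra! hall
    refine H.degeneracyLocus_notMem_nhds (g q) ?_
    rw [← h.map_nhds q hqT]
    change g ⁻¹' degeneracyLocus m ∈ 𝓝 q
    filter_upwards [eventually_all.2 hall, hgU] with z h1 h2
    exact (H.mem_degeneracyLocus_iff (hχ _ h2) (hiff _ h2)).2 h1
  refine (h.analyticAt_jac hqT fun i => hχ _ hb (I i)).exists_volume_image_eq_zero (m := k) (by simp)
    hI (h.analyticAt_jointMap hqT (hy q hq.2)) ?_ ?_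
  · filter_upwards [hgU] with z h1 h2
    exact h2.1 _ fun i => hχ _ h1 _
  · exact Eventually.of_forall fun z hz =>
      h.not_surjective_fderiv hm (hOT hz.2) hz.1 (hy z hz.2)

/-- Regular points do not lie on the degeneracy locus: there it would be a hypersurface, so that some
`n - 1` holomorphic functions would map it onto an open set and not to a null set. -/
theorem HasSlices.notMem_degeneracyLocus (H : HasSlices m)
    (hm : ∀ b y, (∀ i, HolAt (y i) b) → HolAt (m y) b) {b : B}
    (hb : b ∈ regularLocus (k + 1) B) : b ∉ degeneracyLocus m := by
  intro hK
  obtain ⟨e, he, hbe⟩ := hb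
  obtain ⟨g, s, T, h, h0T, rfl⟩ := H b
  have hF : AnalyticAt ℂ (m (fun i x => e x i) ∘ e.symm) (e (g 0)) :=
    (he _ hbe _).1 (hm _ _ fun i => he.holAt_coord hbe i)
  obtain ⟨l, hl⟩ := hF.exists_projection_zeros (d := k) (by simp) (by
      rw [Function.comp_apply, e.left_inv hbe]
      exact hK _ fun i => he.holAt_coord hbe i) (fun h0 => by
      refine H.degeneracyLocus_notMem_nhds (g 0) ?_
      filter_upwards [(e.continuousAt hbe).eventually h0, e.open_source.mem_nhds hbe] with x h1 h2
      rw [Function.comp_apply, e.left_inv h2] at h1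
      exact (H.mem_degeneracyLocus_iff_chart he h2).2 h1)
  let y : Fin k → B → ℂ := fun i x => l (e x) i
  have hy : ∀ x ∈ e.source, ∀ i, HolAt (y i) x := fun x hx i =>
    HolAt.clm_comp (y := fun j x => e x j) (fun j => he.holAt_coord hx j)
      (((ContinuousLinearMap.proj (R := ℂ) (φ := fun _ : Fin k => ℂ) i).comp l).comp
        ((PiLp.continuousLinearEquiv 2 ℂ (fun _ : Fin (k + 1) => ℂ)).symm :
          (Fin (k + 1) → ℂ) →L[ℂ] PiLp 2 (fun _ : Fin (k + 1) => ℂ)))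
  let O : Set (Cn (k + 1)) := {z | z ∈ T ∧ g z ∈ e.source}
  have hO : O ∈ 𝓝 0 := by
    filter_upwards [h.isOpen.mem_nhds h0T,
      (h.continuousAt h0T).eventually (e.open_source.mem_nhds hbe)] with z h1 h2 using ⟨h1, h2⟩
  have hnull := H.volume_image_degeneracyLocus hm h (O := O) (fun z hz => hz.1) (y := y)
    fun z hz => hy _ hz.2
  have hgO : ∀ᶠ q in 𝓝 (e (g 0)), e.symm q ∈ g '' O := by
    refine (e.continuousAt_symm (e.map_source hbe)).preimage_mem_nhds ?_
    rw [e.left_inv hbe, ← h.map_nhds 0 h0T]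
    exact image_mem_map hO
  refine (MeasureTheory.Measure.measure_pos_of_mem_nhds MeasureTheory.volume (hl _
    (inter_mem hgO (e.open_target.mem_nhds (e.map_source hbe))))).ne'
    (MeasureTheory.measure_mono_null ?_ hnull)
  rintro _ ⟨q, ⟨hq0, ⟨z, hz, hzq⟩, hqt⟩, rfl⟩
  refine ⟨z, ⟨(H.mem_degeneracyLocus_iff_chart he hz.2).2 ?_, hz⟩, ?_⟩
  · rw [hzq]
    exact hq0
  · funext i
    change l (e (g z)) i = l q i
    rw [hzq, e.right_inv hqt]

/-- The degeneracy locus has codimension at least two: a finite projection maps it onto an open subset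
of some `ℂʲ`, and `j ≥ n - 1` is impossible because images in `ℂⁿ⁻¹` are null sets. -/
theorem HasSlices.exists_isolating (H : HasSlices m)
    (hm : ∀ b y, (∀ i, HolAt (y i) b) → HolAt (m y) b) {b : B}
    (hdim : localDim (univ : Set B) b = k + 1) (hb : b ∈ degeneracyLocus m) :
    ∃ j < k, ∃ v : Fin j → B → ℂ, (∀ i, HolAt (v i) b ∧ v i b = 0) ∧
      ∀ᶠ x in 𝓝 b, x ∈ degeneracyLocus m → (∀ i, v i x = 0) → x = b := by
  obtain ⟨u, hu, hub⟩ : ∃ u : Fin (k + 1) → B → ℂ, (∀ i, HolAt (u i) b ∧ u i b = 0) ∧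
      ∀ᶠ x in 𝓝 b, x ∈ (univ : Set B) → (∀ i, u i x = 0) → x = b := by
    have h1 : localDim (univ : Set B) b ∈ _ := Nat.sInf_mem (Nat.nonempty_of_pos_sInf (by
      change 0 < localDim (univ : Set B) b
      omega))
    rw [hdim] at h1
    exact h1
  obtain ⟨g, s, T, h, h0T, rfl⟩ := H b
  set U := jointMap u g with hUdef
  have hU0 : U 0 = 0 := funext fun i => (hu i).2
  have hUa : AnalyticAt ℂ U 0 := h.analyticAt_jointMap h0T fun i => (hu i).1
  have hiso : ∀ᶠ z in 𝓝 (0 : Cn (k + 1)), U z = U 0 → z = 0 := by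
    filter_upwards [(h.continuousAt h0T).eventually hub, h.eventually_eq 0 h0T] with z h1 h2 h3
    rw [hU0] at h3
    exact h2 (h1 (mem_univ _) fun i => congrFun h3 i)
  have hA : IsAnalyticGermAt (g ⁻¹' degeneracyLocus m) (0 : Cn (k + 1)) := by
    obtain ⟨N, W, χ, hW, hbW, -, -, hχ, hiff⟩ := exists_local_embedding (g 0)
    refine .of_fintype (ι := Fin (k + 1) → Fin N) (g := fun I => m (fun i x => χ x (I i)) ∘ g)
      (fun I => h.analyticAt_jac h0T fun i => hχ _ hbW _) ?_
    filter_upwards [(h.continuousAt h0T).eventually (hW.mem_nhds hbW)] with z hz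
    exact H.mem_degeneracyLocus_iff (hχ _ hz) (hiff _ hz)
  let O : Set (Cn (k + 1)) := {z | z ∈ T ∧ ∀ i, HolAt (u i) (g z)}
  have hO : O ∈ 𝓝 0 := by
    filter_upwards [h.isOpen.mem_nhds h0T, (h.continuousAt h0T).eventually
      (eventually_all.2 fun i => (hu i).1.eventually)] with z h1 h2 using ⟨h1, h2⟩
  obtain ⟨O', hO', hO'O, hS⟩ := hA.exists_image hUa hiso hO
  rw [hU0] at hS
  obtain ⟨j, l, hl0, hl, -⟩ := hS.exists_finite_projection (k + 1)
    ⟨0, ⟨hb, mem_of_mem_nhds hO'⟩, hU0⟩ univ_mem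
  refine ⟨j, ?_, fun i x => l (fun a => u a x) i, fun i => ⟨?_, ?_⟩, ?_⟩
  · by_contra! hkj
    let π : (Fin j → ℂ) →L[ℂ] (Fin k → ℂ) := ContinuousLinearMap.pi fun i =>
      ContinuousLinearMap.proj (R := ℂ) (φ := fun _ : Fin j => ℂ) (Fin.castLE hkj i)
    have hπ : Function.Surjective π := by
      intro c
      refine ⟨fun i => if hi : (i : ℕ) < k then c ⟨i, hi⟩ else 0, ?_⟩
      funext i
      simp [π]
    have h1 := (π.isOpenMap hπ).image_mem_nhds hl
    have hnull := H.volume_image_degeneracyLocus hm h (O := O) (fun z hz => hz.1)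
      (y := fun i x => π (l fun a => u a x) i) fun z hz i =>
        HolAt.clm_comp hz.2 ((ContinuousLinearMap.proj (R := ℂ) (φ := fun _ : Fin k => ℂ) i).comp
          (π.comp l))
    refine (MeasureTheory.Measure.measure_pos_of_mem_nhds MeasureTheory.volume h1).ne'
      (MeasureTheory.measure_mono_null ?_ hnull)
    rintro _ ⟨_, ⟨_, ⟨⟨z, hz, rfl⟩, -⟩, rfl⟩, rfl⟩
    exact ⟨z, ⟨hz.1, hO'O hz.2⟩, rfl⟩
  · exact HolAt.clm_comp (fun a => (hu a).1)
      ((ContinuousLinearMap.proj (R := ℂ) (φ := fun _ : Fin j => ℂ) i).comp l)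
  · have h1 : (fun a => u a (g 0)) = 0 := hU0
    change l (fun a => u a (g 0)) i = 0
    rw [h1, map_zero]
    rfl
  · have h1 : Tendsto (fun x a => u a x) (𝓝 (g 0)) (𝓝 (0 : Fin (k + 1) → ℂ)) := by
      rw [← hU0]
      exact tendsto_pi_nhds.2 fun a => (hu a).1.continuousAt
    have h2 : g '' O' ∈ 𝓝 (g 0) := by
      rw [← h.map_nhds 0 h0T]
      exact image_mem_map hO'
    filter_upwards [h1.eventually hl0, hub, h2] with x h3 h4 h5 h6 h7
    obtain ⟨z, hz, rfl⟩ := h5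
    exact h4 (mem_univ _) fun a => congrFun (h3 ⟨z, ⟨h6, hz⟩, rfl⟩ (funext h7)) a

theorem HasSlices.isAnalyticSet_degeneracyLocus (H : HasSlices m)
    (hm : ∀ b y, (∀ i, HolAt (y i) b) → HolAt (m y) b) :
    IsAnalyticSet (degeneracyLocus m) := by
  intro b
  obtain ⟨N, W, χ, hW, hbW, -, -, hχ, hiff⟩ := exists_local_embedding b
  let ι := Fintype.equivFin (Fin (k + 1) → Fin N)
  refine ⟨_, fun a => m fun i x => χ x (ι.symm a i), fun a => hm _ _ fun i => hχ _ hbW _, ?_⟩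
  filter_upwards [hW.mem_nhds hbW] with x hx
  rw [H.mem_degeneracyLocus_iff (hχ _ hx) (hiff _ hx)]
  exact ι.symm.surjective.forall

theorem HasSlices.localDim_degeneracyLocus (H : HasSlices m)
    (hm : ∀ b y, (∀ i, HolAt (y i) b) → HolAt (m y) b) {b : B}
    (hdim : localDim (univ : Set B) b = k + 1) (hb : b ∈ degeneracyLocus m) :
    localDim (degeneracyLocus m) b + 2 ≤ k + 1 := by
  obtain ⟨j, hj, v, hv⟩ := H.exists_isolating hm hdim hb
  have : localDim (degeneracyLocus m) b ≤ j := Nat.sInf_le ⟨v, hv⟩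
  omega

end DegeneracyDimension

/-! ### Prime divisors and the degeneracy locus -/

section PrimeDivisors

variable {k : ℕ} {B : Type*} [TopologicalSpace B] [ReducedComplexSpace B]
variable {m : (Fin (k + 1) → B → ℂ) → B → ℂ} {g : Cn (k + 1) → B} {s : Cn (k + 1) → ℂ}
  {T : Set (Cn (k + 1))}

theorem localDim_eq_of_mem_nhds {Z : Set B} {b : B} (hZ : Z ∈ 𝓝 b) :
    localDim Z b = localDim (univ : Set B) b := by
  unfold localDim
  congr 1
  ext j
  refine exists_congr fun u => and_congr_right fun _ => ⟨fun h => ?_, fun h => ?_⟩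
  · filter_upwards [h, hZ] with x h1 h2 _ using h1 h2
  · filter_upwards [h] with x h1 _ using h1 (mem_univ _)

/-- A prime divisor has no interior points. -/
theorem ReducedComplexSpace.IsPrimeDivisor.notMem_nhds {E : Set B} (hE : IsPrimeDivisor (k + 1) E)
    (hdim : IsPureDim (k + 1) B) {b : B} (hb : b ∈ E) : E ∉ 𝓝 b := by
  intro h
  have h1 := hE.2.2.1 b hb
  rw [localDim_eq_of_mem_nhds h, hdim b] at h1
  omega

/-- The degeneracy locus contains no prime divisor, for reasons of dimension. -/
theorem HasSlices.exists_mem_notMem_degeneracyLocus (H : HasSlices m)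
    (hm : ∀ b y, (∀ i, HolAt (y i) b) → HolAt (m y) b) (hdim : IsPureDim (k + 1) B) {E : Set B}
    (hE : IsPrimeDivisor (k + 1) E) : ∃ b ∈ E, b ∉ degeneracyLocus m := by
  by_contra! hEK
  obtain ⟨b, hb⟩ := hE.1
  obtain ⟨j, hj, v, hv, hvi⟩ := H.exists_isolating hm (hdim b) (hEK b hb)
  have h1 : localDim E b ≤ j := Nat.sInf_le ⟨v, hv, by
    filter_upwards [hvi] with x hx hxE using hx (hEK x hxE)⟩
  have h2 := hE.2.2.1 b hb
  omega

/-- A prime divisor is, near some of its points, the zero set of a holomorphic function with nonzero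
differential. It is contained in such a smooth hypersurface near some point; if it were a proper
subset, it would have smaller dimension. -/
theorem IsSlice.exists_smooth_divisor (h : IsSlice m g s T) (hdim : IsPureDim (k + 1) B)
    {E : Set B} (hE : IsPrimeDivisor (k + 1) E) {e : OpenPartialHomeomorph B (Cn (k + 1))}
    (he : IsChart e) (heT : e.target ⊆ T) (heg : (e.symm : Cn (k + 1) → B) = g)
    {z : Cn (k + 1)} (hz : z ∈ e.target) (hzE : g z ∈ E) :
    ∃ p ∈ e.target, g p ∈ E ∧ ∃ (u : Cn (k + 1) → ℂ) (v : Cn (k + 1)), AnalyticAt ℂ u p ∧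
      fderiv ℂ u p v ≠ 0 ∧ ∀ᶠ q in 𝓝 p, (g q ∈ E ↔ u q = 0) := by
  have heg' : ∀ q ∈ e.target, g q ∈ e.source ∧ e (g q) = q := fun q hq => by
    rw [← heg]
    exact ⟨e.map_target hq, e.right_inv hq⟩
  -- `E` is contained in a smooth hypersurface near some point
  obtain ⟨p, ⟨hpE, hpt⟩, u, v, hu, huv, huE⟩ : ∃ p ∈ (g ⁻¹' E) ∩ e.target,
      ∃ (u : Cn (k + 1) → ℂ) (v : Cn (k + 1)), AnalyticAt ℂ u p ∧ fderiv ℂ u p v ≠ 0 ∧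
        ∀ᶠ q in 𝓝 p, q ∈ g ⁻¹' E → u q = 0 := by
    obtain ⟨r, φ, hφ, hφE⟩ := hE.2.1 (g z)
    have hgE := (h.continuousAt (heT hz)).eventually hφE
    obtain ⟨i, hi⟩ : ∃ i, ¬ ∀ᶠ q in 𝓝 z, (φ i ∘ g) q = 0 := by
      by_contra! hall
      refine hE.notMem_nhds hdim hzE ?_
      rw [← h.map_nhds z (heT hz)]
      change g ⁻¹' E ∈ 𝓝 z
      filter_upwards [hgE, eventually_all.2 hall] with q h1 h2 using h1.2 h2
    exact (h.analyticAt z (heT hz) _ (hφ i)).exists_smooth_hypersurface hi hzE (by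
      filter_upwards [hgE] with q h1 h2 using h1.1 h2 i) (e.open_target.mem_nhds hz)
  refine ⟨p, hpt, hpE, u, v, hu, huv, ?_⟩
  have hup : u p = 0 := huE.self_of_nhds hpE
  obtain ⟨Φ, hpΦ, -, hΦu, hΦa, hΦs⟩ := hu.exists_straighten (m := k) (by simp) huv univ_mem
  have hΦp : Φ p = ((Φ p).1, 0) := Prod.ext rfl ((hΦu p).trans hup)
  -- the part of the hypersurface that belongs to `E`, in coordinates of the hypersurface
  let ι : (Fin k → ℂ) → (Fin k → ℂ) × ℂ := fun a => ((Φ p).1 + a, 0)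
  have hι0 : ι 0 = Φ p := by
    rw [hΦp]
    simp [ι]
  have hιa : AnalyticAt ℂ ι 0 := (analyticAt_const.add analyticAt_id).prod analyticAt_const
  have hψa : AnalyticAt ℂ (fun a => Φ.symm (ι a)) 0 :=
    (hΦs _ (Φ.map_source hpΦ)).comp_of_eq hιa hι0
  have hψ0 : Φ.symm (ι 0) = p := by rw [hι0, Φ.left_inv hpΦ]
  have hψc : Tendsto (fun a => Φ.symm (ι a)) (𝓝 0) (𝓝 p) := by
    have h1 := hψa.continuousAt.tendsto
    rwa [hψ0] at h1
  let S : Set (Fin k → ℂ) := {a | g (Φ.symm (ι a)) ∈ E}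
  have hS : IsAnalyticGermAt S 0 := by
    obtain ⟨r, φ, hφ, hφE⟩ := hE.2.1 (g p)
    refine .of_fintype (g := fun i a => (φ i ∘ g) (Φ.symm (ι a))) (fun i => ?_) ?_
    · exact (h.analyticAt p (heT hpt) _ (hφ i)).comp_of_eq hψa hψ0
    · exact hψc.eventually ((h.continuousAt (heT hpt)).eventually hφE)
  have h0S : (0 : Fin k → ℂ) ∈ S := by
    change g (Φ.symm (ι 0)) ∈ E
    rwa [hψ0]
  have hq : ∀ q ∈ Φ.source, u q = 0 → Φ.symm (ι ((Φ q).1 - (Φ p).1)) = q := by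
    intro q hq hq0
    have h1 : ι ((Φ q).1 - (Φ p).1) = Φ q := by
      refine Prod.ext ?_ ?_
      · simp [ι]
      · exact ((hΦu q).trans hq0).symm
    rw [h1, Φ.left_inv hq]
  have hdiff : ContinuousAt (fun q => (Φ q).1 - (Φ p).1) p :=
    (continuous_fst.continuousAt.comp (Φ.continuousAt hpΦ)).sub continuousAt_const
  have hS1 : S ∈ 𝓝 0 := by
    by_contra hSn
    obtain ⟨j, l, hl0, -, hj⟩ := hS.exists_finite_projection k h0S univ_mem
    have hjk := hj hSn
    have hle : localDim E (g p) ≤ j := by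
      refine Nat.sInf_le ⟨fun i x => l ((Φ (e x)).1 - (Φ p).1) i, fun i => ⟨?_, ?_⟩, ?_⟩
      · rw [he _ (heg' p hpt).1, (heg' p hpt).2, heg]
        have h1 : AnalyticAt ℂ (fun q => l ((Φ q).1 - (Φ p).1) i) p :=
          (((ContinuousLinearMap.proj (R := ℂ) (φ := fun _ : Fin j => ℂ) i).comp l).analyticAt
            _).comp ((analyticAt_fst.comp (hΦa p hpΦ)).sub analyticAt_const)
        refine h1.congr ?_
        filter_upwards [e.open_target.mem_nhds hpt] with q hq
        simp [(heg' q hq).2]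
      · simp [(heg' p hpt).2]
      · have hec : Tendsto e (𝓝 (g p)) (𝓝 p) := by
          have h1 := (e.continuousAt (heg' p hpt).1).tendsto
          rwa [(heg' p hpt).2] at h1
        have hd : Tendsto (fun q => (Φ q).1 - (Φ p).1) (𝓝 p) (𝓝 0) := by
          simpa using hdiff.tendsto
        filter_upwards [hec.eventually (hd.eventually hl0),
          hec.eventually (Φ.open_source.mem_nhds hpΦ), hec.eventually huE,
          e.open_source.mem_nhds (heg' p hpt).1] with x h1 h2 h3 h4 h5 h6
        have h7 : g (e x) = x := by rw [← heg, e.left_inv h4]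
        have h8 : u (e x) = 0 := h3 (by rwa [mem_preimage, h7])
        have h9 := hq _ h2 h8
        have h10 := h1 (by
          change g (Φ.symm (ι _)) ∈ E
          rwa [h9, h7]) (funext h6)
        rw [h10, hψ0] at h9
        rw [h9, h7]
    have h1 := hE.2.2.1 (g p) hpE
    omega
  have hd : Tendsto (fun q => (Φ q).1 - (Φ p).1) (𝓝 p) (𝓝 0) := by
    simpa using hdiff.tendsto
  filter_upwards [huE, Φ.open_source.mem_nhds hpΦ, hd.eventually hS1] with q h1 h2 h3
  refine ⟨h1, fun h4 => ?_⟩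
  have h5 : g (Φ.symm (ι ((Φ q).1 - (Φ p).1))) ∈ E := h3
  rwa [hq q h2 h4] at h5

end PrimeDivisors

/-! ### The Jacobian determinant on the base of the fibration -/

section BaseJacobian

variable {n : ℕ} {D B : Type*} [TopologicalSpace D] [ChartedSpace (Cn (n + 1)) D]
  {σ : DForm (n + 1) n D} {e : OpenPartialHomeomorph D (ℂ × Cn n)}
  [TopologicalSpace B] [ReducedComplexSpace B] {f : C(D, B)}

/-- The function on the base whose pull-back is the quotient of `d(y₁ ∘ f) ∧ … ∧ d(yₙ ∘ f)`
by `σ`, which is constant on the fibres: it is evaluated at a chosen point of the fibre. -/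
noncomputable def baseJac (σ : DForm (n + 1) n D) {f : C(D, B)} (hf : Function.Surjective f)
    (y : Fin n → B → ℂ) (b : B) : ℂ :=
  jacQuot σ (fun i => y i ∘ f) (Function.surjInv hf b)

variable [IsManifold 𝓘(ℂ, Cn (n + 1)) ω D]

theorem baseJac_apply (hf : IsUniSmoothFibration n f) (hσ : σ.IsHolomorphic)
    (hσ0 : σ.NowhereVanishing) (hker : IsGivenByKernel n f σ) {y : Fin n → B → ℂ} {x : D}
    (hy : ∀ i, HolAt (y i) (f x)) :
    baseJac σ hf.surjective y (f x) = jacQuot σ (fun i => y i ∘ f) x :=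
  (jacQuot_comp_eq hf hσ hσ0 hker (Function.surjInv_eq hf.surjective (f x)).symm hy).symm

theorem IsFlowBox.baseJac_mul (h : IsFlowBox σ e) (hf : IsUniSmoothFibration n f)
    (hσ : σ.IsHolomorphic) (hσ0 : σ.NowhereVanishing) (hker : IsGivenByKernel n f σ)
    {p : ℂ × Cn n} (hp : p ∈ e.target) {y : Fin n → B → ℂ}
    (hy : ∀ i, HolAt (y i) (f (e.symm p))) :
    σ.param e.symm p (stdFrame n) * baseJac σ hf.surjective y (f (e.symm p)) =
      Matrix.det (Matrix.of fun i j =>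
        fderiv ℂ (y i ∘ boxSlice f e) p.2 (EuclideanSpace.single j 1)) := by
  rw [baseJac_apply hf hσ hσ0 hker hy, mul_comm]
  exact h.jacQuot_comp_mul hσ0 hf hker hp hy

theorem IsFlowBox.isSlice (h : IsFlowBox σ e) (hf : IsUniSmoothFibration n f)
    (hσ : σ.IsHolomorphic) (hσ0 : σ.NowhereVanishing) (hker : IsGivenByKernel n f σ) :
    IsSlice (baseJac σ hf.surjective) (boxSlice f e)
      (fun z => σ.param e.symm (0, z) (stdFrame n)) {z | ((0 : ℂ), z) ∈ e.target} where
  isOpen := e.open_target.preimage (by fun_prop)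
  map_nhds z hz := by
    exact (h.map_nhds_eq hσ0 hf hker hz).symm.trans (hf.map_nhds hσ hσ0 hker _)
  eventually_eq z hz := by
    have h1 := (h.eventually_fibre hσ0 hf hker (e.map_target hz)).1
    rw [e.right_inv hz] at h1
    have h2 : ContinuousAt (fun z : Cn n => ((0 : ℂ), z)) z := by fun_prop
    have h3 : ContinuousAt (fun z => e.symm ((0 : ℂ), z)) z :=
      (e.continuousAt_symm hz).comp_of_eq h2 rfl
    filter_upwards [h3.eventually h1, h2.preimage_mem_nhds (e.open_target.mem_nhds hz)]
      with z' h4 h5 h6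
    have h7 := h4 h6
    rwa [e.right_inv h5] at h7
  analyticAt z hz φ hφ := h.analyticAt_boxSlice hf hz hφ
  analyticAt_density z hz := (h.analyticAt_density hσ hz).comp_of_eq
    (f := fun z : Cn n => ((0 : ℂ), z)) (analyticAt_const.prod analyticAt_id) rfl
  density_ne_zero z hz := h.density_ne_zero hσ0 hz
  jac z hz y hy := h.baseJac_mul hf hσ hσ0 hker hz hy

theorem hasSlices_baseJac (hf : IsUniSmoothFibration n f)
    (hσ : σ.IsHolomorphic) (hσ0 : σ.NowhereVanishing) (hker : IsGivenByKernel n f σ) :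
    HasSlices (baseJac σ hf.surjective) := by
  intro b
  obtain ⟨x, rfl⟩ := hf.surjective b
  obtain ⟨e, he, hxe, hx0⟩ := exists_isFlowBox hσ hσ0 (hker.exists_kernel_vector hf) x
  have h0 : (0 : ℂ × Cn n) ∈ e.target := hx0 ▸ e.map_source hxe
  refine ⟨_, _, _, he.isSlice hf hσ hσ0 hker, h0, ?_⟩
  change f (e.symm 0) = f x
  rw [← hx0, e.left_inv hxe]

end BaseJacobian

/-! ### Derivatives on manifolds -/

section ManifoldDerivatives

variable {E E' : Type*} [NormedAddCommGroup E] [NormedSpace ℂ E] [NormedAddCommGroup E']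
  [NormedSpace ℂ E'] {M M' : Type*} [TopologicalSpace M] [ChartedSpace E M] [TopologicalSpace M']
  [ChartedSpace E' M'] [IsManifold 𝓘(ℂ, E') ω M'] {G : M → M'} {x : M}

/-- The differential of a map is computed in the preferred chart at the image point. -/
theorem mfderiv_eq_mfderiv_chartAt (hG : MDifferentiableAt 𝓘(ℂ, E) 𝓘(ℂ, E') G x) (v : E) :
    mfderiv 𝓘(ℂ, E) 𝓘(ℂ, E') G x v =
      mfderiv 𝓘(ℂ, E) 𝓘(ℂ, E') (chartAt E' (G x) ∘ G) x v := by
  have h1 : MDifferentiableAt 𝓘(ℂ, E') 𝓘(ℂ, E') (chartAt E' (G x)) (G x) :=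
    (contMDiffAt_of_mem_maximalAtlas (n := ω) (IsManifold.chart_mem_maximalAtlas (G x))
      (mem_chart_source _ _)).mdifferentiableAt (by simp)
  rw [hG.mfderiv, (h1.comp x hG).mfderiv]
  rfl

/-- A point of an open submanifold has the same preferred chart in both manifolds, so in these charts
the differential of the inclusion is the identity. -/
theorem mfderiv_opens_val [IsManifold 𝓘(ℂ, E) ω M] {U : Opens M} (x : U) (v : E) :
    mfderiv 𝓘(ℂ, E) 𝓘(ℂ, E) (Subtype.val : U → M) x v = v := by
  have h1 := mfderiv_eq_mfderiv_chartAt (G := (Subtype.val : U → M)) (x := x)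
    ((contMDiff_subtype_val (n := ω) x).mdifferentiableAt (by simp)) v
  have h2 := mfderiv_eq_mfderiv_chartAt (G := (id : U → U)) (x := x) mdifferentiableAt_id v
  rw [mfderiv_id] at h2
  exact h1.trans h2.symm

end ManifoldDerivatives

/-! ### The standard volume form -/

section StandardVolumeForm

/-- The form `dz₁ ∧ … ∧ dzₙ`. -/
noncomputable def detForm (n : ℕ) : Cn n [⋀^Fin n]→L[ℂ] ℂ where
  toMultilinearMap := (Matrix.detRowAlternating.compLinearMap
    (WithLp.linearEquiv 2 ℂ (Fin n → ℂ)).toLinearMap : Cn n [⋀^Fin n]→ₗ[ℂ] ℂ).toMultilinearMap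
  cont := by
    change Continuous fun v : Fin n → Cn n => Matrix.det (Matrix.of fun i j => v i j)
    fun_prop
  map_eq_zero_of_eq' v i j hv hij := (Matrix.detRowAlternating.compLinearMap
    (WithLp.linearEquiv 2 ℂ (Fin n → ℂ)).toLinearMap : Cn n [⋀^Fin n]→ₗ[ℂ] ℂ).map_eq_zero_of_eq v hv hij

theorem detForm_apply {n : ℕ} (v : Fin n → Cn n) :
    detForm n v = Matrix.det (Matrix.of fun i j => v i j) := rfl

theorem detForm_single (n : ℕ) : detForm n (fun i => EuclideanSpace.single i 1) = 1 := by
  rw [detForm_apply]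
  convert Matrix.det_one (n := Fin n) (R := ℂ)
  ext i j
  simp [Matrix.one_apply, eq_comm]

/-- A linear endomorphism multiplies the determinant by its own determinant, which is its value on the
images of the standard basis. -/
theorem detForm_clm {n : ℕ} (L : Cn n →L[ℂ] Cn n) (v : Fin n → Cn n) :
    detForm n (fun i => L (v i)) =
      detForm n (fun i => L (EuclideanSpace.single i 1)) * detForm n v := by
  have h1 := (detForm n).compContinuousLinearMap L |>.toAlternatingMap.eq_smul_basis_det
    (EuclideanSpace.basisFun (Fin n) ℂ).toBasis
  have h2 := (detForm n).toAlternatingMap.eq_smul_basis_det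
    (EuclideanSpace.basisFun (Fin n) ℂ).toBasis
  have h3 := congrArg (fun T => T v) h1
  have h4 := congrArg (fun T => T v) h2
  have h5 : (fun i => (EuclideanSpace.basisFun (Fin n) ℂ).toBasis i) =
      fun i => EuclideanSpace.single i (1 : ℂ) := by
    funext i
    simp
  have h6 : (detForm n) ((EuclideanSpace.basisFun (Fin n) ℂ).toBasis) = 1 := by
    rw [← detForm_single n]
    exact congrArg _ h5
  have h7 : ((detForm n).compContinuousLinearMap L)
      ((EuclideanSpace.basisFun (Fin n) ℂ).toBasis) =
      detForm n (fun i => L (EuclideanSpace.single i 1)) := by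
    rw [ContinuousAlternatingMap.compContinuousLinearMap_apply]
    congr 1
    funext i
    simp
  refine h3.trans ?_
  rw [show (detForm n v) = _ from h4]
  simp only [AlternatingMap.smul_apply, smul_eq_mul]
  erw [h6, h7]
  ring

end StandardVolumeForm

/-! ### The descended form on the regular locus -/

section RegularPart

variable {n : ℕ} {D B : Type*} [TopologicalSpace D] [ChartedSpace (Cn (n + 1)) D]
  {σ : DForm (n + 1) n D}
  [TopologicalSpace B] [ReducedComplexSpace B] {f : C(D, B)}

theorem IsUniSmoothFibration.contMDiffAt_chart_comp (hf : IsUniSmoothFibration n f)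
    {e : OpenPartialHomeomorph B (Cn n)} (he : IsChart e) {x : D} (hx : f x ∈ e.source) :
    ContMDiffAt 𝓘(ℂ, Cn (n + 1)) 𝓘(ℂ, Cn n) ω (e ∘ f) x := by
  have h1 : ContMDiffAt 𝓘(ℂ, Cn (n + 1)) 𝓘(ℂ, Fin n → ℂ) ω (fun x i => e (f x) i) x :=
    contMDiffAt_pi_space.2 fun i => hf.holomorphic x _ (he.holAt_coord hx i)
  exact ((PiLp.continuousLinearEquiv 2 ℂ (fun _ : Fin n => ℂ)).symm.contDiff
    (n := ω)).contMDiff.contMDiffAt.comp x h1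

theorem IsUniSmoothFibration.contMDiff_regMap (hf : IsUniSmoothFibration n f) :
    ContMDiff 𝓘(ℂ, Cn (n + 1)) 𝓘(ℂ, Cn n) ω (regMap n f) := by
  intro x
  rw [contMDiffAt_iff_target]
  refine ⟨(Continuous.subtype_mk (by fun_prop) _).continuousAt, ?_⟩
  exact (hf.contMDiffAt_chart_comp (regMap n f x).2.choose_spec.1
    (regMap n f x).2.choose_spec.2).comp x (contMDiff_subtype_val (n := ω) x)

variable [IsManifold 𝓘(ℂ, Cn (n + 1)) ω D]

/-- The differential of the restriction of `f` over the regular locus, in the preferred chart. -/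
theorem IsUniSmoothFibration.mfderiv_regMap (hf : IsUniSmoothFibration n f) (x : overReg n f)
    (v : Cn (n + 1)) :
    mfderiv 𝓘(ℂ, Cn (n + 1)) 𝓘(ℂ, Cn n) (regMap n f) x v =
      mfderiv 𝓘(ℂ, Cn (n + 1)) 𝓘(ℂ, Cn n) ((regMap n f x).2.choose ∘ f) (x : D) v := by
  rw [mfderiv_eq_mfderiv_chartAt ((hf.contMDiff_regMap x).mdifferentiableAt (by simp)) v]
  have h1 := mfderiv_comp x ((hf.contMDiffAt_chart_comp (regMap n f x).2.choose_spec.1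
    (regMap n f x).2.choose_spec.2).mdifferentiableAt (by simp))
    ((contMDiff_subtype_val (I := 𝓘(ℂ, Cn (n + 1))) (n := ω) x).mdifferentiableAt (by simp))
  have h2 := DFunLike.congr_fun h1 v
  refine Eq.trans h2 ?_
  exact congrArg (mfderiv 𝓘(ℂ, Cn (n + 1)) 𝓘(ℂ, Cn n) ((regMap n f x).2.choose ∘ f) (x : D))
    (mfderiv_opens_val x v)

/-- In a chart of the base, the pull-back of the standard volume form is a multiple of `σ`. -/
theorem detForm_mfderiv (hf : IsUniSmoothFibration n f) (hσ : σ.IsHolomorphic)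
    (hσ0 : σ.NowhereVanishing) (hker : IsGivenByKernel n f σ)
    {e : OpenPartialHomeomorph B (Cn n)} (he : IsChart e) {x : D} (hx : f x ∈ e.source)
    (w : Fin n → Cn (n + 1)) :
    detForm n (fun i => mfderiv 𝓘(ℂ, Cn (n + 1)) 𝓘(ℂ, Cn n) (e ∘ f) x (w i)) =
      baseJac σ hf.surjective (fun i b => e b i) (f x) * σ.val x w := by
  obtain ⟨E, hE, hxE, -⟩ := exists_isFlowBox hσ hσ0 (hker.exists_kernel_vector hf) x
  obtain ⟨p, hp, rfl⟩ : ∃ p ∈ E.target, E.symm p = x := ⟨E x, E.map_source hxE, E.left_inv hxE⟩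
  choose R hR using hE.surjective_paramDeriv hp
  set L : Cn n →L[ℂ] Cn n := fderiv ℂ (e ∘ boxSlice f E) p.2 with hL
  have hbox : f (E.symm p) = boxSlice f E p.2 := hE.apply_eq_boxSlice hσ0 hf hker hp
  have hy : ∀ i, HolAt (fun b => e b i) (f (E.symm p)) := fun i => he.holAt_coord hx i
  have hea : AnalyticAt ℂ (e ∘ boxSlice f E) p.2 := by
    have h1 : AnalyticAt ℂ (fun z i => e (boxSlice f E z) i) p.2 := AnalyticAt.pi fun i =>
      hE.analyticAt_boxSlice hf (φ := fun b => e b i) (hE.zero_mem_target hp) (hbox ▸ hy i)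
    exact ((PiLp.continuousLinearEquiv 2 ℂ (fun _ : Fin n => ℂ)).symm.analyticAt _).comp h1
  have hLi : ∀ z i, L z i = fderiv ℂ ((fun b => e b i) ∘ boxSlice f E) p.2 z := by
    intro z i
    have h1 := ((EuclideanSpace.proj (𝕜 := ℂ) i : Cn n →L[ℂ] ℂ)).hasFDerivAt.comp p.2
      hea.differentiableAt.hasFDerivAt
    rw [show (fun b => e b i) ∘ boxSlice f E =
      (EuclideanSpace.proj (𝕜 := ℂ) i : Cn n →L[ℂ] ℂ) ∘ (e ∘ boxSlice f E) from rfl, h1.fderiv]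
    rfl
  have h1 : ∀ v : Cn (n + 1), mfderiv 𝓘(ℂ, Cn (n + 1)) 𝓘(ℂ, Cn n) (e ∘ f) (E.symm p) v =
      L (R v).2 := by
    intro v
    have h2 := mfderiv_comp p
      ((hf.contMDiffAt_chart_comp he hx).mdifferentiableAt (by simp))
      ((hE.contMDiffAt_symm hp).mdifferentiableAt (by simp))
    have h3 : (e ∘ f) ∘ E.symm =ᶠ[𝓝 p] (e ∘ boxSlice f E) ∘ Prod.snd := by
      filter_upwards [E.open_target.mem_nhds hp] with q hq
      simp only [Function.comp_apply]
      rw [hE.apply_eq_boxSlice hσ0 hf hker hq]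
    have h4 : HasFDerivAt ((e ∘ boxSlice f E) ∘ Prod.snd)
        (L.comp (ContinuousLinearMap.snd ℂ ℂ (Cn n))) p :=
      hea.differentiableAt.hasFDerivAt.comp p (ContinuousLinearMap.snd ℂ ℂ (Cn n)).hasFDerivAt
    rw [h3.mfderiv_eq, mfderiv_eq_fderiv, h4.fderiv] at h2
    have h5 := DFunLike.congr_fun h2 (R v)
    refine Eq.trans ?_ h5.symm
    exact congrArg (mfderiv 𝓘(ℂ, Cn (n + 1)) 𝓘(ℂ, Cn n) (e ∘ f) (E.symm p)) (hR v).symm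
  have h2 : (fun i => mfderiv 𝓘(ℂ, Cn (n + 1)) 𝓘(ℂ, Cn n) (e ∘ f) (E.symm p) (w i)) =
      fun i => L (R (w i)).2 := funext fun i => h1 (w i)
  have h3 : σ.val (E.symm p) w = σ.param E.symm p (stdFrame n) *
      Matrix.det (Matrix.of fun i j => (R (w i)).2 j) := by
    rw [← hE.param_apply hp, DForm.param_apply]
    congr 1
    exact funext fun i => (hR _).symm
  have h4 : detForm n (fun i => L (EuclideanSpace.single i 1)) =
      σ.param E.symm p (stdFrame n) *
        baseJac σ hf.surjective (fun i b => e b i) (f (E.symm p)) := by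
    rw [hE.baseJac_mul hf hσ hσ0 hker hp hy, detForm_apply, ← Matrix.det_transpose]
    congr 1
    ext i j
    exact hLi _ _
  refine (congrArg (detForm n) h2).trans ?_
  rw [detForm_clm L, h4, h3, detForm_apply]
  ring

/-- The form on the regular locus that has, at each point, the coefficient `1 / m` in the preferred
chart at this point, where `m` is the Jacobian determinant of the coordinates of the chart. -/
noncomputable def invJacForm (m : (Fin n → B → ℂ) → B → ℂ) : DForm n n (regularLocus n B) :=
  fun b => ((m (fun i x => b.2.choose x i) b)⁻¹ • detForm n : Cn n [⋀^Fin n]→L[ℂ] ℂ)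

theorem invJacForm_apply (m : (Fin n → B → ℂ) → B → ℂ) (b : regularLocus n B) (w : Fin n → Cn n) :
    invJacForm m b w = (m (fun i x => b.2.choose x i) b)⁻¹ * detForm n w := rfl

/-- The form with coefficient `1 / m` pulls back to `σ`. -/
theorem pullback_invJacForm (hf : IsUniSmoothFibration n f) (hσ : σ.IsHolomorphic)
    (hσ0 : σ.NowhereVanishing) (hker : IsGivenByKernel n f σ)
    (hreg : ∀ b ∈ regularLocus n B, b ∉ degeneracyLocus (baseJac σ hf.surjective)) :
    DForm.pullback (regMap n f) (invJacForm (baseJac σ hf.surjective)) =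
      (DForm.pullback (Subtype.val : overReg n f → D) σ : DForm (n + 1) n (overReg n f)) := by
  funext x
  refine ContinuousAlternatingMap.ext fun w => ?_
  have he := (regMap n f x).2.choose_spec
  have h0 : baseJac σ hf.surjective (fun i b => (regMap n f x).2.choose b i) (f x) ≠ 0 := fun h =>
    hreg _ x.2 (((hasSlices_baseJac hf hσ hσ0 hker).mem_degeneracyLocus_iff_chart he.1 he.2).2 h)
  have h1 := detForm_mfderiv hf hσ hσ0 hker he.1 he.2 w
  have h2 : (fun i => mfderiv 𝓘(ℂ, Cn (n + 1)) 𝓘(ℂ, Cn n) (regMap n f) x (w i)) =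
      fun i => mfderiv 𝓘(ℂ, Cn (n + 1)) 𝓘(ℂ, Cn n) ((regMap n f x).2.choose ∘ f) (x : D) (w i) :=
    funext fun i => hf.mfderiv_regMap x (w i)
  have h3 : (fun i => mfderiv 𝓘(ℂ, Cn (n + 1)) 𝓘(ℂ, Cn (n + 1))
      (Subtype.val : overReg n f → D) x (w i)) = w := funext fun i => mfderiv_opens_val (E := Cn (n + 1)) x (w i)
  have h4 : DForm.pullback (regMap n f) (invJacForm (baseJac σ hf.surjective)) x w =
      (baseJac σ hf.surjective (fun i b => (regMap n f x).2.choose b i) (f x))⁻¹ *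
        detForm n (fun i => mfderiv 𝓘(ℂ, Cn (n + 1)) 𝓘(ℂ, Cn n) (regMap n f) x (w i)) := rfl
  have h5 : (DForm.pullback (Subtype.val : overReg n f → D) σ : DForm (n + 1) n (overReg n f)) x w =
      σ.val x (fun i => mfderiv 𝓘(ℂ, Cn (n + 1)) 𝓘(ℂ, Cn (n + 1))
        (Subtype.val : overReg n f → D) x (w i)) := rfl
  have h6 := congrArg (detForm n) h2
  have h7 := congrArg (σ.val x) h3
  refine h4.trans (Eq.trans ?_ (h5.trans h7).symm)
  refine (congrArg _ (h6.trans h1)).trans ?_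
  exact inv_mul_cancel_left₀ h0 _

/-- The fibration is submersive off the degeneracy locus: an `n`-tuple of vectors on which `σ` does not
vanish has linearly independent images. -/
theorem surjective_mfderiv_regMap (hf : IsUniSmoothFibration n f) (hσ : σ.IsHolomorphic)
    (hσ0 : σ.NowhereVanishing) (hker : IsGivenByKernel n f σ)
    (hreg : ∀ b ∈ regularLocus n B, b ∉ degeneracyLocus (baseJac σ hf.surjective))
    (x : overReg n f) :
    Function.Surjective (mfderiv 𝓘(ℂ, Cn (n + 1)) 𝓘(ℂ, Cn n) (regMap n f) x) := by
  have he := (regMap n f x).2.choose_spec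
  set L : Cn (n + 1) →L[ℂ] Cn n :=
    mfderiv 𝓘(ℂ, Cn (n + 1)) 𝓘(ℂ, Cn n) ((regMap n f x).2.choose ∘ f) (x : D) with hL
  suffices h : Function.Surjective L by
    intro w
    obtain ⟨v, hv⟩ := h w
    exact ⟨v, (hf.mfderiv_regMap x v).trans hv⟩
  have h0 : baseJac σ hf.surjective (fun i b => (regMap n f x).2.choose b i) (f x) ≠ 0 := fun h =>
    hreg _ x.2 (((hasSlices_baseJac hf hσ hσ0 hker).mem_degeneracyLocus_iff_chart he.1 he.2).2 h)
  obtain ⟨w, hw⟩ : ∃ w : Fin n → Cn (n + 1), σ.val x w ≠ 0 := by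
    by_contra! h
    exact hσ0 x (ContinuousAlternatingMap.ext h)
  have h1 : detForm n (fun i => L (w i)) ≠ 0 := by
    have h2 := detForm_mfderiv hf hσ hσ0 hker he.1 he.2 w
    exact ne_of_eq_of_ne h2 (mul_ne_zero h0 hw)
  have hli : LinearIndependent ℂ fun i => L (w i) := by
    by_contra h
    exact h1 ((detForm n).toAlternatingMap.map_linearDependent _ h)
  have hspan := hli.span_eq_top_of_card_eq_finrank' (by simp)
  have hrange : LinearMap.range L.toLinearMap = ⊤ := by
    rw [eq_top_iff, ← hspan, Submodule.span_le]
    rintro _ ⟨i, rfl⟩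
    exact ⟨w i, rfl⟩
  exact LinearMap.range_eq_top.1 hrange

theorem nowhereVanishing_invJacForm {m : (Fin n → B → ℂ) → B → ℂ} (H : HasSlices m)
    (hreg : ∀ b ∈ regularLocus n B, b ∉ degeneracyLocus m) : (invJacForm m).NowhereVanishing := by
  intro b h
  have h1 : invJacForm m b (fun i => (EuclideanSpace.single i 1 : Cn n)) = 0 :=
    DFunLike.congr_fun h _
  rw [invJacForm_apply, detForm_single, mul_one, inv_eq_zero] at h1
  exact hreg b b.2 ((H.mem_degeneracyLocus_iff_chart b.2.choose_spec.1 b.2.choose_spec.2).2 h1)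

/-- The coefficient in a fixed chart is `1 / m` with `m` the Jacobian determinant of the coordinates of
that chart, by the chain rule for Jacobian determinants. -/
theorem isHolomorphic_invJacForm {m : (Fin n → B → ℂ) → B → ℂ} (H : HasSlices m)
    (hreg : ∀ b ∈ regularLocus n B, b ∉ degeneracyLocus m) : (invJacForm m).IsHolomorphic := by
  intro b₀ v
  set c := chartAt (Cn n) b₀ with hc
  set e₀ : OpenPartialHomeomorph B (Cn n) := b₀.2.choose with he₀
  have hch : IsChart e₀ := b₀.2.choose_spec.1
  have hb₀ : (b₀ : B) ∈ e₀.source := b₀.2.choose_spec.2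
  have hcb : c b₀ = e₀ b₀ := rfl
  have hm : AnalyticAt ℂ (m (fun i x => e₀ x i) ∘ e₀.symm) (c b₀) := by
    have h1 := H.holAt_jac_of_mem_regularLocus b₀.2 fun i => hch.holAt_coord hb₀ i
    exact (hch _ hb₀ _).1 h1
  have hm0 : (m (fun i x => e₀ x i) ∘ e₀.symm) (c b₀) ≠ 0 := by
    intro h
    rw [hcb, Function.comp_apply, e₀.left_inv hb₀] at h
    exact hreg b₀ b₀.2 ((H.mem_degeneracyLocus_iff_chart hch hb₀).2 h)
  refine ((analyticAt_const (v := detForm n v)).fun_div hm hm0).congr ?_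
  filter_upwards [c.open_target.mem_nhds (c.map_source (mem_chart_source _ b₀)),
    hm.continuousAt.eventually_ne hm0] with p hp hmp
  set b : regularLocus n B := c.symm p with hb
  have hcsrc : b ∈ c.source := c.map_target hp
  have hbe : (b : B) ∈ e₀.source := by
    have h1 : b ∈ (e₀.subtypeRestr ⟨b₀⟩).source := hcsrc
    rwa [OpenPartialHomeomorph.subtypeRestr_source] at h1
  have hpb : e₀ b = p := c.right_inv hp
  have hbp : e₀.symm p = b := by rw [← hpb, e₀.left_inv hbe]
  set e : OpenPartialHomeomorph B (Cn n) := b.2.choose with he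
  have hech : IsChart e := b.2.choose_spec.1
  have hbe' : (b : B) ∈ e.source := b.2.choose_spec.2
  set L : Cn n →L[ℂ] Cn n := fderiv ℂ (e ∘ e₀.symm) p with hL
  have hya : ∀ i, HolAt (fun x => e x i) (b : B) := fun i => hech.holAt_coord hbe' i
  have hea : AnalyticAt ℂ (e ∘ e₀.symm) p := by
    have h1 : AnalyticAt ℂ (fun z i => e (e₀.symm z) i) p := AnalyticAt.pi fun i => by
      have h2 := (hch _ hbe _).1 (hya i)
      rwa [hpb] at h2
    exact ((PiLp.continuousLinearEquiv 2 ℂ (fun _ : Fin n => ℂ)).symm.analyticAt _).comp h1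
  have hder : ∀ w : Cn n, mfderiv 𝓘(ℂ, Cn n) 𝓘(ℂ, Cn n) c.symm p w = L w := by
    intro w
    rw [mfderiv_eq_mfderiv_chartAt ((contMDiffAt_symm_of_mem_maximalAtlas (n := ω)
        (IsManifold.chart_mem_maximalAtlas _) hp).mdifferentiableAt (by simp)) w]
    have h1 : chartAt (Cn n) (c.symm p) ∘ c.symm =ᶠ[𝓝 p] e ∘ e₀.symm := by
      filter_upwards [c.open_target.mem_nhds hp] with q hq
      have h2 : (c.symm q : B) ∈ e₀.source := by
        have h1 : c.symm q ∈ (e₀.subtypeRestr ⟨b₀⟩).source := c.map_target hq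
        rwa [OpenPartialHomeomorph.subtypeRestr_source] at h1
      have h3 : e₀ (c.symm q) = q := c.right_inv hq
      have h4 : e₀.symm q = c.symm q := by
        rw [← e₀.left_inv h2, h3]
      change e (c.symm q) = e (e₀.symm q)
      rw [h4]
    rw [h1.mfderiv_eq, mfderiv_eq_fderiv]
    rfl
  have h1 : (fun i => mfderiv 𝓘(ℂ, Cn n) 𝓘(ℂ, Cn n) c.symm p (v i)) = fun i => L (v i) :=
    funext fun i => hder (v i)
  have h2 := H.jac_eq_det_mul hch hbe hya
  have h3 : detForm n (fun i => L (EuclideanSpace.single i 1)) = Matrix.det (Matrix.of fun i k =>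
      fderiv ℂ ((fun x => e x i) ∘ e₀.symm) (e₀ b) (EuclideanSpace.single k 1)) := by
    rw [detForm_apply, ← Matrix.det_transpose, hpb]
    congr 1
    ext i j
    have h4 := ((EuclideanSpace.proj (𝕜 := ℂ) i : Cn n →L[ℂ] ℂ)).hasFDerivAt.comp p
      hea.differentiableAt.hasFDerivAt
    rw [Matrix.transpose_apply, Matrix.of_apply, Matrix.of_apply,
      show (fun b => e b i) ∘ e₀.symm =
      (EuclideanSpace.proj (𝕜 := ℂ) i : Cn n →L[ℂ] ℂ) ∘ (e ∘ e₀.symm) from rfl, h4.fderiv]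
    rfl
  have h4 : m (fun i x => e x i) b ≠ 0 := fun h =>
    hreg b b.2 ((H.mem_degeneracyLocus_iff_chart hech hbe').2 h)
  rw [Function.comp_apply, hbp] at hmp
  refine Eq.trans ?_ (Eq.trans (congrArg (invJacForm m b) h1) (invJacForm_apply m b _)).symm
  rw [detForm_clm L, h3]
  rw [Function.comp_apply, hbp]
  rw [h2] at h4
  have h5 := left_ne_zero_of_mul h4
  change _ = (m (fun i x => e x i) b)⁻¹ * _
  rw [h2]
  field_simp

end RegularPart

/-! ### Local equations of hypersurfaces -/

section LocalEquations

/-- In holomorphic coordinates, a function with nonzero differential is a local equation of its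
zero set. -/
theorem isLocalEquation_of_fderiv_ne_zero {M F : Type*} [TopologicalSpace M]
    [NormedAddCommGroup F] [NormedSpace ℂ F] [FiniteDimensional ℂ F] {j : ℕ} (hF : Module.finrank ℂ F = j + 1)
    {Hol : (M → ℂ) → M → Prop} {e : OpenPartialHomeomorph M F}
    (he : ∀ y ∈ e.source, ∀ φ, Hol φ y ↔ AnalyticAt ℂ (φ ∘ e.symm) (e y)) {E : Set M} {p v : F}
    (hp : p ∈ e.target) {u : F → ℂ} (hu : AnalyticAt ℂ u p) (huv : fderiv ℂ u p v ≠ 0)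
    (hpE : e.symm p ∈ E) (huE : ∀ᶠ q in 𝓝 p, (e.symm q ∈ E ↔ u q = 0)) :
    IsLocalEquation Hol E (e.symm p) (u ∘ e) := by
  have hsrc := e.map_target hp
  have hHol : ∀ {w : F → ℂ}, AnalyticAt ℂ w p → Hol (w ∘ e) (e.symm p) := by
    intro w hw
    rw [he _ hsrc, e.right_inv hp]
    refine hw.congr ?_
    filter_upwards [e.open_target.mem_nhds hp] with q hq
    simp [e.right_inv hq]
  have hec : Tendsto e (𝓝 (e.symm p)) (𝓝 p) := by
    have h1 := (e.continuousAt hsrc).tendsto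
    rwa [e.right_inv hp] at h1
  refine ⟨hHol hu, ?_, fun φ hφ hφE => ?_⟩
  · filter_upwards [hec.eventually huE, e.open_source.mem_nhds hsrc] with y h1 h2 h3
    rw [e.left_inv h2] at h1
    exact h1.1 h3
  · rw [he _ hsrc, e.right_inv hp] at hφ
    obtain ⟨w, hw, hwu⟩ := hu.exists_eq_mul_of_vanish hF huv (huE.self_of_nhds.1 hpE) hφ (by
      filter_upwards [huE, (e.continuousAt_symm hp).eventually hφE] with q h1 h2 h3
      exact h2 (h1.2 h3))
    refine ⟨w ∘ e, hHol hw, ?_⟩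
    filter_upwards [hec.eventually hwu, e.open_source.mem_nhds hsrc] with y h1 h2
    rw [Function.comp_apply, e.left_inv h2] at h1
    exact h1

end LocalEquations

/-! ### Multiplicities of fibres -/

section Multiplicity

variable {k : ℕ} {D B : Type*} [TopologicalSpace D] [ChartedSpace (Cn (k + 1 + 1)) D]
  [IsManifold 𝓘(ℂ, Cn (k + 1 + 1)) ω D] {σ : DForm (k + 1 + 1) (k + 1) D}
  [TopologicalSpace B] [ReducedComplexSpace B] {f : C(D, B)}

/-- Where the fibration is submersive, local equations of a divisor pull back to local equations:
a local section pulls a local equation of the preimage back to a multiple of a local equation of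
the divisor. -/
theorem IsLocalEquation.comp_eq_unit_mul (hf : IsUniSmoothFibration (k + 1) f)
    (hσ : σ.IsHolomorphic) (hσ0 : σ.NowhereVanishing) (hker : IsGivenByKernel (k + 1) f σ)
    (hdim : IsPureDim (k + 1) B) {E : Set B} (hE : IsPrimeDivisor (k + 1) E) {x : D}
    (hx : f x ∉ degeneracyLocus (baseJac σ hf.surjective)) (hxE : f x ∈ E) {u : B → ℂ} {v : D → ℂ}
    (hu : IsLocalEquation HolAt E (f x) u)
    (hv : IsLocalEquation (ManifoldHolAt (k + 1 + 1)) (f ⁻¹' E) x v) :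
    ∃ c : D → ℂ, ManifoldHolAt (k + 1 + 1) c x ∧ c x ≠ 0 ∧ u ∘ f =ᶠ[𝓝 x] c * v := by
  obtain ⟨c, hc, hcv⟩ := hv.2.2 _ (hf.holomorphic x u hu.1)
    (f.continuous.continuousAt.eventually hu.2.1)
  refine ⟨c, hc, fun hc0 => ?_, hcv⟩
  obtain ⟨e, he, hxe, hx0⟩ := exists_isFlowBox hσ hσ0 (hker.exists_kernel_vector hf) x
  have h0 : ((0 : ℂ), (0 : Cn (k + 1))) ∈ e.target := by
    have h1 := e.map_source hxe
    rwa [hx0] at h1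
  have hex : e.symm ((0 : ℂ), (0 : Cn (k + 1))) = x := by
    rw [show ((0 : ℂ), (0 : Cn (k + 1))) = e x from hx0.symm, e.left_inv hxe]
  have hg0 : boxSlice f e 0 = f x := congrArg f hex
  obtain ⟨a, ha, hxa, hax, -, hag⟩ := (he.isSlice hf hσ hσ0 hker).exists_isChart (z := 0) h0
    (by rwa [hg0])
  rw [hg0] at hxa hax
  -- the local section of `f` through `x`
  let τ : B → D := fun b => e.symm ((0 : ℂ), a b)
  have hτx : τ (f x) = x := by
    change e.symm ((0 : ℂ), a (f x)) = x
    rw [hax, hex]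
  have hι : ContinuousAt (fun z : Cn (k + 1) => e.symm ((0 : ℂ), z)) 0 :=
    (e.continuousAt_symm h0).comp_of_eq (f := fun z : Cn (k + 1) => ((0 : ℂ), z))
      (by fun_prop) rfl
  have hτc : Tendsto τ (𝓝 (f x)) (𝓝 x) := by
    have h1 : ContinuousAt τ (f x) :=
      ContinuousAt.comp_of_eq (g := fun z : Cn (k + 1) => e.symm ((0 : ℂ), z)) hι
        (a.continuousAt hxa) hax
    have h2 := h1.tendsto
    rwa [hτx] at h2
  have hfτ : ∀ᶠ b in 𝓝 (f x), f (τ b) = b := by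
    filter_upwards [a.open_source.mem_nhds hxa] with b hb
    have h1 := a.left_inv hb
    rw [hag] at h1
    exact h1
  have hvτ : HolAt (v ∘ τ) (f x) := by
    rw [ha _ hxa, hax]
    have h1 := (he.manifoldHolAt_iff hxe).1 hv.1
    rw [hx0] at h1
    have h2 : AnalyticAt ℂ (fun z : Cn (k + 1) => (v ∘ e.symm) ((0 : ℂ), z)) 0 :=
      h1.comp_of_eq (f := fun z : Cn (k + 1) => ((0 : ℂ), z))
        (analyticAt_const.prod analyticAt_id) rfl
    refine h2.congr ?_
    have h3 : a.target ∈ 𝓝 (0 : Cn (k + 1)) := a.open_target.mem_nhds (hax ▸ a.map_source hxa)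
    filter_upwards [h3] with z hz
    simp [τ, a.right_inv hz]
  obtain ⟨w, hw, hwu⟩ := hu.2.2 _ hvτ (by
    filter_upwards [hτc.eventually hv.2.1, hfτ] with b h1 h2 h3
    refine h1 ?_
    rwa [mem_preimage, h2])
  have hlim : Tendsto (fun b => c (τ b) * w b) (𝓝 (f x)) (𝓝 0) := by
    have h1 := (hc.continuousAt.tendsto.comp hτc).mul hw.continuousAt.tendsto
    rw [hc0, zero_mul] at h1
    exact h1
  have hu0 : ∀ᶠ b in 𝓝 (f x), u b = 0 := by
    filter_upwards [hlim.eventually_ne zero_ne_one, hτc.eventually hcv, hfτ, hwu]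
      with b h1 h2 h3 h4
    simp only [Function.comp_apply, Pi.mul_apply, h3] at h2 h4
    rw [h4, ← mul_assoc] at h2
    by_contra h5
    exact h1 (mul_right_cancel₀ h5 ((one_mul _).trans h2).symm)
  refine hE.notMem_nhds hdim hxE ?_
  obtain ⟨r, φ, hφ, hφE⟩ := hE.2.1 (f x)
  have hφ0 : ∀ i, ∀ᶠ b in 𝓝 (f x), φ i b = 0 := by
    intro i
    obtain ⟨q, -, hq⟩ := hu.2.2 _ (hφ i) (by filter_upwards [hφE] with b h1 h2 using h1.1 h2 i)
    filter_upwards [hq, hu0] with b h1 h2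
    rw [h1, Pi.mul_apply, h2, mul_zero]
  filter_upwards [hφE, eventually_all.2 hφ0] with b h1 h2 using h1.2 h2

/-- The multiplicity of the fibration along a prime divisor is one. Local equations exist at points over
a smooth point of the divisor. -/
theorem hasFibreMultiplicity_one (hf : IsUniSmoothFibration (k + 1) f)
    (hσ : σ.IsHolomorphic) (hσ0 : σ.NowhereVanishing) (hker : IsGivenByKernel (k + 1) f σ)
    (hdim : IsPureDim (k + 1) B)
    (hm : ∀ b y, (∀ i, HolAt (y i) b) → HolAt (baseJac σ hf.surjective y) b)
    {E : Set B} (hE : IsPrimeDivisor (k + 1) E) : HasFibreMultiplicity (k + 1) f E 1 := by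
  have H := hasSlices_baseJac hf hσ hσ0 hker
  refine ⟨le_rfl, ?_, fun x hxE u v hu hv => ?_⟩
  · obtain ⟨b, hbE, hb⟩ := H.exists_mem_notMem_degeneracyLocus hm hdim hE
    obtain ⟨x, rfl⟩ := hf.surjective b
    obtain ⟨e, he, hxe, hx0⟩ := exists_isFlowBox hσ hσ0 (hker.exists_kernel_vector hf) x
    have h0 : ((0 : ℂ), (0 : Cn (k + 1))) ∈ e.target := by
      have h1 := e.map_source hxe
      rwa [hx0] at h1
    have hg0 : boxSlice f e 0 = f x := by
      change f (e.symm 0) = f x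
      rw [← hx0, e.left_inv hxe]
    have hs := he.isSlice hf hσ hσ0 hker
    obtain ⟨a, ha, hxa, hax, haT, hag⟩ := hs.exists_isChart (z := 0) h0 (by rwa [hg0])
    obtain ⟨p, hp, hpE, u, v, hu, huv, huE⟩ := hs.exists_smooth_divisor hdim hE ha haT hag
      (hax ▸ a.map_source hxa) (by rwa [hg0])
    have hpe : ((0 : ℂ), p) ∈ e.target := haT hp
    have hpa : a.symm p ∈ a.source := a.map_target hp
    refine ⟨⟨e.symm ((0 : ℂ), p), a, ha, ?_⟩, hpE, ⟨u ∘ a, ?_⟩, (u ∘ Prod.snd) ∘ e, ?_⟩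
    · rw [hag] at hpa
      exact hpa
    · have h1 := isLocalEquation_of_fderiv_ne_zero (j := k) (by simp) ha hp hu huv
        (E := E) (by rwa [hag]) (by rwa [hag])
      rw [hag] at h1
      exact h1
    · have hu' : AnalyticAt ℂ (u ∘ Prod.snd) ((0 : ℂ), p) :=
        hu.comp_of_eq (f := Prod.snd) analyticAt_snd rfl
      have hd : HasFDerivAt (u ∘ Prod.snd) ((fderiv ℂ u p).comp
          (ContinuousLinearMap.snd ℂ ℂ (Cn (k + 1)))) ((0 : ℂ), p) :=
        hu.differentiableAt.hasFDerivAt.comp ((0 : ℂ), p)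
          (ContinuousLinearMap.snd ℂ ℂ (Cn (k + 1))).hasFDerivAt
      refine isLocalEquation_of_fderiv_ne_zero (j := k + 1) (v := ((0 : ℂ), v)) ?_
        (fun y hy φ => he.manifoldHolAt_iff hy) hpe hu' ?_ hpE ?_
      · simp [add_comm]
      · rw [hd.fderiv]
        exact huv
      · have h1 : Tendsto (Prod.snd : ℂ × Cn (k + 1) → Cn (k + 1)) (𝓝 ((0 : ℂ), p)) (𝓝 p) :=
          continuous_snd.tendsto _
        filter_upwards [h1.eventually huE, e.open_target.mem_nhds hpe] with q h2 h3
        rw [mem_preimage, he.apply_eq_boxSlice hσ0 hf hker h3]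
        exact h2
  · rw [pow_one]
    exact IsLocalEquation.comp_eq_unit_mul hf hσ hσ0 hker hdim hE
      (H.notMem_degeneracyLocus hm x.2) hxE hu hv

theorem orbifoldDivisor_eq_zero (hf : IsUniSmoothFibration (k + 1) f)
    (hσ : σ.IsHolomorphic) (hσ0 : σ.NowhereVanishing) (hker : IsGivenByKernel (k + 1) f σ)
    (hdim : IsPureDim (k + 1) B)
    (hm : ∀ b y, (∀ i, HolAt (y i) b) → HolAt (baseJac σ hf.surjective y) b) :
    orbifoldDivisor (k + 1) f = 0 := by
  funext ⟨E, hE⟩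
  have h1 := hasFibreMultiplicity_one hf hσ hσ0 hker hdim hm hE
  have h2 : fibreMultiplicity (k + 1) f E = 1 :=
    le_antisymm (Nat.sInf_le h1) (le_csInf ⟨1, h1⟩ fun m hm => hm.1)
  simp [orbifoldDivisor, h2]

end Multiplicity

/-! ### Descent of the form and triviality of the canonical bundle -/

theorem lemma2p3 (n : ℕ) (hn : 1 ≤ n)
    (D : Type*) [TopologicalSpace D] [ChartedSpace (Cn (n + 1)) D]
    [IsManifold 𝓘(ℂ, Cn (n + 1)) ω D] [T2Space D] [SecondCountableTopology D] [ConnectedSpace D]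
    (B : Type*) [TopologicalSpace B] [ReducedComplexSpace B] [T2Space B]
    (hdim : ReducedComplexSpace.IsPureDim n B) (hnormal : ReducedComplexSpace.IsNormal n B)
    (f : C(D, B)) (hf : IsUniSmoothFibration n f)
    (σ : DForm (n + 1) n D) (hσ : σ.IsHolomorphic) (hσ0 : σ.NowhereVanishing)
    (hker : IsGivenByKernel n f σ) :
    -- no multiple fibres in codimension one, and the form descends off codimension two
    (∃ Z : Set B, ReducedComplexSpace.IsAnalyticSet Z ∧
      (∀ b ∈ Z, ReducedComplexSpace.localDim Z b + 2 ≤ n) ∧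
      Zᶜ ⊆ ReducedComplexSpace.regularLocus n B) ∧
    (∀ x : overReg n f, Function.Surjective
      (mfderiv 𝓘(ℂ, Cn (n + 1)) 𝓘(ℂ, Cn n) (regMap n f) x)) ∧
    orbifoldDivisor n f = 0 ∧
    (∃ α : DForm n n (ReducedComplexSpace.regularLocus n B),
      α.IsHolomorphic ∧ α.NowhereVanishing ∧
      DForm.pullback (regMap n f) α =
        (DForm.pullback (Subtype.val : overReg n f → D) σ : DForm (n + 1) n (overReg n f))) ∧
    CanonicalClassTrivial n B := by
  obtain ⟨k, rfl⟩ : ∃ k, n = k + 1 := ⟨n - 1, by omega⟩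
  have H := hasSlices_baseJac hf hσ hσ0 hker
  have hm : ∀ b y, (∀ i, HolAt (y i) b) → HolAt (baseJac σ hf.surjective y) b :=
    fun b y hy => H.holAt_jac hnormal hy
  have hreg : ∀ b ∈ regularLocus (k + 1) B, b ∉ degeneracyLocus (baseJac σ hf.surjective) :=
    fun b hb => H.notMem_degeneracyLocus hm hb
  have hhol := isHolomorphic_invJacForm H hreg
  have hnv := nowhereVanishing_invJacForm H hreg
  exact ⟨⟨_, H.isAnalyticSet_degeneracyLocus hm,
      fun b hb => H.localDim_degeneracyLocus hm (hdim b) hb, fun b hb => H.mem_regularLocus hb⟩,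
    surjective_mfderiv_regMap hf hσ hσ0 hker hreg,
    orbifoldDivisor_eq_zero hf hσ hσ0 hker hdim hm,
    ⟨_, hhol, hnv, pullback_invJacForm hf hσ hσ0 hker hreg⟩, _, hhol, hnv⟩
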